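/- Let $k$ be a field of characteristic $5$ and let $\Sigma_5$ be the symmetric group on $5$ letters. For a partition $\lambda$ of $5$ let $S^\lambda$ be the Specht module over $k$ (the submodule of the permutation module on $\lambda$-tabloids spanned by the polytabloids), let $S_\lambda=(S^\lambda)^*$ be the dual Specht module, and for $5$-restricted $\lambda$ (that is, $\lambda_i-\lambda_{i+1}<5$ for all $i$) let $D_\lambda=\operatorname{soc}(S^\lambda)$ be the corresponding simple module. A (dual) Specht filtration of a $k\Sigma_5$-module is a finite filtration by submodules each of whose successive quotients is isomorphic to some $S^\lambda$ (respectively $S_\lambda$), $\lambda\vdash 5$. Let $\Omega$ be the Heller translate: $\Omega(M)$ is the kernel of a projective cover of $M$. Let $U\cong\Omega^2(D_{(2,1,1,1)})$. Then: (i) $U\otimes_k U$, with the diagonal action, has neither a Specht filtration nor a dual Specht filtration. (ii) $\operatorname{Ext}^1_{k\Sigma_5}(U,U^*)\cong k$ as $k$-vector spaces. (iii) $U$ does not lift to characteristic zero: there are no discrete valuation ring $\mathcal O$ of characteristic zero with residue field $k$ and $\mathcal O\Sigma_5$-module $L$, free of finite rank over $\mathcal O$, with $k\otimes_{\mathcal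 O}L\cong U$. (iv) $U$ is indecomposable, and every Sylow $5$-subgroup $P$ of $\Sigma_5$ is a vertex of $U$, with source $\operatorname{rad}^2(kP)$; and $\operatorname{rad}^2(kP)$ is, up to isomorphism, the unique finite-dimensional indecomposable $kP$-module of Loewy length three. -/

import Mathlib

open scoped MonoidAlgebra TensorProduct

universe u v w

/-! ### Representations of a group, that is, modules over the group algebra -/

section Generalities

variable {k : Type u} [Field k] {G : Type w} [Group G] {V : Type v} [AddCommGroup V] [Module k V]

/-- The socle: the sum of all simple submodules. -/
noncomputable def socleSub (ρ : Representation k G V) : Subrepresentation ρ :=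
  Subrepresentation.ofSubmodule' (sSup {N : Submodule k[G] ρ.asModule | IsAtom N})

/-- The submodule `rad ^ n (M) = J ^ n • M` of a module `M` over a ring `R` with Jacobson
radical `J`. -/
def radicalPower (R : Type u) (M : Type v) [Ring R] [AddCommGroup M] [Module R M] :
    ℕ → Submodule R M
  | 0 => ⊤
  | n + 1 => Ring.jacobson R • radicalPower R M n

/-- The subrepresentation `rad ^ n (V)`. -/
noncomputable def radicalSub (ρ : Representation k G V) (n : ℕ) : Subrepresentation ρ :=
  Subrepresentation.ofSubmodule' (radicalPower k[G] ρ.asModule n)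

/-- `n` is the Loewy length: the least `n` with `rad ^ n (V) = 0`. -/
def HasLoewyLength (ρ : Representation k G V) (n : ℕ) : Prop :=
  IsLeast {m : ℕ | radicalSub ρ m = ⊥} n

/-- `ρ` is nonzero and is not the direct sum of two nonzero subrepresentations. -/
def IsIndecomposableRep (ρ : Representation k G V) : Prop :=
  Nontrivial V ∧ ∀ A B : Subrepresentation ρ, IsCompl A B → A = ⊥ ∨ B = ⊥

/-- `ρ` is isomorphic to a direct summand of `σ`. -/
def IsDirectSummandOf (ρ : Representation k G V) {W : Type*} [AddCommGroup W] [Module k W]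
    (σ : Representation k G W) : Prop :=
  ∃ (i : ρ.IntertwiningMap σ) (q : σ.IntertwiningMap ρ), ∀ x, q (i x) = x

/-- `f` is a projective cover: its source is projective and `f` is an epimorphism whose kernel
is superfluous. -/
def IsProjectiveCover {ρ : Representation k G V} {P : Type*} [AddCommGroup P] [Module k P]
    {π : Representation k G P} (f : π.IntertwiningMap ρ) : Prop :=
  Module.Projective k[G] π.asModule ∧ Function.Surjective f ∧
    ∀ N : Subrepresentation π, N ⊔ f.ker = ⊤ → N = ⊤

/-- `σ ≅ Ω(ρ)`: `σ` is isomorphic to the kernel of a projective cover of `ρ`. -/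
def IsHellerTranslate (ρ : Representation k G V) {W : Type v} [AddCommGroup W] [Module k W]
    (σ : Representation k G W) : Prop :=
  ∃ (P : Type v) (_ : AddCommGroup P) (_ : Module k P) (π : Representation k G P)
    (f : π.IntertwiningMap ρ),
    IsProjectiveCover f ∧ Nonempty (σ.Equiv f.ker.toRepresentation)

/-- `σ ≅ Ω²(ρ) = Ω(Ω(ρ))`. -/
def IsHellerTranslateSq (ρ : Representation k G V) {W : Type v} [AddCommGroup W] [Module k W]
    (σ : Representation k G W) : Prop :=
  ∃ (L : Type v) (_ : AddCommGroup L) (_ : Module k L) (τ : Representation k G L),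
    IsHellerTranslate ρ τ ∧ IsHellerTranslate τ σ

end Generalities

/-! ### Specht modules and simple modules of symmetric groups -/

section Specht

/-- A tableau of shape `μ`: a bijective filling of the cells of `μ` with the numbers in `Fin d`
(so there are none unless `μ` has exactly `d` cells). -/
abbrev YTableau (μ : YoungDiagram) (d : ℕ) : Type := μ.cells ≃ Fin d

/-- A `μ`-tabloid is a row equivalence class of tableaux of shape `μ`, recorded as the function
that sends each entry to the index of the row containing it. -/
def Tabloid (μ : YoungDiagram) (d : ℕ) : Type :=
  {f : Fin d → ℕ // ∃ t : YTableau μ d, ∀ x, f x = (t.symm x).1.1}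

/-- The tabloid `{t}` of a tableau `t`. -/
def YTableau.tabloid {μ : YoungDiagram} {d : ℕ} (t : YTableau μ d) : Tabloid μ d :=
  ⟨fun x => (t.symm x).1.1, t, fun _ => rfl⟩

/-- Permutations act on tabloids by permuting the entries. -/
instance Tabloid.instMulAction (μ : YoungDiagram) (d : ℕ) :
    MulAction (Equiv.Perm (Fin d)) (Tabloid μ d) where
  smul g f := ⟨fun x => f.1 (g⁻¹ x), by
    obtain ⟨t, ht⟩ := f.2
    exact ⟨t.trans g, fun x => ht _⟩⟩
  one_smul f := rfl
  mul_smul g h f := by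
    apply Subtype.ext
    funext x
    change f.1 ((g * h)⁻¹ x) = f.1 (h⁻¹ (g⁻¹ x))
    rw [mul_inv_rev]
    rfl

/-- The permutation module `M^μ` on the `μ`-tabloids. -/
noncomputable abbrev tabloidRep (k : Type u) [Field k] (μ : YoungDiagram) (d : ℕ) :
    Representation k (Equiv.Perm (Fin d)) k[Tabloid μ d] :=
  Representation.ofMulAction k (Equiv.Perm (Fin d)) (Tabloid μ d)

/-- The column stabilizer `C_t` of a tableau `t`. -/
def YTableau.columnStabilizer {μ : YoungDiagram} {d : ℕ} (t : YTableau μ d) :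
    Finset (Equiv.Perm (Fin d)) :=
  {σ | ∀ x, (t.symm (σ x)).1.2 = (t.symm x).1.2}

/-- The polytabloid `e_t = ∑_{σ ∈ C_t} sgn(σ) σ{t}`. -/
noncomputable def YTableau.polytabloid (k : Type u) [Field k] {μ : YoungDiagram} {d : ℕ}
    (t : YTableau μ d) : k[Tabloid μ d] :=
  ∑ σ ∈ t.columnStabilizer,
    MonoidAlgebra.single (σ • t.tabloid) (((Equiv.Perm.sign σ : ℤˣ) : ℤ) : k)

theorem YTableau.map_polytabloid (k : Type u) [Field k] {μ : YoungDiagram} {d : ℕ}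
    (g : Equiv.Perm (Fin d)) (t : YTableau μ d) :
    tabloidRep k μ d g (t.polytabloid k) = YTableau.polytabloid k (μ := μ) (t.trans g) := by
  have htab : YTableau.tabloid (μ := μ) (t.trans g) = g • t.tabloid := rfl
  unfold YTableau.polytabloid
  rw [map_sum]
  refine Finset.sum_bij' (fun σ _ => g * σ * g⁻¹) (fun σ _ => g⁻¹ * σ * g) ?_ ?_ ?_ ?_ ?_
  · intro σ hσ
    simp only [YTableau.columnStabilizer, Finset.mem_filter, Finset.mem_univ, true_and] at hσ ⊢
    intro x
    simpa using hσ (g⁻¹ x)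
  · intro σ hσ
    simp only [YTableau.columnStabilizer, Finset.mem_filter, Finset.mem_univ, true_and] at hσ ⊢
    intro x
    simpa using hσ (g x)
  · intro σ _
    group
  · intro σ _
    group
  · intro σ _
    rw [Representation.ofMulAction_single, htab, smul_smul, smul_smul]
    simp [mul_right_comm]

/-- The Specht module `S^μ`: the submodule of `M^μ` spanned by the polytabloids. -/
noncomputable def spechtSub (k : Type u) [Field k] (μ : YoungDiagram) (d : ℕ) :
    Subrepresentation (tabloidRep k μ d) where
  toSubmodule := Submodule.span k (Set.range fun t : YTableau μ d => t.polytabloid k)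
  apply_mem_toSubmodule g v hv := by
    induction hv using Submodule.span_induction with
    | mem x hx =>
      obtain ⟨t, rfl⟩ := hx
      rw [YTableau.map_polytabloid]
      exact Submodule.subset_span ⟨_, rfl⟩
    | zero => simp
    | add x y _ _ hx hy => rw [map_add]; exact Submodule.add_mem _ hx hy
    | smul a x _ hx => rw [map_smul]; exact Submodule.smul_mem _ _ hx

/-- The underlying vector space of the Specht module `S^μ`. -/
def SpechtModule (k : Type u) [Field k] (μ : YoungDiagram) (d : ℕ) : Type u :=
  (spechtSub k μ d).toSubmodule

noncomputable instance (k : Type u) [Field k] (μ : YoungDiagram) (d : ℕ) :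
    AddCommGroup (SpechtModule k μ d) :=
  inferInstanceAs (AddCommGroup (spechtSub k μ d).toSubmodule)

noncomputable instance (k : Type u) [Field k] (μ : YoungDiagram) (d : ℕ) :
    Module k (SpechtModule k μ d) :=
  inferInstanceAs (Module k (spechtSub k μ d).toSubmodule)

/-- The Specht module `S^μ` as a representation of the symmetric group. -/
noncomputable def spechtRep (k : Type u) [Field k] (μ : YoungDiagram) (d : ℕ) :
    Representation k (Equiv.Perm (Fin d)) (SpechtModule k μ d) :=
  (spechtSub k μ d).toRepresentation

/-- The module `D_μ := soc(S^μ)`; for `p`-restricted `μ`, with `p = char k`, these are the simple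
modules of the symmetric group. -/
noncomputable abbrev simpleRep (k : Type u) [Field k] (μ : YoungDiagram) (d : ℕ) :
    Representation k (Equiv.Perm (Fin d)) (socleSub (spechtRep k μ d)).toSubmodule :=
  (socleSub (spechtRep k μ d)).toRepresentation

/-- The partition `(2, 1, 1, 1)` of `5`. -/
def partition2111 : YoungDiagram := YoungDiagram.ofRowLens [2, 1, 1, 1] (by decide)

/-- The subquotient `B / A` of `ρ` is isomorphic to `σ`: one has `A ≤ B`, and `σ` is the image of
an intertwining map on `B` with kernel `A`. -/
def SubquotientIso {k : Type u} [Field k] {G : Type w} [Group G] {V : Type v} [AddCommGroup V]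
    [Module k V] {ρ : Representation k G V} (A B : Subrepresentation ρ) {W : Type*}
    [AddCommGroup W] [Module k W] (σ : Representation k G W) : Prop :=
  A ≤ B ∧ ∃ f : B.toRepresentation.IntertwiningMap σ,
    Function.Surjective f ∧ ∀ x : B.toSubmodule, f x = 0 ↔ (x : V) ∈ A

/-- There is a filtration `0 = F 0 ≤ F 1 ≤ ... ≤ F n = V` by subrepresentations, each subquotient
`F (i + 1) / F i` of which is isomorphic to the Specht module `S^μ` for some partition `μ` of
`d`. -/
def HasSpechtFiltration {k : Type u} [Field k] {d : ℕ} {V : Type v} [AddCommGroup V]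
    [Module k V] (ρ : Representation k (Equiv.Perm (Fin d)) V) : Prop :=
  ∃ (n : ℕ) (F : Fin (n + 1) → Subrepresentation ρ), F 0 = ⊥ ∧ F (Fin.last n) = ⊤ ∧
    ∀ i : Fin n, ∃ μ : YoungDiagram, μ.card = d ∧
      SubquotientIso (F i.castSucc) (F i.succ) (spechtRep k μ d)

/-- The same with the dual Specht modules `S_μ = (S^μ)^*`. -/
def HasDualSpechtFiltration {k : Type u} [Field k] {d : ℕ} {V : Type v} [AddCommGroup V]
    [Module k V] (ρ : Representation k (Equiv.Perm (Fin d)) V) : Prop :=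
  ∃ (n : ℕ) (F : Fin (n + 1) → Subrepresentation ρ), F 0 = ⊥ ∧ F (Fin.last n) = ⊤ ∧
    ∀ i : Fin n, ∃ μ : YoungDiagram, μ.card = d ∧
      SubquotientIso (F i.castSucc) (F i.succ) (spechtRep k μ d).dual

end Specht

/-! ### Lifting, vertices and sources -/

section ModularRepresentations

/-- Extension of scalars of a representation. -/
noncomputable def baseChangeRep {O : Type w} (k : Type u) [CommRing O] [Field k] [Algebra O k]
    {G L : Type*} [Group G] [AddCommGroup L] [Module O L] (τ : Representation O G L) :
    Representation k G (k ⊗[O] L) :=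
  ((Module.End.baseChangeHom O k L : Module.End O L →* Module.End k (k ⊗[O] L))).comp τ

/-- `ρ` lifts to characteristic zero: there are a discrete valuation ring `O` of characteristic
zero with residue field `k` and an `O`-free `OG`-lattice `L` of finite rank with
`k ⊗ L ≅ ρ`. Completeness of `O` is not demanded. -/
def LiftsToCharZero.{o, a, b, c} {k : Type a} [Field k] {G : Type b} [Group G] {V : Type c}
    [AddCommGroup V] [Module k V] (ρ : Representation k G V) : Prop :=
  ∃ (O : Type o) (_ : CommRing O) (_ : IsDomain O) (_ : IsDiscreteValuationRing O)
    (_ : CharZero O) (_ : Algebra O k) (L : Type o) (_ : AddCommGroup L) (_ : Module O L)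
    (τ : Representation O G L),
    Function.Surjective (algebraMap O k) ∧ Module.Free O L ∧ Module.Finite O L ∧
      Nonempty ((baseChangeRep k τ).Equiv ρ)

/-- `ρ` is relatively `H`-projective: it is a direct summand of `Ind_H^G Res_H ρ`. -/
def IsRelativelyProjective {k : Type u} [Field k] {G : Type*} [Group G] (H : Subgroup G)
    {V : Type v} [AddCommGroup V] [Module k V] (ρ : Representation k G V) : Prop :=
  IsDirectSummandOf ρ (Representation.ind H.subtype (ρ.comp H.subtype))

/-- `Q` is a vertex of `ρ`: the representation `ρ` is indecomposable, and `Q` is minimal among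
the subgroups relative to which it is projective. -/
def IsVertex {k : Type u} [Field k] {G : Type*} [Group G] (Q : Subgroup G)
    {V : Type v} [AddCommGroup V] [Module k V] (ρ : Representation k G V) : Prop :=
  IsIndecomposableRep ρ ∧
    Minimal (fun H : Subgroup G => IsRelativelyProjective H ρ) Q

/-- `σ` is a source of `ρ` on the vertex `Q`: a finite-dimensional indecomposable representation
of `Q` such that `ρ` is a direct summand of `Ind_Q^G σ`. -/
def IsSource {k : Type u} [Field k] {G : Type*} [Group G] (Q : Subgroup G)
    {V : Type v} [AddCommGroup V] [Module k V] (ρ : Representation k G V)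
    {W : Type w} [AddCommGroup W] [Module k W] (σ : Representation k Q W) : Prop :=
  IsVertex Q ρ ∧ Module.Finite k W ∧ IsIndecomposableRep σ ∧
    IsDirectSummandOf ρ (Representation.ind Q.subtype σ)

/-- The representation `rad ^ n (kQ)` of `Q`, a subrepresentation of the regular one. -/
noncomputable abbrev radicalPowerRep (k : Type u) [Field k] (Q : Type v) [Group Q] (n : ℕ) :
    Representation k Q (radicalSub (Representation.leftRegular k Q) n).toSubmodule :=
  (radicalSub (Representation.leftRegular k Q) n).toRepresentation

/-- The `k`-space `Ext^n_{kG}(ρ, σ)`. -/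
noncomputable abbrev ExtRep {k : Type u} [Field k] {G : Type} [Group G] {V W : Type u}
    [AddCommGroup V] [Module k V] [AddCommGroup W] [Module k W]
    (ρ : Representation k G V) (σ : Representation k G W) (n : ℕ) : Type u :=
  CategoryTheory.Abelian.Ext (ModuleCat.of k[G] ρ.asModule) (ModuleCat.of k[G] σ.asModule) n

end ModularRepresentations

/-! Let L_n be the space of alternating n-forms on k^5, with the permutation action. It carries two
Koszul differentials: the exterior product e with the sum of the coordinates (`wedgeSum`) and the
contraction d with the all-ones vector (`contractSum`). Both are exact, and since the sum of the
coordinates takes the value 5 = 0 on the all-ones vector, they anticommute. The modules L_1, ...,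
L_4 are projective (`hasHigmanElement_altRep`). A nonzero equivariant map L_m → L_n needs |m - n| ≤
1, and for |m - n| = 1 it is a multiple of e or d.

This makes U explicit. The socle of the Specht module of (2,1,1,1) is L_3 / ker(ed)
(`socleSub_partition2111`). The kernel of ed on L_3 is the image of the total map (f, h) ↦ ef + dh
on L_2 ⊕ L_4, so U is the kernel of that total map. The identification with an arbitrary Heller
translate (`IsHellerTranslate.equiv_ker`) needs no minimality: it is enough that the kernels have
only scalar endomorphisms and are not projective. The second fact is read off from dimensions modulo
5. Dually, U^* is the kernel of the total map L_1 ⊕ L_3 → L_2 (`nonempty_equiv_dual_ker_totalMap`).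

(i) The first cohomology of every dual Specht module vanishes (`h1Trivial_dual_spechtRep`): hooks
are presented by the L_n, and the two other shapes are separated from the trivial module by the sum
of the transpositions. A dual Specht filtration of U ⊗ U would thus kill Ext^1(U^*, U), a Specht
filtration Ext^1(U, U^*). Both are nonzero: otherwise a projection of the kernel would lift, giving
a nonzero scalar endomorphism through a projective, which the trace forbids because dim U is
invertible in k (`HasHigmanElement.eq_zero_of_factor`).

(ii) In 0 → U^* → L_1 ⊕ L_3 → I → 0 the middle term is injective, Hom(U, I) is spanned by one map,
and that map does not lift.

(iii) A 5-cycle acts on U with at most two Jordan blocks, one of size 5, so dim U = 8. On a lift its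
fixed lattice has rank r = 1 or 2. The nontrivial powers of the 5-cycle are conjugate, so their
common trace t, an algebraic integer, satisfies 8 + 4t = 5r, which is impossible.

(iv) U has scalar endomorphisms and is not projective, so its vertex is a Sylow subgroup P of order
5. Restricted to P it is kP plus a block of size 3, which is rad^2(kP), and a trace computation
shows that U is a summand of the module induced from that block. -/

/-! ### Wedge products and contractions of alternating forms -/

section Koszul

namespace AlternatingMap

variable {R : Type*} {M : Type*} [CommRing R] [AddCommGroup M] [Module R M] {n : ℕ}

/-- The exterior product with a linear form, on the left. -/
def wedgeLeft (φ : M →ₗ[R] R) : (M [⋀^Fin n]→ₗ[R] R) →ₗ[R] M [⋀^Fin (n + 1)]→ₗ[R] R :=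
  alternatizeUncurryFinLM ∘ₗ LinearMap.smulRightₗ φ

theorem wedgeLeft_apply (φ : M →ₗ[R] R) (f : M [⋀^Fin n]→ₗ[R] R) (v : Fin (n + 1) → M) :
    wedgeLeft φ f v = ∑ i : Fin (n + 1), (-1) ^ (i : ℕ) * (φ (v i) * f (i.removeNth v)) := by
  simp [wedgeLeft, alternatizeUncurryFin_apply]

theorem wedgeLeft_wedgeLeft (φ : M →ₗ[R] R) (f : M [⋀^Fin n]→ₗ[R] R) :
    wedgeLeft φ (wedgeLeft φ f) = 0 := by
  have h := alternatizeUncurryFin_alternatizeUncurryFinLM_comp_of_symmetric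
    (f := φ.smulRight (φ.smulRight f)) (by intro x y; simp [smul_smul, mul_comm])
  rw [← h]
  ext v
  simp [wedgeLeft, alternatizeUncurryFin_apply]

/-- Contraction is an antiderivation. Exactness of both differentials and their anticommutation all
come from this one identity. -/
theorem curryLeft_wedgeLeft (φ : M →ₗ[R] R) (f : M [⋀^Fin (n + 1)]→ₗ[R] R) (m : M) :
    (wedgeLeft φ f).curryLeft m = φ m • f - wedgeLeft φ (f.curryLeft m) := by
  ext v
  simp only [curryLeft_apply_apply, wedgeLeft_apply, sub_apply, smul_apply]
  rw [Fin.sum_univ_succ]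
  simp only [Fin.val_zero, pow_zero, one_mul, Matrix.cons_val_zero, Fin.val_succ, smul_eq_mul,
    Matrix.cons_val_succ, sub_eq_add_neg, ← Finset.sum_neg_distrib]
  congr 1
  refine Finset.sum_congr rfl fun i _ => ?_
  have : i.succ.removeNth (Matrix.vecCons m v) = Matrix.vecCons m (i.removeNth v) := by
    ext j
    refine Fin.cases ?_ (fun j => ?_) j <;> simp [Fin.removeNth]
  rw [this]
  ring

/-- In degree zero there is nothing left to contract, so the second term of the antiderivation rule
is absent. -/
theorem curryLeft_wedgeLeft_zero (φ : M →ₗ[R] R) (f : M [⋀^Fin 0]→ₗ[R] R) (m : M) :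
    (wedgeLeft φ f).curryLeft m = φ m • f := by
  ext v
  simp only [curryLeft_apply_apply, wedgeLeft_apply, smul_apply]
  simp [Fin.removeNth_zero]

theorem wedgeLeft_compLinearMap (φ : M →ₗ[R] R) (f : M [⋀^Fin n]→ₗ[R] R) (p : M →ₗ[R] M) :
    (wedgeLeft φ f).compLinearMap p = wedgeLeft (φ ∘ₗ p) (f.compLinearMap p) := by
  ext v
  simp only [compLinearMap_apply, wedgeLeft_apply]
  rfl

theorem curryLeft_compLinearMap' (f : M [⋀^Fin (n + 1)]→ₗ[R] R) (p : M →ₗ[R] M) (m : M) :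
    (f.compLinearMap p).curryLeft m = (f.curryLeft (p m)).compLinearMap p := by
  ext v
  simp only [compLinearMap_apply, curryLeft_apply_apply]
  congr 1
  ext j
  refine Fin.cases ?_ (fun j => ?_) j <;> simp

end AlternatingMap

/-! ### Alternating forms on `k ^ 5` and the two Koszul differentials. -/

variable (k : Type u) [Field k]

/-- Alternating forms of degree `n` on `k ^ 5`. -/
abbrev AltForm (n : ℕ) : Type u := (Fin 5 → k) [⋀^Fin n]→ₗ[k] k

/-- The action of the symmetric group on alternating forms by permutation of the coordinates. -/
def altRep (n : ℕ) : Representation k (Equiv.Perm (Fin 5)) (AltForm k n) where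
  toFun g :=
    { toFun := fun f => f.compLinearMap (LinearMap.funLeft k k g)
      map_add' := fun _ _ => rfl
      map_smul' := fun _ _ => rfl }
  map_one' := by ext; rfl
  map_mul' g h := by ext; rfl

variable {k}

theorem altRep_def {n : ℕ} (g : Equiv.Perm (Fin 5)) (f : AltForm k n) :
    altRep k n g f = f.compLinearMap (LinearMap.funLeft k k g) := rfl

theorem altRep_apply {n : ℕ} (g : Equiv.Perm (Fin 5)) (f : AltForm k n) (v : Fin n → Fin 5 → k) :
    altRep k n g f v = f (fun i => v i ∘ g) := rfl

/-- The values of an alternating form on tuples of basis vectors. -/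
def AltForm.coeff {n : ℕ} (f : AltForm k n) (x : Fin n → Fin 5) : k :=
  f fun i => Pi.single (x i) 1

theorem single_comp_perm (i : Fin 5) (g : Equiv.Perm (Fin 5)) :
    (Pi.single i 1 : Fin 5 → k) ∘ g = Pi.single (g⁻¹ i) 1 := by
  ext j
  simp [Pi.single_apply, Equiv.eq_symm_apply]

namespace AltForm

variable {n : ℕ}

theorem coeff_altRep (g : Equiv.Perm (Fin 5)) (f : AltForm k n) (x : Fin n → Fin 5) :
    coeff (altRep k n g f) x = coeff f (⇑g⁻¹ ∘ x) := by
  simp only [coeff, altRep_apply, single_comp_perm]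
  rfl

theorem ext_coeff {f f' : AltForm k n} (h : ∀ x, Function.Injective x → coeff f x = coeff f' x) :
    f = f' := by
  refine Module.Basis.ext_alternating (Pi.basisFun k (Fin 5)) fun x hx => ?_
  simpa [coeff] using h x hx

/-- `AltForm.coeff` as a linear form. -/
def coeffₗ (x : Fin n → Fin 5) : AltForm k n →ₗ[k] k where
  toFun f := coeff f x
  map_add' _ _ := rfl
  map_smul' _ _ := rfl

@[simp] theorem coeff_add (f f' : AltForm k n) (x : Fin n → Fin 5) :
    coeff (f + f') x = coeff f x + coeff f' x := rfl

@[simp] theorem coeff_sub (f f' : AltForm k n) (x : Fin n → Fin 5) :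
    coeff (f - f') x = coeff f x - coeff f' x := rfl

@[simp] theorem coeff_zero (x : Fin n → Fin 5) : coeff (0 : AltForm k n) x = 0 := rfl

@[simp] theorem coeff_smul (c : k) (f : AltForm k n) (x : Fin n → Fin 5) :
    coeff (c • f) x = c * coeff f x := rfl

theorem coeff_sum {ι : Type*} (s : Finset ι) (f : ι → AltForm k n) (x : Fin n → Fin 5) :
    coeff (∑ i ∈ s, f i) x = ∑ i ∈ s, coeff (f i) x := by
  exact map_sum (coeffₗ (k := k) x) f s

theorem coeff_eq_zero (f : AltForm k n) {x : Fin n → Fin 5} (hx : ¬ Function.Injective x) :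
    coeff f x = 0 :=
  f.map_eq_zero_of_not_injective _ fun h => hx fun i j hij => h (by simp only [hij])

theorem coeff_comp_perm (f : AltForm k n) (x : Fin n → Fin 5) (σ : Equiv.Perm (Fin n)) :
    coeff f (x ∘ σ) = ((Equiv.Perm.sign σ : ℤ) : k) * coeff f x := by
  have := f.map_perm (fun i => Pi.single (x i) 1) σ
  rw [Units.smul_def, zsmul_eq_mul] at this
  exact this

instance instFinite : Module.Finite k (AltForm k n) := by
  let c : AltForm k n →ₗ[k] (Fin n → Fin 5) → k :=
    { toFun := coeff, map_add' := fun _ _ => rfl, map_smul' := fun _ _ => rfl }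
  exact Module.Finite.of_injective c fun f f' h => ext_coeff fun x _ => congrFun h x

end AltForm

variable (k)

/-- The sum of the coordinates. -/
def sumForm : (Fin 5 → k) →ₗ[k] k := ∑ i, LinearMap.proj i

theorem sumForm_apply (v : Fin 5 → k) : sumForm k v = ∑ i, v i := by simp [sumForm]

theorem sumForm_comp (g : Equiv.Perm (Fin 5)) :
    sumForm k ∘ₗ LinearMap.funLeft k k g = sumForm k := by
  refine LinearMap.ext fun v => ?_
  simp only [LinearMap.coe_comp, Function.comp_apply, sumForm_apply, LinearMap.funLeft_apply]
  exact Equiv.sum_comp g _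

/-- The exterior product with the sum of the coordinates, as a linear map. -/
def wedgeSumₗ (n : ℕ) : AltForm k n →ₗ[k] AltForm k (n + 1) :=
  AlternatingMap.wedgeLeft (sumForm k)

theorem wedgeSumₗ_altRep {n : ℕ} (g : Equiv.Perm (Fin 5)) (f : AltForm k n) :
    wedgeSumₗ k n (altRep k n g f) = altRep k (n + 1) g (wedgeSumₗ k n f) := by
  rw [altRep_def, altRep_def, wedgeSumₗ, AlternatingMap.wedgeLeft_compLinearMap,
    sumForm_comp]

/-- The Koszul differential of degree `1`: the exterior product with the sum of the coordinates. -/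
def wedgeSum (n : ℕ) : (altRep k n).IntertwiningMap (altRep k (n + 1)) where
  toLinearMap := wedgeSumₗ k n
  isIntertwining' g := LinearMap.ext fun f => wedgeSumₗ_altRep k g f

/-- The Koszul differential of degree `-1`: the contraction with the sum of the basis vectors. -/
def contractSum (n : ℕ) : (altRep k (n + 1)).IntertwiningMap (altRep k n) where
  toLinearMap :=
    { toFun := fun f => f.curryLeft 1
      map_add' := fun _ _ => rfl
      map_smul' := fun _ _ => rfl }
  isIntertwining' g := by
    ext1 f
    change (f.compLinearMap _).curryLeft 1 = (f.curryLeft 1).compLinearMap _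
    rw [AlternatingMap.curryLeft_compLinearMap']
    rfl

variable {k}
variable {n : ℕ}

theorem wedgeSum_def (f : AltForm k n) :
    wedgeSum k n f = AlternatingMap.wedgeLeft (sumForm k) f := rfl

theorem contractSum_def (f : AltForm k (n + 1)) : contractSum k n f = f.curryLeft 1 := rfl

theorem coeff_wedgeSum (f : AltForm k n) (x : Fin (n + 1) → Fin 5) :
    (wedgeSum k n f).coeff x = ∑ i : Fin (n + 1), (-1) ^ (i : ℕ) * f.coeff (i.removeNth x) := by
  simp only [AltForm.coeff, wedgeSum_def, AlternatingMap.wedgeLeft_apply, sumForm_apply]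
  refine Finset.sum_congr rfl fun i _ => ?_
  simp
  rfl

theorem coeff_contractSum (f : AltForm k (n + 1)) (x : Fin n → Fin 5) :
    (contractSum k n f).coeff x = ∑ i, f.coeff (Matrix.vecCons i x) := by
  have h : (1 : Fin 5 → k) = ∑ i, Pi.single i 1 := by
    ext j; simp
  simp only [contractSum_def, h, map_sum, AltForm.coeff_sum]
  refine Finset.sum_congr rfl fun i _ => ?_
  rw [AltForm.coeff, AlternatingMap.curryLeft_apply_apply]
  congr 1
  ext j : 1
  refine Fin.cases ?_ (fun j => ?_) j <;> simp

@[simp] theorem wedgeSum_wedgeSum (f : AltForm k n) : wedgeSum k (n + 1) (wedgeSum k n f) = 0 :=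
  AlternatingMap.wedgeLeft_wedgeLeft _ _

@[simp] theorem contractSum_contractSum (f : AltForm k (n + 2)) :
    contractSum k n (contractSum k (n + 1) f) = 0 :=
  AlternatingMap.curryLeft_same _ _

/-- The sum of the coordinates is 1 on the first basis vector, so contraction with that vector is a
contracting homotopy for the exterior product. -/
theorem exists_wedgeSum_eq {f : AltForm k (n + 1)} (hf : wedgeSum k (n + 1) f = 0) :
    ∃ f', wedgeSum k n f' = f := by
  refine ⟨f.curryLeft (Pi.single 0 1), ?_⟩
  have := AlternatingMap.curryLeft_wedgeLeft (sumForm k) f (Pi.single 0 1)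
  rw [← wedgeSum_def, hf, sumForm_apply] at this
  simp only [AlternatingMap.curryLeft_zero, LinearMap.zero_apply, Finset.sum_pi_single',
    Finset.mem_univ, if_true, one_smul] at this
  rw [wedgeSum_def]
  exact (sub_eq_zero.mp this.symm).symm

/-- Dually, the first coordinate is 1 on the all-ones vector, so the exterior product with it is a
contracting homotopy. -/
theorem exists_contractSum_eq {f : AltForm k (n + 1)} (hf : contractSum k n f = 0) :
    ∃ f', contractSum k (n + 1) f' = f := by
  refine ⟨AlternatingMap.wedgeLeft (LinearMap.proj 0) f, ?_⟩
  rw [contractSum_def, AlternatingMap.curryLeft_wedgeLeft, ← contractSum_def, hf]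
  simp

/-- Alternating forms of degree greater than `5` vanish. -/
theorem AltForm.eq_zero_of_lt (hn : 5 < n) (f : AltForm k n) : f = 0 :=
  AltForm.ext_coeff fun x hx => by
    have := Fintype.card_le_of_injective x hx
    simp at this
    omega

variable [CharP k 5]

theorem five_eq_zero : (5 : k) = 0 := by
  exact_mod_cast CharP.cast_eq_zero k 5

/-- The scalar term of the antiderivation rule is the value of the coordinate sum on the all-ones
vector, which is 5 = 0. -/
theorem contractSum_wedgeSum (f : AltForm k (n + 1)) :
    contractSum k (n + 1) (wedgeSum k (n + 1) f) = -wedgeSum k n (contractSum k n f) := by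
  rw [contractSum_def, wedgeSum_def, AlternatingMap.curryLeft_wedgeLeft, sumForm_apply,
    wedgeSum_def, contractSum_def]
  simp [five_eq_zero]

end Koszul

/-! ### Higman's criterion -/

section Higman

variable {k : Type u} [Field k] {G : Type w} [Group G] [Fintype G]
variable {V W X : Type*} [AddCommGroup V] [Module k V] [AddCommGroup W] [Module k W]
  [AddCommGroup X] [Module k X]

open Representation

/-- The trace of a linear map: the sum of its conjugates under the group. -/
def Representation.traceMap (ρ : Representation k G V) (σ : Representation k G W) (f : V →ₗ[k] W) :
    ρ.IntertwiningMap σ where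
  toLinearMap := ∑ g, σ g ∘ₗ f ∘ₗ ρ g⁻¹
  isIntertwining' h := by
    ext v
    simp only [LinearMap.coe_comp, Function.comp_apply, LinearMap.sum_apply, map_sum]
    refine Fintype.sum_equiv (Equiv.mulLeft h⁻¹) _ _ fun g => ?_
    simp only [Equiv.coe_mulLeft, ← Module.End.mul_apply, ← map_mul]
    simp

theorem Representation.traceMap_apply (ρ : Representation k G V) (σ : Representation k G W)
    (f : V →ₗ[k] W) (v : V) : traceMap ρ σ f v = ∑ g, σ g (f (ρ g⁻¹ v)) := by
  change (∑ g, σ g ∘ₗ f ∘ₗ ρ g⁻¹ : V →ₗ[k] W) v = _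
  simp

/-- Higman's criterion for projectivity relative to the trivial subgroup: the identity is the
trace of a linear endomorphism. -/
def HasHigmanElement (ρ : Representation k G V) : Prop :=
  ∃ θ : V →ₗ[k] V, ∀ v, ∑ g, ρ g (θ (ρ g⁻¹ v)) = v

/-- All endomorphisms of `ρ` are multiplications by scalars. -/
def HasScalarEndomorphisms (ρ : Representation k G V) : Prop :=
  ∀ φ : ρ.IntertwiningMap ρ, ∃ c : k, ∀ v, φ v = c • v

variable {ρ : Representation k G V} {σ : Representation k G W} {τ : Representation k G X}

omit [Fintype G] in
theorem Representation.IntertwiningMap.apply_inv (f : ρ.IntertwiningMap σ) (g : G) (v : V) :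
    σ g (f (ρ g⁻¹ v)) = f v := by
  rw [f.isIntertwining, ← Module.End.mul_apply, ← map_mul]
  simp

theorem HasHigmanElement.exists_lift (hρ : HasHigmanElement ρ) (f : σ.IntertwiningMap τ)
    (hf : Function.Surjective f) (h : ρ.IntertwiningMap τ) :
    ∃ h' : ρ.IntertwiningMap σ, ∀ v, f (h' v) = h v := by
  obtain ⟨θ, hθ⟩ := hρ
  obtain ⟨s, hs⟩ := f.toLinearMap.exists_rightInverse_of_surjective
    (LinearMap.range_eq_top.mpr hf)
  have hs' : ∀ w, f (s w) = w := fun w => congr($hs w)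
  refine ⟨traceMap ρ σ (s ∘ₗ h.toLinearMap ∘ₗ θ), fun v => ?_⟩
  rw [traceMap_apply, map_sum]
  conv_rhs => rw [← hθ v, map_sum]
  refine Finset.sum_congr rfl fun g _ => ?_
  rw [f.isIntertwining, h.isIntertwining]
  exact congrArg _ (hs' _)

/-- A linear section of `f` gives a linear lift; composing it with the Higman element and averaging
makes it equivariant without changing its image under `f`. -/
theorem HasHigmanElement.exists_extension (hρ : HasHigmanElement ρ) (i : σ.IntertwiningMap τ)
    (hi : Function.Injective i) (h : σ.IntertwiningMap ρ) :
    ∃ h' : τ.IntertwiningMap ρ, ∀ v, h' (i v) = h v := by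
  obtain ⟨θ, hθ⟩ := hρ
  obtain ⟨s, hs⟩ := i.toLinearMap.exists_leftInverse_of_injective (LinearMap.ker_eq_bot.mpr hi)
  have hs' : ∀ w, s (i w) = w := fun w => congr($hs w)
  refine ⟨traceMap τ ρ (θ ∘ₗ h.toLinearMap ∘ₗ s), fun v => ?_⟩
  rw [traceMap_apply]
  conv_rhs => rw [← hθ (h v)]
  refine Finset.sum_congr rfl fun g _ => ?_
  rw [← h.isIntertwining, ← i.isIntertwining]
  simp only [LinearMap.coe_comp, Function.comp_apply, hs']
  rfl

theorem HasHigmanElement.prod (hρ : HasHigmanElement ρ) (hσ : HasHigmanElement σ) :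
    HasHigmanElement (ρ.prod σ) := by
  obtain ⟨θ, hθ⟩ := hρ
  obtain ⟨η, hη⟩ := hσ
  refine ⟨θ.prodMap η, fun v => ?_⟩
  refine Prod.ext ?_ ?_
  · rw [Prod.fst_sum]; exact hθ v.1
  · rw [Prod.snd_sum]; exact hη v.2

theorem HasHigmanElement.of_retract (hσ : HasHigmanElement σ) (i : ρ.IntertwiningMap σ)
    (q : σ.IntertwiningMap ρ) (h : ∀ v, q (i v) = v) : HasHigmanElement ρ := by
  obtain ⟨θ, hθ⟩ := hσ
  refine ⟨q.toLinearMap ∘ₗ θ ∘ₗ i.toLinearMap, fun v => ?_⟩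
  conv_rhs => rw [← h v, ← hθ (i v), map_sum]
  refine Finset.sum_congr rfl fun g _ => ?_
  rw [q.isIntertwining, ← i.isIntertwining]
  rfl

omit [Fintype G] in
theorem trace_conj (ρ : Representation k G V) (g : G) (θ : V →ₗ[k] V) :
    LinearMap.trace k V (ρ g ∘ₗ θ ∘ₗ ρ g⁻¹) = LinearMap.trace k V θ := by
  have h := LinearMap.trace_mul_comm k (ρ g) (θ * ρ g⁻¹)
  rw [mul_assoc, ← map_mul, inv_mul_cancel, map_one, mul_one] at h
  exact h

/-- Such a map is a sum of |G| conjugates of one linear map, so its trace is a multiple of |G| = 0.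
-/
theorem HasHigmanElement.trace_eq_zero (hρ : HasHigmanElement ρ) (hG : (Fintype.card G : k) = 0)
    (φ : ρ.IntertwiningMap ρ) : LinearMap.trace k V φ.toLinearMap = 0 := by
  obtain ⟨θ, hθ⟩ := hρ
  have : φ.toLinearMap = ∑ g, ρ g ∘ₗ (φ.toLinearMap ∘ₗ θ) ∘ₗ ρ g⁻¹ := by
    ext v
    conv_lhs => rw [← hθ v, map_sum]
    rw [LinearMap.sum_apply]
    refine Finset.sum_congr rfl fun g _ => ?_
    change φ (ρ g _) = ρ g (φ _)
    rw [φ.isIntertwining]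
  rw [this, map_sum]
  simp only [trace_conj, Finset.sum_const, Finset.card_univ, nsmul_eq_mul, hG, zero_mul]

theorem HasHigmanElement.finrank_eq_zero (hρ : HasHigmanElement ρ)
    (hG : (Fintype.card G : k) = 0) [Module.Finite k V] : (Module.finrank k V : k) = 0 := by
  rw [← LinearMap.trace_id]
  exact hρ.trace_eq_zero hG (IntertwiningMap.id ρ)

/-- A scalar endomorphism that factors through a projective representation vanishes if the
dimension is invertible. -/
theorem HasHigmanElement.eq_zero_of_factor (hσ : HasHigmanElement σ)
    (hG : (Fintype.card G : k) = 0) [Module.Finite k V] [Module.Finite k W]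
    (hV : (Module.finrank k V : k) ≠ 0)
    (hρ : HasScalarEndomorphisms ρ) (i : ρ.IntertwiningMap σ) (q : σ.IntertwiningMap ρ) (v : V) :
    q (i v) = 0 := by
  obtain ⟨c, hc⟩ := hρ (q.comp i)
  have h1 : LinearMap.trace k V (q.toLinearMap ∘ₗ i.toLinearMap) = c * Module.finrank k V := by
    rw [← LinearMap.trace_id, ← smul_eq_mul, ← map_smul]
    congr 1
    ext v
    exact hc v
  -- The other composite is an endomorphism of the projective, so it has trace zero; hence the
  -- scalar times the dimension is zero.
  rw [LinearMap.trace_comp_comm'] at h1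
  have h2 := hσ.trace_eq_zero hG (i.comp q)
  rw [IntertwiningMap.comp_toLinearMap] at h2
  rw [h2] at h1
  have : c = 0 := (mul_eq_zero.mp h1.symm).resolve_right hV
  have h3 : q (i v) = c • v := hc v
  rw [h3, this, zero_smul]

omit [Fintype G] in
theorem HasScalarEndomorphisms.congr (hρ : HasScalarEndomorphisms ρ) (e : ρ.Equiv σ) :
    HasScalarEndomorphisms σ := by
  intro φ
  obtain ⟨c, hc⟩ := hρ ((e.symm.toIntertwiningMap.comp φ).comp e.toIntertwiningMap)
  refine ⟨c, fun w => ?_⟩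
  have h := congrArg e (hc (e.symm w))
  simpa using h

end Higman

/-! ### Uniqueness of Heller translates -/

section Heller

open Representation

variable {k : Type u} [Field k] {G : Type w} [Group G]

theorem exists_section_of_projective {V W : Type*} [AddCommGroup V] [Module k V] [AddCommGroup W]
    [Module k W] {ρ : Representation k G V} {σ : Representation k G W}
    [hσ : Module.Projective k[G] σ.asModule] (f : ρ.IntertwiningMap σ)
    (hf : Function.Surjective f) : ∃ s : σ.IntertwiningMap ρ, ∀ w, f (s w) = w := by
  obtain ⟨s, hs⟩ := Module.projective_lifting_property
    (IntertwiningMap.equivLinearMapAsModule ρ σ f) LinearMap.id hf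
  refine ⟨(IntertwiningMap.equivLinearMapAsModule σ ρ).symm s, fun w => ?_⟩
  exact congr($hs w)

variable [Fintype G]

/-- If the kernel of an epimorphism from a projective representation onto `τ` has only scalar
endomorphisms and is not projective, then every Heller translate of `τ` is isomorphic to it. -/
theorem IsHellerTranslate.equiv_ker {V W : Type v} [AddCommGroup V] [Module k V] [AddCommGroup W]
    [Module k W] {τ : Representation k G V} {σ : Representation k G W}
    (h : IsHellerTranslate τ σ) {Q : Type*} [AddCommGroup Q] [Module k Q]
    {π : Representation k G Q} (f : π.IntertwiningMap τ) (hπ : HasHigmanElement π)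
    (hf : Function.Surjective f) (hK : HasScalarEndomorphisms f.ker.toRepresentation)
    (hK' : ¬ HasHigmanElement f.ker.toRepresentation) :
    Nonempty (σ.Equiv f.ker.toRepresentation) := by
  obtain ⟨P, _, _, π', f', ⟨hproj, hf', hsup⟩, ⟨e⟩⟩ := h
  obtain ⟨α, hα⟩ := hπ.exists_lift f' hf' f
  have hαs : Function.Surjective α := by
    -- The image of `α` together with the superfluous kernel of `f'` is everything.
    have : α.range = ⊤ := by
      refine hsup _ (top_unique fun x _ => ?_)
      obtain ⟨y, hy⟩ := hf (f' x)
      refine Submodule.mem_sup.mpr ⟨α y, ⟨y, rfl⟩, x - α y, ?_, by simp⟩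
      change f' (x - α y) = 0
      rw [map_sub, hα, hy, sub_self]
    intro x
    have hx : x ∈ α.range := by rw [this]; exact Submodule.mem_top
    exact hx
  -- Thus `β ∘ α` is an idempotent of the representation `π` that preserves the kernel of `f`, where
  -- it must be a scalar.
  obtain ⟨β, hβ⟩ := exists_section_of_projective α hαs
  have hfβ : ∀ x, f (β x) = f' x := fun x => by rw [← hα, hβ]
  have hmem : ∀ x : f.ker.toSubmodule, β (α x) ∈ f.ker.toSubmodule := fun x => by
    change f (β (α x)) = 0
    rw [hfβ, hα]
    exact x.2
  let ε : f.ker.toRepresentation.IntertwiningMap f.ker.toRepresentation :=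
    { toLinearMap := ((β.toLinearMap ∘ₗ α.toLinearMap).domRestrict _).codRestrict _ hmem
      isIntertwining' := fun g => LinearMap.ext fun x => Subtype.ext <| by
        change β (α (π g x)) = π g (β (α x))
        rw [α.isIntertwining, β.isIntertwining] }
  have hε : ∀ x, ((ε x : f.ker.toSubmodule) : Q) = β (α x) := fun _ => rfl
  obtain ⟨c, hc⟩ := hK ε
  -- If the scalar is 0, then `1 - β ∘ α` retracts the projective onto the kernel of `f`, which
  -- would be projective. Otherwise `α` is injective, since its kernel lies in the kernel of `f`.
  by_cases hc0 : c = 0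
  · exfalso
    apply hK'
    have hker : ∀ x ∈ f.ker.toSubmodule, α x = 0 := fun x hx => by
      have := hε ⟨x, hx⟩
      rw [hc, hc0, zero_smul] at this
      rw [← hβ (α x), ← this]
      simp
    have hmem' : ∀ x, x - β (α x) ∈ f.ker.toSubmodule := fun x => by
      change f (x - β (α x)) = 0
      rw [map_sub, hfβ, hα, sub_self]
    refine hπ.of_retract (ρ := f.ker.toRepresentation)
      ⟨f.ker.toSubmodule.subtype, fun g => rfl⟩
      { toLinearMap := (LinearMap.id - β.toLinearMap ∘ₗ α.toLinearMap).codRestrict _ hmem'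
        isIntertwining' := fun g => LinearMap.ext fun x => Subtype.ext <| by
          change π g x - β (α (π g x)) = π g (x - β (α x))
          rw [α.isIntertwining, β.isIntertwining, map_sub] } fun x => Subtype.ext ?_
    change (x : Q) - β (α x) = x
    rw [hker x x.2, map_zero, sub_zero]
  · have hαi : Function.Injective α := by
      rw [injective_iff_map_eq_zero]
      intro x hx
      have hxk : x ∈ f.ker.toSubmodule := by
        change f x = 0
        rw [← hα, hx, map_zero]
      have := hε ⟨x, hxk⟩
      rw [hc] at this
      simp only [hx, map_zero] at this
      exact (smul_eq_zero.mp this).resolve_left hc0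
    have hmemα : ∀ x : f.ker.toSubmodule, α x ∈ f'.ker.toSubmodule := fun x => by
      change f' (α x) = 0
      rw [hα]; exact x.2
    let ψ : f.ker.toRepresentation.IntertwiningMap f'.ker.toRepresentation :=
      { toLinearMap := (α.toLinearMap.domRestrict _).codRestrict _ hmemα
        isIntertwining' := fun g => LinearMap.ext fun x => Subtype.ext <| by
          change α (π g x) = π' g (α x)
          rw [α.isIntertwining] }
    have hψ : Function.Bijective ψ := by
      refine ⟨fun x y hxy => Subtype.ext (hαi (congrArg Subtype.val hxy)), fun y => ?_⟩
      obtain ⟨x, hx⟩ := hαs y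
      refine ⟨⟨x, ?_⟩, Subtype.ext hx⟩
      change f x = 0
      rw [← hα, hx]
      exact y.2
    exact ⟨e.trans (ψ.ofBijective hψ).symm⟩

end Heller

/-! ### Equivariant maps between alternating forms -/

section AltHom

variable {k : Type u} [Field k] {n m : ℕ}

theorem exists_perm_comp_eq {x y : Fin n → Fin 5} (hx : Function.Injective x)
    (hy : Function.Injective y) : ∃ g : Equiv.Perm (Fin 5), g ∘ x = y := by
  obtain ⟨g, hg⟩ := (Equiv.Perm.isMultiplyPretransitive (Fin 5) n).exists_smul_eq ⟨x, hx⟩ ⟨y, hy⟩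
  exact ⟨g, congrArg (fun f : Fin n ↪ Fin 5 => (f : Fin n → Fin 5)) hg⟩

theorem exists_comp_perm_eq {x y : Fin n → Fin 5} (hy : Function.Injective y)
    (h : ∀ i, y i ∈ Set.range x) : ∃ σ : Equiv.Perm (Fin n), x ∘ σ = y := by
  choose s hs using h
  have hsi : Function.Injective s := fun i j hij => hy (by rw [← hs i, ← hs j, hij])
  exact ⟨Equiv.ofBijective s (Finite.injective_iff_bijective.mp hsi), funext hs⟩

variable (k) in
/-- The form `e_{x 0}^* ∧ ... ∧ e_{x (n-1)}^*`. -/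
def dualForm (x : Fin n → Fin 5) : AltForm k n :=
  Matrix.detRowAlternating.compLinearMap (LinearMap.funLeft k k x)

theorem altRep_dualForm (g : Equiv.Perm (Fin 5)) (x : Fin n → Fin 5) :
    altRep k n g (dualForm k x) = dualForm k (g ∘ x) := rfl

theorem coeff_dualForm (x y : Fin n → Fin 5) :
    (dualForm k x).coeff y =
      ∑ σ : Equiv.Perm (Fin n), ((Equiv.Perm.sign σ : ℤ) : k) * if y ∘ σ = x then 1 else 0 := by
  have : (dualForm k x).coeff y =
      Matrix.det (Matrix.of fun i j => (Pi.single (y i) 1 : Fin 5 → k) (x j)) := rfl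
  rw [this, Matrix.det_apply']
  refine Finset.sum_congr rfl fun σ _ => ?_
  congr 1
  simp only [Matrix.of_apply, Pi.single_apply, Finset.prod_boole, Finset.mem_univ, true_implies,
    funext_iff, Function.comp_apply, eq_comm]

theorem coeff_dualForm_self {x : Fin n → Fin 5} (hx : Function.Injective x) :
    (dualForm k x).coeff x = 1 := by
  rw [coeff_dualForm, Finset.sum_eq_single 1]
  · simp
  · intro σ _ hσ
    rw [if_neg, mul_zero]
    intro h
    exact hσ (Equiv.ext fun i => hx (congrFun h i))
  · simp

theorem coeff_dualForm_eq_zero {x y : Fin n → Fin 5} {i : Fin n} (h : y i ∉ Set.range x) :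
    (dualForm k x).coeff y = 0 := by
  rw [coeff_dualForm]
  refine Finset.sum_eq_zero fun σ _ => ?_
  rw [if_neg, mul_zero]
  rintro rfl
  exact h ⟨σ⁻¹ i, by simp⟩

theorem dualForm_comp_perm (x : Fin n → Fin 5) (σ : Equiv.Perm (Fin n)) :
    dualForm k (x ∘ σ) = ((Equiv.Perm.sign σ : ℤ) : k) • dualForm k x := by
  ext v
  exact Matrix.det_permute' σ (Matrix.of fun i j => v i (x j))

theorem dualForm_eq_zero {x : Fin n → Fin 5} (hx : ¬ Function.Injective x) : dualForm k x = 0 := by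
  refine AltForm.ext_coeff fun y hy => ?_
  rw [coeff_dualForm]
  refine Finset.sum_eq_zero fun σ _ => ?_
  rw [if_neg, mul_zero]
  rintro rfl
  exact hx (hy.comp σ.injective)

/-- Each set of `n` entries is counted once for every ordering, with cancelling signs. -/
theorem factorial_smul_eq_sum (f : AltForm k n) :
    (n.factorial : k) • f = ∑ x : Fin n → Fin 5, f.coeff x • dualForm k x := by
  refine AltForm.ext_coeff fun y _ => ?_
  rw [AltForm.coeff_sum, AltForm.coeff_smul]
  simp only [AltForm.coeff_smul, coeff_dualForm, Finset.mul_sum]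
  rw [Finset.sum_comm]
  have : ∀ σ : Equiv.Perm (Fin n), ∑ x : Fin n → Fin 5, f.coeff x *
      (((Equiv.Perm.sign σ : ℤ) : k) * if y ∘ σ = x then 1 else 0) = f.coeff y := by
    intro σ
    rw [Finset.sum_eq_single (y ∘ σ) (fun x _ hx => by rw [if_neg hx.symm]; simp) (by simp),
      if_pos rfl, AltForm.coeff_comp_perm, mul_one, mul_right_comm, ← Int.cast_mul,
      Int.units_coe_mul_self]
    simp
  rw [Finset.sum_congr rfl fun σ _ => this σ]
  simp [Finset.card_univ, Fintype.card_perm]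

theorem eq_coeff_smul_dualForm (f : AltForm k 5) : f = f.coeff id • dualForm k id := by
  refine AltForm.ext_coeff fun y hy => ?_
  obtain ⟨σ, rfl⟩ := exists_comp_perm_eq (x := id) hy (by simp)
  rw [AltForm.coeff_comp_perm, AltForm.coeff_smul, AltForm.coeff_comp_perm,
    coeff_dualForm_self Function.injective_id]
  ring

variable [CharP k 5]

theorem factorial_ne_zero (hn : n < 5) : (n.factorial : k) ≠ 0 := by
  rw [Ne, CharP.cast_eq_zero_iff k 5, Nat.Prime.dvd_factorial (by norm_num)]
  omega

/-- Two linear maps on alternating forms agree if they agree on the decomposable basis forms. -/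
theorem AltForm.linearMap_ext {W : Type*} [AddCommGroup W] [Module k W]
    {φ ψ : AltForm k n →ₗ[k] W}
    (h : ∀ x : Fin n → Fin 5, Function.Injective x → φ (dualForm k x) = ψ (dualForm k x)) :
    φ = ψ := by
  have h' : ∀ x : Fin n → Fin 5, φ (dualForm k x) = ψ (dualForm k x) := by
    intro x
    by_cases hx : Function.Injective x
    · exact h x hx
    · rw [dualForm_eq_zero hx, map_zero, map_zero]
  ext f
  -- Dividing by `n!` settles `n < 5`. In degree five, where `5! = 0`, the space is a line, and
  -- above it there are no forms.
  rcases lt_trichotomy n 5 with hn | rfl | hn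
  · have := factorial_smul_eq_sum f
    apply smul_right_injective W (factorial_ne_zero (k := k) hn)
    simp only [← map_smul, this, map_sum]
    exact Finset.sum_congr rfl fun x _ => by rw [map_smul, map_smul, h']
  · rw [eq_coeff_smul_dualForm f, map_smul, map_smul, h']
  · rw [AltForm.eq_zero_of_lt hn f, map_zero, map_zero]

/-- An invariant linear form on alternating forms of degree at least two vanishes. -/
theorem AltForm.linearForm_eq_zero {φ : AltForm k (n + 2) →ₗ[k] k}
    (h : ∀ g f, φ (altRep k (n + 2) g f) = φ f) : φ = 0 := by
  refine AltForm.linearMap_ext fun x hx => ?_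
  -- Transposing two entries of `x` negates the basis form, and 2 is invertible.
  have h1 := h (Equiv.swap (x 0) (x 1)) (dualForm k x)
  have h2 : Equiv.swap (x 0) (x 1) ∘ x = x ∘ Equiv.swap 0 1 := by
    ext1 i
    simp only [Function.comp_apply]
    rw [hx.swap_apply]
  rw [altRep_dualForm, h2, dualForm_comp_perm,
    Equiv.Perm.sign_swap (by simp), map_smul] at h1
  have h3 : (2 : k) * φ (dualForm k x) = 0 := by
    simp only [Units.val_neg, Units.val_one, Int.cast_neg, Int.cast_one, smul_eq_mul] at h1
    linear_combination -h1
  have h4 : (2 : k) ≠ 0 := by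
    have := factorial_ne_zero (k := k) (n := 2) (by norm_num)
    simpa using this
  exact (mul_eq_zero.mp h3).resolve_left h4

/-- A kernel that is invariant and alternating in both tuples of variables. -/
structure IsAltKernel (K : (Fin m → Fin 5) → (Fin n → Fin 5) → k) : Prop where
  comp (g : Equiv.Perm (Fin 5)) (x : Fin m → Fin 5) (y : Fin n → Fin 5) : K (g ∘ x) (g ∘ y) = K x y
  left (σ : Equiv.Perm (Fin m)) (x : Fin m → Fin 5) (y : Fin n → Fin 5) :
    K (x ∘ σ) y = ((Equiv.Perm.sign σ : ℤ) : k) * K x y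
  right (σ : Equiv.Perm (Fin n)) (x : Fin m → Fin 5) (y : Fin n → Fin 5) :
    K x (y ∘ σ) = ((Equiv.Perm.sign σ : ℤ) : k) * K x y

omit [CharP k 5] in
theorem isAltKernel_coeff (φ : (altRep k m).IntertwiningMap (altRep k n)) :
    IsAltKernel fun x y => (φ (dualForm k x)).coeff y where
  comp g x y := by
    rw [← altRep_dualForm, φ.isIntertwining, AltForm.coeff_altRep]
    congr 1
    ext1 i
    simp
  left σ x y := by rw [dualForm_comp_perm, map_smul, AltForm.coeff_smul]
  right σ x y := AltForm.coeff_comp_perm _ _ _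

namespace IsAltKernel

variable {K : (Fin m → Fin 5) → (Fin n → Fin 5) → k}

omit [CharP k 5] in
theorem flip (hK : IsAltKernel K) : IsAltKernel fun y x => K x y where
  comp g y x := hK.comp g x y
  left σ y x := hK.right σ x y
  right σ y x := hK.left σ x y

/-- The transposition of the two entries outside `y` fixes `y` and negates the dependence on `x`, so
the value equals its own negative. -/
theorem eq_zero (hK : IsAltKernel K) {x : Fin m → Fin 5} {y : Fin n → Fin 5}
    (hx : Function.Injective x) {i j : Fin m} (hij : i ≠ j) (hi : x i ∉ Set.range y)
    (hj : x j ∉ Set.range y) : K x y = 0 := by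
  have h := hK.comp (Equiv.swap (x i) (x j)) x y
  have h1 : Equiv.swap (x i) (x j) ∘ x = x ∘ Equiv.swap i j := by
    ext1 l
    simp only [Function.comp_apply]
    rw [hx.swap_apply]
  have h2 : Equiv.swap (x i) (x j) ∘ y = y := by
    ext1 l
    exact Equiv.swap_apply_of_ne_of_ne (fun h => hi ⟨l, h⟩) fun h => hj ⟨l, h⟩
  rw [h1, h2, hK.left, Equiv.Perm.sign_swap hij] at h
  have h3 : (2 : k) * K x y = 0 := by
    simp only [Units.val_neg, Units.val_one, Int.cast_neg, Int.cast_one] at h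
    linear_combination -h
  have h4 : (2 : k) ≠ 0 := by
    have := factorial_ne_zero (k := k) (n := 2) (by norm_num)
    simpa using this
  exact (mul_eq_zero.mp h3).resolve_left h4

/-- A kernel vanishes if its degrees differ by at least two. -/
theorem eq_zero_of_lt (hK : IsAltKernel K) (hmn : n + 1 < m) {x : Fin m → Fin 5}
    (hx : Function.Injective x) (y : Fin n → Fin 5) : K x y = 0 := by
  classical
  -- At most `n` entries of `x` can lie among those of `y`, so at least two lie outside.
  have h1 : (Finset.univ.filter fun i => x i ∈ Set.range y).card ≤ n := by
    calc _ = ((Finset.univ.filter fun i => x i ∈ Set.range y).image x).card :=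
          (Finset.card_image_of_injective _ hx).symm
      _ ≤ (Finset.univ.image y).card := Finset.card_le_card fun z hz => by
          obtain ⟨i, hi, rfl⟩ := Finset.mem_image.mp hz
          obtain ⟨j, hj⟩ := (Finset.mem_filter.mp hi).2
          exact Finset.mem_image.mpr ⟨j, Finset.mem_univ _, hj⟩
      _ ≤ n := Finset.card_image_le.trans (by simp)
  have h2 := Finset.card_filter_add_card_filter_not (s := (Finset.univ : Finset (Fin m)))
    (fun i => x i ∈ Set.range y)
  rw [Finset.card_univ, Fintype.card_fin] at h2
  obtain ⟨i, hi, j, hj, hij⟩ := Finset.one_lt_card.mp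
    (show 1 < (Finset.univ.filter fun i => ¬ x i ∈ Set.range y).card by omega)
  exact hK.eq_zero hx hij (Finset.mem_filter.mp hi).2 (Finset.mem_filter.mp hj).2

/-- A kernel whose degrees differ by one is determined by a single value. -/
theorem eq_zero_of_cons {K : (Fin (n + 1) → Fin 5) → (Fin n → Fin 5) → k} (hK : IsAltKernel K)
    {y₀ : Fin n → Fin 5} (hy₀ : Function.Injective y₀) {p₀ : Fin 5} (hp₀ : p₀ ∉ Set.range y₀)
    (h : K (Matrix.vecCons p₀ y₀) y₀ = 0) {x : Fin (n + 1) → Fin 5} (hx : Function.Injective x)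
    {y : Fin n → Fin 5} (hy : Function.Injective y) : K x y = 0 := by
  obtain ⟨g, rfl⟩ := exists_perm_comp_eq hy₀ hy
  obtain ⟨x, rfl⟩ : ∃ x', x = g ∘ x' := ⟨⇑g⁻¹ ∘ x, by ext1 i; simp⟩
  rw [hK.comp]
  replace hx : Function.Injective x := Function.Injective.of_comp hx
  obtain ⟨i, hi⟩ : ∃ i, x i ∉ Set.range y₀ := by
    by_contra! hcon
    choose s hs using hcon
    have hsi : Function.Injective s := fun i j hij => hx (by rw [← hs i, ← hs j, hij])
    have := Fintype.card_le_of_injective s hsi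
    simp at this
  -- With two entries outside `y₀` the value vanishes. With exactly one, `x` is a rearrangement of
  -- that entry followed by `y₀`.
  by_cases hj : ∃ j, i ≠ j ∧ x j ∉ Set.range y₀
  · obtain ⟨j, hij, hj⟩ := hj
    exact hK.eq_zero hx hij hi hj
  · push Not at hj
    obtain ⟨σ, hσ⟩ := exists_comp_perm_eq (x := Matrix.vecCons (x i) y₀) hx fun j => by
      by_cases hij : i = j
      · exact ⟨0, by simp [hij]⟩
      · obtain ⟨l, hl⟩ := hj j hij
        exact ⟨l.succ, by simpa using hl⟩
    rw [← hσ, hK.left]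
    -- This transposition moves the extra entry to `p₀` and fixes `y₀`, reducing to the value known
    -- to vanish.
    have h1 := hK.comp (Equiv.swap (x i) p₀) (Matrix.vecCons (x i) y₀) y₀
    have h2 : Equiv.swap (x i) p₀ ∘ y₀ = y₀ := by
      ext1 l
      exact Equiv.swap_apply_of_ne_of_ne (fun h => hi ⟨l, h⟩) fun h => hp₀ ⟨l, h⟩
    have h3 : Equiv.swap (x i) p₀ ∘ Matrix.vecCons (x i) y₀ = Matrix.vecCons p₀ y₀ := by
      ext1 l
      refine Fin.cases ?_ (fun l => ?_) l
      · simp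
      · simpa using congrFun h2 l
    rw [h2, h3, h] at h1
    rw [← h1, mul_zero]

end IsAltKernel

theorem AltForm.intertwiningMap_ext {φ ψ : (altRep k m).IntertwiningMap (altRep k n)}
    (h : ∀ x y, Function.Injective x → Function.Injective y →
      (φ (dualForm k x)).coeff y = (ψ (dualForm k x)).coeff y) : φ = ψ :=
  Representation.IntertwiningMap.ext <| AltForm.linearMap_ext fun x hx => ext_coeff fun y hy =>
    h x y hx hy

theorem exists_cons_injective (hn : n < 5) :
    ∃ (y : Fin n → Fin 5) (p : Fin 5), Function.Injective y ∧ p ∉ Set.range y ∧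
      Function.Injective (Matrix.vecCons p y) := by
  let z : Fin (n + 1) → Fin 5 := Fin.castLE hn
  have hz : Function.Injective z := Fin.castLE_injective hn
  have h : Matrix.vecCons (z 0) (z ∘ Fin.succ) = z := by
    ext1 l
    refine Fin.cases ?_ (fun l => ?_) l <;> simp
  refine ⟨z ∘ Fin.succ, z 0, hz.comp (Fin.succ_injective n), ?_, by rwa [h]⟩
  rintro ⟨l, hl⟩
  exact Fin.succ_ne_zero l (hz hl)

/-- Equivariant maps of degree `1` are multiples of the exterior product with the sum of the
coordinates. -/
theorem exists_eq_smul_wedgeSum (hn : n < 5)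
    (φ : (altRep k n).IntertwiningMap (altRep k (n + 1))) : ∃ c : k, φ = c • wedgeSum k n := by
  obtain ⟨y, p, hy, hp, hpy⟩ := exists_cons_injective hn
  let c := (φ (dualForm k y)).coeff (Matrix.vecCons p y)
  -- The wedge map has value 1 at the test pair, so subtracting `c` times it annihilates the single
  -- value that determines the kernel.
  have hE : (wedgeSum k n (dualForm k y)).coeff (Matrix.vecCons p y) = 1 := by
    rw [coeff_wedgeSum, Fin.sum_univ_succ, Finset.sum_eq_zero, add_zero]
    · simp [coeff_dualForm_self hy, Fin.removeNth_zero, Fin.tail_def]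
    · intro i _
      have : (i.succ.removeNth (Matrix.vecCons p y)) ⟨0, i.pos⟩ = p := by
        simp [Fin.removeNth, Fin.succAbove, Fin.lt_def]
      rw [coeff_dualForm_eq_zero (i := ⟨0, i.pos⟩) (by rwa [this]), mul_zero]
  have hK := (isAltKernel_coeff (φ - c • wedgeSum k n)).flip
  have h0 : ((φ - c • wedgeSum k n) (dualForm k y)).coeff (Matrix.vecCons p y) = 0 := by
    change (φ (dualForm k y) - c • wedgeSum k n (dualForm k y)).coeff _ = 0
    rw [AltForm.coeff_sub, AltForm.coeff_smul, hE, mul_one]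
    exact sub_self c
  refine ⟨c, sub_eq_zero.mp (AltForm.intertwiningMap_ext fun x z hx hz => ?_)⟩
  exact hK.eq_zero_of_cons hy hp h0 hz hx

/-- Equivariant maps of degree `-1` are multiples of the contraction with the sum of the basis. -/
theorem exists_eq_smul_contractSum (hn : n < 5)
    (φ : (altRep k (n + 1)).IntertwiningMap (altRep k n)) : ∃ c : k, φ = c • contractSum k n := by
  obtain ⟨y, p, hy, hp, hpy⟩ := exists_cons_injective hn
  let c := (φ (dualForm k (Matrix.vecCons p y))).coeff y
  have hE : (contractSum k n (dualForm k (Matrix.vecCons p y))).coeff y = 1 := by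
    rw [coeff_contractSum, Finset.sum_eq_single p, coeff_dualForm_self hpy]
    · intro l _ hl
      by_cases hly : l ∈ Set.range y
      · refine AltForm.coeff_eq_zero _ fun h => ?_
        obtain ⟨i, hi⟩ := hly
        exact Fin.succ_ne_zero i (h (by simpa using hi))
      · refine coeff_dualForm_eq_zero (i := 0) ?_
        rintro ⟨i, hi⟩
        revert hi
        refine Fin.cases ?_ (fun i => ?_) i
        · simpa using hl.symm
        · intro h
          exact hly ⟨i, by simpa using h⟩
    · simp
  have hK := isAltKernel_coeff (φ - c • contractSum k n)
  have h0 : ((φ - c • contractSum k n) (dualForm k (Matrix.vecCons p y))).coeff y = 0 := by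
    change (φ (dualForm k _) - c • contractSum k n (dualForm k _)).coeff _ = 0
    rw [AltForm.coeff_sub, AltForm.coeff_smul, hE, mul_one]
    exact sub_self c
  exact ⟨c, sub_eq_zero.mp (AltForm.intertwiningMap_ext fun x z hx hz =>
    hK.eq_zero_of_cons hy hp h0 hx hz)⟩

theorem eq_zero_of_add_one_lt (hmn : m + 1 < n)
    (φ : (altRep k m).IntertwiningMap (altRep k n)) : φ = 0 :=
  AltForm.intertwiningMap_ext fun x _ _ hy =>
    (isAltKernel_coeff φ).flip.eq_zero_of_lt hmn hy x

theorem eq_zero_of_lt_add_one (hmn : n + 1 < m)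
    (φ : (altRep k m).IntertwiningMap (altRep k n)) : φ = 0 :=
  AltForm.intertwiningMap_ext fun _ y hx _ => (isAltKernel_coeff φ).eq_zero_of_lt hmn hx y

/-- Each `i` is the image of 0 under 4! = 24 permutations. -/
theorem sum_perm_apply_zero {W : Type*} [AddCommGroup W] (F : Fin 5 → W) :
    ∑ g : Equiv.Perm (Fin 5), F (g 0) = 24 • ∑ i, F i := by
  rw [← Equiv.sum_comp (Equiv.Perm.decomposeFin (n := 4)).symm, Fintype.sum_prod_type]
  simp [Fintype.card_perm, Nat.factorial, Finset.smul_sum]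

/-- The projection onto the forms divisible by the `i`-th coordinate. -/
def coordProj (k : Type u) [Field k] (n : ℕ) (i : Fin 5) : AltForm k (n + 1) →ₗ[k] AltForm k (n + 1) where
  toFun f := AlternatingMap.wedgeLeft (LinearMap.proj i) (f.curryLeft (Pi.single i 1))
  map_add' f f' := by rw [AlternatingMap.curryLeft_add, LinearMap.add_apply, map_add]
  map_smul' c f := by
    rw [AlternatingMap.curryLeft_smul, LinearMap.smul_apply, map_smul, RingHom.id_apply]

omit [CharP k 5] in
-- Euler's identity: a basis form is reproduced by the projector of each of its `n + 1` coordinates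
-- and killed by the others.
theorem sum_coordProj (f : AltForm k (n + 1)) : ∑ i, coordProj k n i f = (n + 1 : k) • f := by
  have h : ∑ i : Fin 5, (LinearMap.proj i : (Fin 5 → k) →ₗ[k] k).smulRight
      (f.curryLeft (Pi.single i 1)) = f.curryLeft := by
    refine LinearMap.pi_ext' fun j => LinearMap.ext_ring ?_
    simp [Pi.single_apply]
  have h2 : ∑ i, coordProj k n i f = AlternatingMap.alternatizeUncurryFin f.curryLeft := by
    rw [← h, ← AlternatingMap.alternatizeUncurryFinLM_apply, map_sum]
    rfl
  rw [h2, AlternatingMap.alternatizeUncurryFin_curryLeft, ← Nat.cast_smul_eq_nsmul k]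
  simp

omit [CharP k 5] in
theorem altRep_coordProj (g : Equiv.Perm (Fin 5)) (f : AltForm k (n + 1)) :
    altRep k (n + 1) g (coordProj k n 0 (altRep k (n + 1) g⁻¹ f)) = coordProj k n (g 0) f := by
  change (AlternatingMap.wedgeLeft _ ((f.compLinearMap _).curryLeft _)).compLinearMap _ =
    AlternatingMap.wedgeLeft _ (f.curryLeft _)
  rw [AlternatingMap.wedgeLeft_compLinearMap, AlternatingMap.curryLeft_compLinearMap',
    AlternatingMap.compLinearMap_assoc]
  have h1 : LinearMap.funLeft k k ⇑g⁻¹ ∘ₗ LinearMap.funLeft k k ⇑g = LinearMap.id := by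
    ext; simp [LinearMap.funLeft_apply]
  have h2 : LinearMap.funLeft k k ⇑g⁻¹ (Pi.single 0 1) = Pi.single (g 0) 1 := by
    have := single_comp_perm (k := k) 0 g⁻¹
    rwa [inv_inv] at this
  rw [h1, h2]
  rfl

/-- The projector of one coordinate averages to 24(n + 1) times the identity, and this is invertible
because `n + 1 < 5`. Degrees 0 and 5 are not projective. -/
theorem hasHigmanElement_altRep (hn : n < 4) : HasHigmanElement (altRep k (n + 1)) := by
  have hc : (24 * (n + 1) : k) ≠ 0 := by
    have h1 : (24 : k) ≠ 0 := by
      have := factorial_ne_zero (k := k) (n := 4) (by norm_num)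
      simpa [Nat.factorial] using this
    have h2 : ((n + 1 : ℕ) : k) ≠ 0 := by
      rw [Ne, CharP.cast_eq_zero_iff k 5]
      intro h
      have := Nat.le_of_dvd (by omega) h
      omega
    exact mul_ne_zero h1 (by exact_mod_cast h2)
  refine ⟨(24 * (n + 1) : k)⁻¹ • coordProj k n 0, fun f => ?_⟩
  simp only [LinearMap.smul_apply, map_smul, altRep_coordProj]
  rw [← Finset.smul_sum, sum_perm_apply_zero fun i => coordProj k n i f, sum_coordProj,
    ← Nat.cast_smul_eq_nsmul k, smul_smul, smul_smul, mul_assoc]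
  push_cast
  rw [inv_mul_cancel₀ hc, one_smul]

end AltHom

/-! ### The total Koszul maps and their kernels -/

section Total

open Representation

variable (k : Type u) [Field k]

variable {k}

/-- Restriction of the codomain of an intertwining map to a subrepresentation. -/
def Representation.IntertwiningMap.codRestrict {G : Type*} [Group G] {V W : Type*}
    [AddCommGroup V] [Module k V] [AddCommGroup W] [Module k W] {ρ : Representation k G V}
    {σ : Representation k G W} (f : ρ.IntertwiningMap σ) (N : Subrepresentation σ)
    (h : ∀ x, f x ∈ N.toSubmodule) : ρ.IntertwiningMap N.toRepresentation where
  toLinearMap := f.toLinearMap.codRestrict _ h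
  isIntertwining' g := LinearMap.ext fun x => Subtype.ext <| by
    change f (ρ g x) = σ g (f x)
    rw [f.isIntertwining]

variable (k)

/-- The map `(f, h) ↦ e ∧ f + d h`. -/
noncomputable def totalMap (n : ℕ) :
    ((altRep k n).prod (altRep k (n + 2))).IntertwiningMap (altRep k (n + 1)) :=
  (wedgeSum k n).comp (IntertwiningMap.fst k _ _) +
    (contractSum k (n + 1)).comp (IntertwiningMap.snd k _ _)

variable {k}

@[simp] theorem totalMap_apply {n : ℕ} (x : AltForm k n × AltForm k (n + 2)) :
    totalMap k n x = wedgeSum k n x.1 + contractSum k (n + 1) x.2 := rfl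

theorem mem_ker_totalMap {n : ℕ} (x : AltForm k n × AltForm k (n + 2)) :
    x ∈ (totalMap k n).ker.toSubmodule ↔ wedgeSum k n x.1 + contractSum k (n + 1) x.2 = 0 := Iff.rfl

theorem wedgeSum_zero_injective {c : AltForm k 0} (h : wedgeSum k 0 c = 0) : c = 0 := by
  have := AlternatingMap.curryLeft_wedgeLeft_zero (sumForm k) c (Pi.single 0 1)
  rw [← wedgeSum_def, h, sumForm_apply] at this
  simpa using this.symm

theorem contractSum_zero_surjective (c : AltForm k 0) : ∃ w, contractSum k 0 w = c := by
  refine ⟨AlternatingMap.wedgeLeft (LinearMap.proj 0) c, ?_⟩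
  rw [contractSum_def, AlternatingMap.curryLeft_wedgeLeft_zero]
  simp

theorem contractSum_four_injective {h : AltForm k 5} (hh : contractSum k 4 h = 0) : h = 0 := by
  obtain ⟨h', rfl⟩ := exists_contractSum_eq hh
  rw [AltForm.eq_zero_of_lt (by norm_num) h', map_zero]

theorem wedgeSum_four_surjective (h : AltForm k 5) : ∃ h', wedgeSum k 4 h' = h :=
  exists_wedgeSum_eq (AltForm.eq_zero_of_lt (by norm_num) _)

variable [CharP k 5]

theorem wedgeSum_contractSum {n : ℕ} (f : AltForm k (n + 1)) :
    wedgeSum k n (contractSum k n f) = -contractSum k (n + 1) (wedgeSum k (n + 1) f) := by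
  rw [contractSum_wedgeSum, neg_neg]

variable (k) in
/-- The map `(v, f) ↦ (e ∧ v + d f, e ∧ f)` onto the kernel of the next total map. -/
noncomputable def totalCover (n : ℕ) : ((altRep k n).prod (altRep k (n + 2))).IntertwiningMap
    (totalMap k (n + 1)).ker.toRepresentation :=
  ((totalMap k n).prod ((wedgeSum k (n + 2)).comp (IntertwiningMap.snd k _ _))).codRestrict _
    fun x => by
      change wedgeSum k (n + 1) (wedgeSum k n x.1 + contractSum k (n + 1) x.2) +
        contractSum k (n + 2) (wedgeSum k (n + 2) x.2) = 0
      rw [map_add, wedgeSum_wedgeSum, wedgeSum_contractSum]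
      simp

theorem coe_totalCover {n : ℕ} (x : AltForm k n × AltForm k (n + 2)) :
    ((totalCover k n x : (totalMap k (n + 1)).ker.toSubmodule) :
      AltForm k (n + 1) × AltForm k (n + 3)) =
      (wedgeSum k n x.1 + contractSum k (n + 1) x.2, wedgeSum k (n + 2) x.2) := rfl

variable (k) in
/-- The map `(f, h) ↦ (d f, e ∧ f + d h)` onto the kernel of the previous total map. -/
noncomputable def totalCocover (n : ℕ) : ((altRep k (n + 1)).prod (altRep k (n + 3))).IntertwiningMap
    (totalMap k n).ker.toRepresentation :=
  (((contractSum k n).comp (IntertwiningMap.fst k _ _)).prod (totalMap k (n + 1))).codRestrict _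
    fun x => by
      change wedgeSum k n (contractSum k n x.1) + contractSum k (n + 1)
        (wedgeSum k (n + 1) x.1 + contractSum k (n + 2) x.2) = 0
      rw [map_add, contractSum_contractSum, wedgeSum_contractSum]
      simp

theorem coe_totalCocover {n : ℕ} (x : AltForm k (n + 1) × AltForm k (n + 3)) :
    ((totalCocover k n x : (totalMap k n).ker.toSubmodule) :
      AltForm k n × AltForm k (n + 2)) =
      (contractSum k n x.1, wedgeSum k (n + 1) x.1 + contractSum k (n + 2) x.2) := rfl

/-- If ef + dh = 0, anticommutation gives d(eh) = 0. Since d is injective in degree five, eh = 0 and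
h is a wedge `e f₃`; then f and `d f₃` differ by an element of the kernel of e. -/
theorem totalCover_surjective : Function.Surjective (totalCover k 1) := by
  rintro ⟨⟨f, h⟩, hfh⟩
  replace hfh : wedgeSum k 2 f + contractSum k 3 h = 0 := hfh
  have h1 : contractSum k 4 (wedgeSum k 4 h) = 0 := by
    rw [contractSum_wedgeSum, ← neg_eq_of_add_eq_zero_right hfh]
    simp
  obtain ⟨f₃, rfl⟩ := exists_wedgeSum_eq (contractSum_four_injective h1)
  have h2 : wedgeSum k 2 (f - contractSum k 2 f₃) = 0 := by
    rw [map_sub, wedgeSum_contractSum, sub_neg_eq_add, hfh]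
  obtain ⟨v, hv⟩ := exists_wedgeSum_eq h2
  refine ⟨(v, f₃), Subtype.ext ?_⟩
  rw [coe_totalCover]
  simp [hv]

/-- This relation is what forces the two scalars describing a map out of the kernel to agree. -/
theorem totalCover_koszul (f : AltForm k 2) :
    totalCover k 1 (contractSum k 1 f, wedgeSum k 2 f) = 0 := by
  apply Subtype.ext
  rw [coe_totalCover]
  simp [wedgeSum_contractSum]

/-- The dual chase. Given ev + df = 0, the form ef is closed for d, hence d of a degree-five form,
which is itself a wedge; correcting f makes it a wedge `e f₂`, and v then differs from `d f₂` by a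
multiple of the coordinate sum. -/
theorem totalCocover_surjective : Function.Surjective (totalCocover k 1) := by
  rintro ⟨⟨v, f⟩, hvf⟩
  replace hvf : wedgeSum k 1 v + contractSum k 2 f = 0 := hvf
  have h1 : contractSum k 3 (wedgeSum k 3 f) = 0 := by
    rw [contractSum_wedgeSum, ← neg_eq_of_add_eq_zero_right hvf]
    simp
  obtain ⟨h₅, hh₅⟩ := exists_contractSum_eq h1
  obtain ⟨h₄, rfl⟩ := wedgeSum_four_surjective h₅
  have h2 : wedgeSum k 3 (f + contractSum k 3 h₄) = 0 := by
    rw [map_add, wedgeSum_contractSum, hh₅]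
    simp
  obtain ⟨f₂, hf₂⟩ := exists_wedgeSum_eq h2
  have h3 : wedgeSum k 1 (v - contractSum k 1 f₂) = 0 := by
    rw [map_sub, wedgeSum_contractSum, hf₂, sub_neg_eq_add, map_add, contractSum_contractSum,
      add_zero, hvf]
  obtain ⟨c, hc⟩ := exists_wedgeSum_eq h3
  obtain ⟨w, rfl⟩ := contractSum_zero_surjective c
  -- Replacing `f₂` by `f₂ - e w` leaves `e f₂` unchanged but shifts `d f₂` by `e (d w)`, which
  -- absorbs the remaining difference.
  refine ⟨(f₂ - wedgeSum k 1 w, -h₄), Subtype.ext (Prod.ext ?_ ?_)⟩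
  · rw [coe_totalCocover]
    simp only [map_sub]
    rw [contractSum_wedgeSum, hc]
    abel
  · rw [coe_totalCocover]
    simp [hf₂]

theorem totalCocover_koszul (f : AltForm k 3) :
    totalCocover k 1 (contractSum k 2 f, wedgeSum k 3 f) = 0 := by
  apply Subtype.ext
  rw [coe_totalCocover]
  simp [wedgeSum_contractSum]

/-- The kernel of `e ∧ d` on forms of degree three is the image of the total map. -/
theorem exists_totalMap_eq {f : AltForm k 3} (hf : wedgeSum k 2 (contractSum k 2 f) = 0) :
    ∃ x, totalMap k 2 x = f := by
  obtain ⟨v, hv⟩ := exists_wedgeSum_eq hf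
  -- A primitive `v` of `d f` is itself closed for d, because e is injective in degree zero.
  have h1 : contractSum k 0 v = 0 := by
    apply wedgeSum_zero_injective
    rw [wedgeSum_contractSum, hv]
    simp
  obtain ⟨f₂, rfl⟩ := exists_contractSum_eq h1
  have h2 : contractSum k 2 (f + wedgeSum k 2 f₂) = 0 := by
    rw [map_add, contractSum_wedgeSum, hv]
    simp
  obtain ⟨h, hh⟩ := exists_contractSum_eq h2
  refine ⟨(-f₂, h), ?_⟩
  simp [hh]

theorem wedgeSum_contractSum_totalMap (x : AltForm k 2 × AltForm k 4) :
    wedgeSum k 2 (contractSum k 2 (totalMap k 2 x)) = 0 := by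
  simp only [totalMap_apply, map_add, contractSum_contractSum, contractSum_wedgeSum]
  simp

/-! ### Endomorphisms -/

omit [CharP k 5] in
theorem coeff_dualForm_intCast {n : ℕ} (x y : Fin n → Fin 5) : (dualForm k x).coeff y =
    ((∑ σ : Equiv.Perm (Fin n), (Equiv.Perm.sign σ : ℤ) * if y ∘ σ = x then 1 else 0 : ℤ) : k) := by
  rw [coeff_dualForm]
  push_cast
  rfl

-- An explicit coefficient of a basis form equals 1. It is computed over the integers, where it is
-- decidable, and then cast to k.
variable (k) in
omit [CharP k 5] in
theorem exists_wedgeSum_contractSum_ne_zero :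
    ∃ f : AltForm k 2, wedgeSum k 1 (contractSum k 1 f) ≠ 0 := by
  refine ⟨dualForm k ![0, 1], fun h => ?_⟩
  have h1 := congrArg (fun f => AltForm.coeff f ![0, 2]) h
  simp only [coeff_wedgeSum, coeff_contractSum, coeff_dualForm_intCast, AltForm.coeff_zero] at h1
  norm_cast at h1
  have h2 : ∀ z : ℤ, z = 1 → (z : k) ≠ 0 := by rintro _ rfl; simp
  refine h2 _ ?_ h1
  decide

variable (k) in
omit [CharP k 5] in
theorem exists_wedgeSum_contractSum_ne_zero' :
    ∃ f : AltForm k 3, wedgeSum k 2 (contractSum k 2 f) ≠ 0 := by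
  refine ⟨dualForm k ![0, 1, 2], fun h => ?_⟩
  have h1 := congrArg (fun f => AltForm.coeff f ![0, 1, 3]) h
  simp only [coeff_wedgeSum, coeff_contractSum, coeff_dualForm_intCast, AltForm.coeff_zero] at h1
  norm_cast at h1
  have h2 : ∀ z : ℤ, z = 1 → (z : k) ≠ 0 := by rintro _ rfl; simp
  refine h2 _ ?_ h1
  decide

variable (k) in
/-- The first projection of the kernel of the total map. -/
noncomputable def kerFst (n : ℕ) : (totalMap k n).ker.toRepresentation.IntertwiningMap (altRep k n) :=
  (IntertwiningMap.fst k _ _).comp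
    ⟨(totalMap k n).ker.toSubmodule.subtype, fun _ => rfl⟩

variable (k) in
/-- The second projection of the kernel of the total map. -/
noncomputable def kerSnd (n : ℕ) : (totalMap k n).ker.toRepresentation.IntertwiningMap (altRep k (n + 2)) :=
  (IntertwiningMap.snd k _ _).comp
    ⟨(totalMap k n).ker.toSubmodule.subtype, fun _ => rfl⟩

omit [CharP k 5] in
theorem kerFst_apply {n : ℕ} (x : (totalMap k n).ker.toSubmodule) : kerFst k n x = x.1.1 := rfl

omit [CharP k 5] in
theorem kerSnd_apply {n : ℕ} (x : (totalMap k n).ker.toSubmodule) : kerSnd k n x = x.1.2 := rfl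

omit [CharP k 5] in
theorem prod_map_apply {n : ℕ} {W : Type*} [AddCommGroup W] [Module k W]
    {τ : Representation k (Equiv.Perm (Fin 5)) W} {m : ℕ}
    (φ : ((altRep k n).prod (altRep k m)).IntertwiningMap τ) (x : AltForm k n × AltForm k m) :
    φ x = φ.comp (IntertwiningMap.inl k _ _) x.1 + φ.comp (IntertwiningMap.inr k _ _) x.2 := by
  change φ x = φ (x.1, 0) + φ (0, x.2)
  rw [← map_add]
  simp

omit [CharP k 5] in
theorem AltForm.eq_of_smul_sub_smul_eq_zero {n : ℕ} {f : AltForm k n} (hf : f ≠ 0) {a b : k}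
    (h : a • f - b • f = 0) : a = b := by
  have h' : (a - b) • f = 0 := (sub_smul a b f).trans h
  exact sub_eq_zero.mp ((smul_eq_zero.mp h').resolve_right hf)

/-- Pulled back along `totalCover`, the map has components L_1 → L_2 and L_3 → L_2, hence multiples
of e and d; the Koszul relation makes the two scalars equal. -/
theorem exists_eq_smul_kerFst_two
    (φ : (totalMap k 2).ker.toRepresentation.IntertwiningMap (altRep k 2)) :
    ∃ c : k, ∀ x, φ x = c • kerFst k 2 x := by
  obtain ⟨a, ha⟩ := exists_eq_smul_wedgeSum (by norm_num)
    ((φ.comp (totalCover k 1)).comp (IntertwiningMap.inl k _ _))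
  obtain ⟨b, hb⟩ := exists_eq_smul_contractSum (by norm_num)
    ((φ.comp (totalCover k 1)).comp (IntertwiningMap.inr k _ _))
  have key : ∀ y, φ (totalCover k 1 y) = a • wedgeSum k 1 y.1 + b • contractSum k 2 y.2 := by
    intro y
    have := prod_map_apply (φ.comp (totalCover k 1)) y
    rwa [ha, hb] at this
  have hab : a = b := by
    obtain ⟨f, hf⟩ := exists_wedgeSum_contractSum_ne_zero k
    have := key (contractSum k 1 f, wedgeSum k 2 f)
    rw [totalCover_koszul, map_zero] at this
    simp only [contractSum_wedgeSum, smul_neg, ← sub_eq_add_neg] at this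
    exact AltForm.eq_of_smul_sub_smul_eq_zero hf this.symm
  refine ⟨a, fun x => ?_⟩
  obtain ⟨y, rfl⟩ := totalCover_surjective x
  rw [key, ← hab, ← smul_add]
  rfl

/-- Pulled back to L_1 ⊕ L_3, only the component L_3 → L_4 can be nonzero. -/
theorem exists_eq_smul_kerSnd_two
    (φ : (totalMap k 2).ker.toRepresentation.IntertwiningMap (altRep k 4)) :
    ∃ c : k, ∀ x, φ x = c • kerSnd k 2 x := by
  have ha := eq_zero_of_add_one_lt (by norm_num)
    ((φ.comp (totalCover k 1)).comp (IntertwiningMap.inl k _ _))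
  obtain ⟨b, hb⟩ := exists_eq_smul_wedgeSum (by norm_num)
    ((φ.comp (totalCover k 1)).comp (IntertwiningMap.inr k _ _))
  refine ⟨b, fun x => ?_⟩
  obtain ⟨y, rfl⟩ := totalCover_surjective x
  have := prod_map_apply (φ.comp (totalCover k 1)) y
  rw [ha, hb] at this
  refine this.trans ?_
  change 0 + b • wedgeSum k 3 y.2 = _
  rw [zero_add]
  rfl

/-- Each projection turns an endomorphism into a scalar; the defining equation of the kernel, tested
on the element (df, ef), forces the two scalars to coincide. -/
theorem hasScalarEndomorphisms_ker_totalMap_two :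
    HasScalarEndomorphisms (V := (totalMap k 2).ker.toSubmodule)
      (totalMap k 2).ker.toRepresentation := by
  intro φ
  obtain ⟨a, ha⟩ := exists_eq_smul_kerFst_two ((kerFst k 2).comp φ)
  obtain ⟨b, hb⟩ := exists_eq_smul_kerSnd_two ((kerSnd k 2).comp φ)
  have hab : a = b := by
    obtain ⟨f, hf⟩ := exists_wedgeSum_contractSum_ne_zero' k
    have h := (φ (totalCover k 1 (0, f))).2
    have h1 : (φ (totalCover k 1 (0, f))).1.1 = a • contractSum k 2 f := by
      refine (ha _).trans ?_
      rw [kerFst_apply, coe_totalCover]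
      simp
    have h2 : (φ (totalCover k 1 (0, f))).1.2 = b • wedgeSum k 3 f := hb _
    rw [mem_ker_totalMap, h1, h2, map_smul, map_smul, contractSum_wedgeSum, smul_neg,
      ← sub_eq_add_neg] at h
    exact AltForm.eq_of_smul_sub_smul_eq_zero hf h
  refine ⟨a, fun x => Subtype.ext (Prod.ext (ha x) ?_)⟩
  rw [hab]
  exact hb x

/-- The kernel is the image of L_2 ⊕ L_4 under `totalCocover`. The Koszul relation identifies two of
the scalars, and the defining equation of the kernel identifies them with the third. -/
theorem hasScalarEndomorphisms_ker_totalMap_one :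
    HasScalarEndomorphisms (V := (totalMap k 1).ker.toSubmodule)
      (totalMap k 1).ker.toRepresentation := by
  intro φ
  obtain ⟨a, ha⟩ := exists_eq_smul_contractSum (by norm_num)
    ((((kerFst k 1).comp φ).comp (totalCocover k 1)).comp (IntertwiningMap.inl k _ _))
  have ha' := eq_zero_of_lt_add_one (by norm_num)
    ((((kerFst k 1).comp φ).comp (totalCocover k 1)).comp (IntertwiningMap.inr k _ _))
  obtain ⟨b, hb⟩ := exists_eq_smul_wedgeSum (by norm_num)
    ((((kerSnd k 1).comp φ).comp (totalCocover k 1)).comp (IntertwiningMap.inl k _ _))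
  obtain ⟨b', hb'⟩ := exists_eq_smul_contractSum (by norm_num)
    ((((kerSnd k 1).comp φ).comp (totalCocover k 1)).comp (IntertwiningMap.inr k _ _))
  have key1 : ∀ y, (φ (totalCocover k 1 y)).1.1 = a • contractSum k 1 y.1 := by
    intro y
    have := prod_map_apply (((kerFst k 1).comp φ).comp (totalCocover k 1)) y
    rw [ha, ha'] at this
    refine this.trans ?_
    change a • contractSum k 1 y.1 + 0 = _
    rw [add_zero]
  have key2 : ∀ y, (φ (totalCocover k 1 y)).1.2 =
      b • wedgeSum k 2 y.1 + b' • contractSum k 3 y.2 := by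
    intro y
    have := prod_map_apply (((kerSnd k 1).comp φ).comp (totalCocover k 1)) y
    rwa [hb, hb'] at this
  have hbb : b = b' := by
    obtain ⟨f, hf⟩ := exists_wedgeSum_contractSum_ne_zero' k
    have := key2 (contractSum k 2 f, wedgeSum k 3 f)
    rw [totalCocover_koszul, map_zero] at this
    simp only [contractSum_wedgeSum, smul_neg, ← sub_eq_add_neg] at this
    exact AltForm.eq_of_smul_sub_smul_eq_zero hf this.symm
  have hab : a = b := by
    obtain ⟨f, hf⟩ := exists_wedgeSum_contractSum_ne_zero k
    have h := (φ (totalCocover k 1 (f, 0))).2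
    rw [mem_ker_totalMap, key1, key2] at h
    simp only [map_smul, map_zero, smul_zero, add_zero] at h
    rw [contractSum_wedgeSum, smul_neg, ← sub_eq_add_neg] at h
    exact AltForm.eq_of_smul_sub_smul_eq_zero hf h
  refine ⟨a, fun x => ?_⟩
  obtain ⟨y, rfl⟩ := totalCocover_surjective x
  refine Subtype.ext (Prod.ext (key1 y) ((key2 y).trans ?_))
  rw [← hbb, ← hab, ← smul_add]
  rfl

variable (k) in
/-- The kernel of `e ∧ d` on forms of degree three. -/
noncomputable def koszulKer : Subrepresentation (altRep k 3) := ((wedgeSum k 2).comp (contractSum k 2)).ker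

variable (k) in
/-- The total map, as a map onto the kernel of `e ∧ d`. -/
noncomputable def totalMapKer : ((altRep k 2).prod (altRep k 4)).IntertwiningMap
    (koszulKer k).toRepresentation :=
  (totalMap k 2).codRestrict _ wedgeSum_contractSum_totalMap

theorem coe_totalMapKer (x : AltForm k 2 × AltForm k 4) :
    ((totalMapKer k x : (koszulKer k).toSubmodule) : AltForm k 3) = totalMap k 2 x := rfl

theorem totalMapKer_surjective : Function.Surjective (totalMapKer k) := by
  rintro ⟨f, hf⟩
  obtain ⟨x, hx⟩ := exists_totalMap_eq hf
  exact ⟨x, Subtype.ext hx⟩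

theorem hasScalarEndomorphisms_koszulKer :
    HasScalarEndomorphisms (V := (koszulKer k).toSubmodule)
      (koszulKer k).toRepresentation := by
  intro φ
  let ι : (koszulKer k).toRepresentation.IntertwiningMap (altRep k 3) :=
    ⟨(koszulKer k).toSubmodule.subtype, fun _ => rfl⟩
  let ψ := (ι.comp φ).comp (totalMapKer k)
  obtain ⟨a, ha⟩ := exists_eq_smul_wedgeSum (by norm_num) (ψ.comp (IntertwiningMap.inl k _ _))
  obtain ⟨b, hb⟩ := exists_eq_smul_contractSum (by norm_num) (ψ.comp (IntertwiningMap.inr k _ _))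
  have key : ∀ y, ((φ (totalMapKer k y) : (koszulKer k).toSubmodule) : AltForm k 3) =
      a • wedgeSum k 2 y.1 + b • contractSum k 3 y.2 := by
    intro y
    have := prod_map_apply ψ y
    rwa [ha, hb] at this
  have hab : a = b := by
    obtain ⟨f, hf⟩ := exists_wedgeSum_contractSum_ne_zero' k
    have := key (contractSum k 2 f, wedgeSum k 3 f)
    have h0 : totalMapKer k (contractSum k 2 f, wedgeSum k 3 f) = 0 := by
      apply Subtype.ext
      rw [coe_totalMapKer]
      simp [wedgeSum_contractSum]
    rw [h0, map_zero] at this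
    simp only [contractSum_wedgeSum, smul_neg, ← sub_eq_add_neg] at this
    exact AltForm.eq_of_smul_sub_smul_eq_zero hf this.symm
  refine ⟨a, fun x => ?_⟩
  obtain ⟨y, rfl⟩ := totalMapKer_surjective x
  apply Subtype.ext
  rw [key, ← hab, ← smul_add]
  rfl

/-! ### Dimensions -/

theorem card_perm_eq_zero : (Fintype.card (Equiv.Perm (Fin 5)) : k) = 0 := by
  rw [CharP.cast_eq_zero_iff k 5]
  simp [Fintype.card_perm, Nat.factorial]

omit [CharP k 5] in
theorem finrank_altForm_zero : Module.finrank k (AltForm k 0) = 1 := by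
  refine (LinearEquiv.finrank_eq (AlternatingMap.constLinearEquivOfIsEmpty (R' := k) (M'' := Fin 5 → k) (N'' := k)
    (ι := Fin 0))).symm.trans (Module.finrank_self k)

-- The dimension is the trace of the identity of a projective module, hence a multiple of the group
-- order.
variable (k) in
theorem finrank_altForm {n : ℕ} (hn : n < 4) : (Module.finrank k (AltForm k (n + 1)) : k) = 0 :=
  (hasHigmanElement_altRep hn).finrank_eq_zero card_perm_eq_zero

variable (k) in
/-- The rank of the exterior product with the sum of the coordinates. -/
noncomputable def wedgeRank (n : ℕ) : ℕ := Module.finrank k (wedgeSum k n).toLinearMap.range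

omit [CharP k 5] in
theorem wedgeRank_zero : wedgeRank k 0 = 1 := by
  rw [wedgeRank, LinearMap.finrank_range_of_inj, finrank_altForm_zero]
  rw [injective_iff_map_eq_zero]
  exact fun c hc => wedgeSum_zero_injective hc

omit [CharP k 5] in
theorem ker_wedgeSum (n : ℕ) :
    (wedgeSum k (n + 1)).toLinearMap.ker = (wedgeSum k n).toLinearMap.range := by
  ext f
  refine ⟨fun hf => exists_wedgeSum_eq hf, ?_⟩
  rintro ⟨f, rfl⟩
  exact wedgeSum_wedgeSum f

/-- By exactness consecutive ranks add up to the dimension of a projective term, which vanishes in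
k. The ranks therefore alternate between 1 and -1 modulo 5. -/
theorem wedgeRank_add {n : ℕ} (hn : n < 4) :
    (wedgeRank k (n + 1) : k) = -wedgeRank k n := by
  have h := (wedgeSum k (n + 1)).toLinearMap.finrank_range_add_finrank_ker
  rw [ker_wedgeSum] at h
  have h2 := finrank_altForm k hn
  rw [← h] at h2
  push_cast at h2
  exact eq_neg_of_add_eq_zero_left h2

/-- The second projection maps U onto eL_3 with kernel eL_1. In k both ranks are -1, and -2 = 3.
Knowing the dimension modulo 5 suffices until the 5-cycle is studied. -/
theorem finrank_ker_totalMap :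
    (Module.finrank k (totalMap k 2).ker.toSubmodule : k) = 3 := by
  have h := LinearMap.finrank_range_add_finrank_ker (V := (totalMap k 2).ker.toSubmodule)
    (kerSnd k 2).toLinearMap
  have h1 : (kerSnd k 2).toLinearMap.range = (wedgeSum k 3).toLinearMap.range := by
    ext h
    constructor
    · rintro ⟨x, rfl⟩
      obtain ⟨y, rfl⟩ := totalCover_surjective x
      exact ⟨y.2, rfl⟩
    · rintro ⟨f, rfl⟩
      exact ⟨totalCover k 1 (0, f), rfl⟩
  have h2 : Module.finrank k (kerSnd k 2).toLinearMap.ker = wedgeRank k 1 := by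
    let e : (kerSnd k 2).toLinearMap.ker ≃ₗ[k] (wedgeSum k 1).toLinearMap.range :=
      LinearEquiv.ofBijective
        (((kerFst k 2).toLinearMap.domRestrict _).codRestrict _ fun x => by
          rw [← ker_wedgeSum]
          have hx := x.1.2
          have hx2 : x.1.1.2 = 0 := x.2
          rw [mem_ker_totalMap, hx2, map_zero, add_zero] at hx
          exact hx) (by
        constructor
        · intro x y hxy
          have hx2 : x.1.1.2 = 0 := x.2
          have hy2 : y.1.1.2 = 0 := y.2
          refine Subtype.ext (Subtype.ext (Prod.ext (congrArg Subtype.val hxy) ?_))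
          rw [hx2, hy2]
        · rintro ⟨_, v, rfl⟩
          refine ⟨⟨totalCover k 1 (v, 0), ?_⟩, Subtype.ext ?_⟩
          · change wedgeSum k 3 0 = 0
            rw [map_zero]
          · change wedgeSum k 1 v + contractSum k 2 0 = wedgeSum k 1 v
            rw [map_zero, add_zero])
    exact e.finrank_eq
  rw [h1, h2] at h
  rw [← h]
  push_cast
  change (wedgeRank k 3 : k) + _ = 3
  rw [wedgeRank_add (n := 2) (by norm_num), wedgeRank_add (n := 1) (by norm_num),
    wedgeRank_add (n := 0) (by norm_num), wedgeRank_zero]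
  have := five_eq_zero (k := k)
  push_cast
  linear_combination -this

theorem finrank_koszulKer : (Module.finrank k (koszulKer k).toSubmodule : k) = 2 := by
  have h := LinearMap.finrank_range_add_finrank_ker (V₂ := (koszulKer k).toSubmodule)
    (totalMapKer k).toLinearMap
  have h1 : (totalMapKer k).toLinearMap.range = ⊤ := LinearMap.range_eq_top.mpr totalMapKer_surjective
  have h2 : (totalMapKer k).toLinearMap.ker = (totalMap k 2).ker.toSubmodule := by
    ext x
    exact Subtype.ext_iff
  rw [h1, h2, finrank_top, Module.finrank_prod] at h
  have h3 := congrArg (Nat.cast : ℕ → k) h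
  push_cast at h3
  rw [finrank_altForm k (n := 1) (by norm_num), finrank_altForm k (n := 3) (by norm_num),
    finrank_ker_totalMap] at h3
  have := five_eq_zero (k := k)
  linear_combination h3 - this

theorem two_ne_zero_of_charP_five : (2 : k) ≠ 0 := by
  have := factorial_ne_zero (k := k) (n := 2) (by norm_num)
  simpa using this

theorem three_ne_zero_of_charP_five : (3 : k) ≠ 0 := by
  have h : (3 : k) * 2 ≠ 0 := by
    have := factorial_ne_zero (k := k) (n := 3) (by norm_num)
    norm_num [Nat.factorial] at this ⊢
    exact this
  exact left_ne_zero_of_mul h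

/-- The second Heller translate of the quotient of the forms of degree three by the kernel
of `e ∧ d`. -/
theorem IsHellerTranslateSq.equiv_ker_totalMap {S V : Type u} [AddCommGroup S] [Module k S]
    [AddCommGroup V] [Module k V] {τ : Representation k (Equiv.Perm (Fin 5)) S}
    {ρ : Representation k (Equiv.Perm (Fin 5)) V} (h : IsHellerTranslateSq τ ρ)
    (q : (altRep k 3).IntertwiningMap τ) (hq : Function.Surjective q)
    (hq' : ∀ f, q f = 0 ↔ wedgeSum k 2 (contractSum k 2 f) = 0) :
    Nonempty (ρ.Equiv (totalMap k 2).ker.toRepresentation) := by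
  obtain ⟨L, _, _, σ, h1, h2⟩ := h
  have hker : q.ker = koszulKer k := Subrepresentation.toSubmodule_injective <| by
    ext f
    exact hq' f
  -- The kernel has dimension 2 modulo 5, so it is not projective and L_3 computes the first Heller
  -- translate.
  have e1 := h1.equiv_ker q (hasHigmanElement_altRep (by norm_num)) hq
    (by rw [hker]; exact hasScalarEndomorphisms_koszulKer)
    (by
      rw [hker]
      intro hH
      have := hH.finrank_eq_zero card_perm_eq_zero
      rw [finrank_koszulKer] at this
      exact two_ne_zero_of_charP_five this)
  rw [hker] at e1
  obtain ⟨e⟩ := e1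
  -- The total map presents the first translate by the projective L_2 ⊕ L_4, with a kernel of
  -- dimension 3 modulo 5.
  let f := e.symm.toIntertwiningMap.comp (totalMapKer k)
  have hker2 : f.ker = (totalMap k 2).ker := Subrepresentation.toSubmodule_injective <| by
    ext x
    change e.symm (totalMapKer k x) = 0 ↔ totalMap k 2 x = 0
    rw [EmbeddingLike.map_eq_zero_iff]
    exact Subtype.ext_iff
  have e2 := h2.equiv_ker f
    ((hasHigmanElement_altRep (by norm_num)).prod (hasHigmanElement_altRep (by norm_num)))
    (e.symm.toLinearEquiv.surjective.comp totalMapKer_surjective)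
    (by rw [hker2]; exact hasScalarEndomorphisms_ker_totalMap_two)
    (by
      rw [hker2]
      intro hH
      have := hH.finrank_eq_zero card_perm_eq_zero
      rw [finrank_ker_totalMap] at this
      exact three_ne_zero_of_charP_five this)
  rwa [hker2] at e2

end Total

/-! ### Isomorphisms of representations -/

section Isomorphisms

open Representation

variable {k : Type*} [Field k] {G : Type*} [Group G] {V V' W W' X : Type*}
  [AddCommGroup V] [Module k V] [AddCommGroup V'] [Module k V'] [AddCommGroup W] [Module k W]
  [AddCommGroup W'] [Module k W'] [AddCommGroup X] [Module k X]
  {ρ : Representation k G V} {ρ' : Representation k G V'} {σ : Representation k G W}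
  {σ' : Representation k G W'} {τ : Representation k G X}

/-- Two quotients of a representation with the same kernel are isomorphic. -/
theorem Representation.IntertwiningMap.nonempty_equiv_of_ker_eq (f : ρ.IntertwiningMap σ)
    (g : ρ.IntertwiningMap τ) (hf : Function.Surjective f) (hg : Function.Surjective g)
    (h : ∀ x, f x = 0 ↔ g x = 0) : Nonempty (σ.Equiv τ) := by
  obtain ⟨s, hs⟩ := f.toLinearMap.exists_rightInverse_of_surjective
    (LinearMap.range_eq_top.mpr hf)
  have hs' : ∀ w, f (s w) = w := fun w => congr($hs w)
  have key : ∀ x y, f x = f y → g x = g y := by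
    intro x y hxy
    rw [← sub_eq_zero, ← map_sub, ← h, map_sub, hxy, sub_self]
  refine ⟨Representation.Equiv.mk (LinearEquiv.ofBijective (g.toLinearMap ∘ₗ s) ⟨?_, ?_⟩) ?_⟩
  · rw [injective_iff_map_eq_zero]
    intro w hw
    rw [← hs' w]
    exact (h _).mpr hw
  · intro y
    obtain ⟨x, rfl⟩ := hg y
    exact ⟨f x, key _ _ (hs' _)⟩
  · intro a
    ext w
    change g (s (σ a w)) = τ a (g (s w))
    rw [← g.isIntertwining]
    apply key
    rw [f.isIntertwining, hs', hs']

theorem Representation.Equiv.map_apply (e : ρ.Equiv σ) (g : G) (v : V) :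
    e (ρ g v) = σ g (e v) := IntertwiningMap.isIntertwining _ _ e.toIntertwiningMap g v

/-- The dual of an isomorphism. -/
def Representation.Equiv.dualEquiv (e : ρ.Equiv σ) : σ.dual.Equiv ρ.dual :=
  Representation.Equiv.mk e.toLinearEquiv.dualMap fun g => by
    ext f v
    change f (σ g⁻¹ (e v)) = f (e (ρ g⁻¹ v))
    rw [e.map_apply]

/-- A finite-dimensional representation is isomorphic to its bidual. -/
noncomputable def Representation.Equiv.bidual [FiniteDimensional k V] (ρ : Representation k G V) :
    ρ.Equiv ρ.dual.dual :=
  Representation.Equiv.mk (Module.evalEquiv k V) fun g => by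
    ext v f
    change f (ρ g v) = f (ρ g⁻¹⁻¹ v)
    rw [inv_inv]

/-- The isomorphism on spaces of linear maps induced by two isomorphisms. -/
def Representation.Equiv.linHomCongr (e : ρ.Equiv ρ') (f : σ.Equiv σ') :
    (linHom ρ σ).Equiv (linHom ρ' σ') :=
  Representation.Equiv.mk (LinearEquiv.arrowCongr e.toLinearEquiv f.toLinearEquiv) fun g => by
    ext φ v
    change f (σ g (φ (ρ g⁻¹ (e.symm v)))) = σ' g (f (φ (e.symm (ρ' g⁻¹ v))))
    rw [f.map_apply, e.symm.map_apply]

/-- The dual of `V ⊗ W` is the space of linear maps from `V` to the dual of `W`. -/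
noncomputable def Representation.Equiv.tprodDual (ρ : Representation k G V) (σ : Representation k G W) :
    (ρ.tprod σ).dual.Equiv (linHom ρ σ.dual) :=
  Representation.Equiv.mk (TensorProduct.lift.equiv (RingHom.id k) V W k).symm fun g => by
    ext φ v w
    rfl

/-- `V ⊗ W` is the space of linear maps from the dual of `V` to `W`. -/
noncomputable def Representation.Equiv.tprodLinHom [FiniteDimensional k V]
    (ρ : Representation k G V) (σ : Representation k G W) :
    (ρ.tprod σ).Equiv (linHom ρ.dual σ) :=
  (Representation.Equiv.mk (TensorProduct.congr (Module.evalEquiv k V) (LinearEquiv.refl k W))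
    fun g => by
      ext v w
      change Module.evalEquiv k V (ρ g v) ⊗ₜ σ g w =
        ρ.dual.dual g (Module.evalEquiv k V v) ⊗ₜ[k] σ g w
      congr 1
      exact (Representation.Equiv.bidual ρ).map_apply g v :
    (ρ.tprod σ).Equiv (ρ.dual.dual.tprod σ)).trans (Representation.Equiv.dualTensorHom ρ.dual σ)

end Isomorphisms

/-! ### Duality between the kernels of the total maps -/

section Duality

open Representation

variable {k : Type u} [Field k]

/-- The pairing of two forms: the sum over all tuples of the products of the coefficients. -/
def AltForm.pairing (k : Type u) [Field k] (n : ℕ) : AltForm k n →ₗ[k] AltForm k n →ₗ[k] k :=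
  LinearMap.mk₂ k (fun f g => ∑ x, f.coeff x * g.coeff x)
    (fun f f' g => by simp [AltForm.coeff_add, add_mul, Finset.sum_add_distrib])
    (fun c f g => by simp [AltForm.coeff_smul, Finset.mul_sum, mul_assoc])
    (fun f g g' => by simp [AltForm.coeff_add, mul_add, Finset.sum_add_distrib])
    (fun c f g => by simp [AltForm.coeff_smul, Finset.mul_sum, mul_left_comm])

theorem AltForm.pairing_apply {n : ℕ} (f g : AltForm k n) :
    AltForm.pairing k _ f g = ∑ x, f.coeff x * g.coeff x := rfl

theorem AltForm.pairing_comm {n : ℕ} (f g : AltForm k n) :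
    AltForm.pairing k _ f g = AltForm.pairing k _ g f := by
  simp only [AltForm.pairing_apply, mul_comm]

theorem AltForm.pairing_altRep {n : ℕ} (f g : AltForm k n) (a : Equiv.Perm (Fin 5)) :
    AltForm.pairing k _ (altRep k n a f) (altRep k n a g) = AltForm.pairing k _ f g := by
  simp only [AltForm.pairing_apply, AltForm.coeff_altRep]
  exact Fintype.sum_equiv (Equiv.arrowCongr (Equiv.refl _) a⁻¹) _ _ fun x => rfl

/-- Wedge and contraction are adjoint up to the factor `n + 1`: each of the `n + 1` positions of the
removed entry contributes the same sum, the sign being cancelled by moving the entry to the front.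
-/
theorem AltForm.pairing_wedgeSum {n : ℕ} (f : AltForm k n) (g : AltForm k (n + 1)) :
    AltForm.pairing k _ (wedgeSum k n f) g = (n + 1) * AltForm.pairing k _ f (contractSum k n g) := by
  simp only [AltForm.pairing_apply, coeff_wedgeSum, coeff_contractSum, Finset.sum_mul]
  rw [Finset.sum_comm]
  have : ∀ i : Fin (n + 1), ∑ x : Fin (n + 1) → Fin 5,
      (-1) ^ (i : ℕ) * f.coeff (i.removeNth x) * g.coeff x =
      ∑ y, f.coeff y * ∑ a, g.coeff (Matrix.vecCons a y) := by
    intro i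
    rw [← (Fin.insertNthEquiv (fun _ => Fin 5) i).sum_comp, Fintype.sum_prod_type,
      Finset.sum_comm]
    refine Finset.sum_congr rfl fun y _ => ?_
    rw [Finset.mul_sum]
    refine Finset.sum_congr rfl fun a _ => ?_
    have h1 : (fun j => (Pi.single (i.insertNth (α := fun _ => Fin 5) a y j) 1 : Fin 5 → k)) =
        i.insertNth (α := fun _ => Fin 5 → k) (Pi.single a 1) (fun j => Pi.single (y j) 1) := by
      ext j : 1
      refine Fin.succAboveCases i ?_ (fun j => ?_) j <;> simp
    have h2 : (fun j => (Pi.single (Matrix.vecCons a y j) 1 : Fin 5 → k)) =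
        Matrix.vecCons (Pi.single a 1) (fun j => Pi.single (y j) 1) := by
      ext j : 1
      refine Fin.cases ?_ (fun j => ?_) j <;> simp
    have h3 : (-1 : k) ^ (i : ℕ) * g.coeff (i.insertNth (α := fun _ => Fin 5) a y) =
        g.coeff (Matrix.vecCons a y) := by
      simp only [AltForm.coeff]
      rw [h1, h2]
      have := g.map_insertNth i (Pi.single a 1) (fun j => Pi.single (y j) 1)
      rw [this]
      simp [← mul_assoc, ← pow_add, ← two_mul]
    rw [← h3]
    change (-1) ^ (i : ℕ) * f.coeff (i.removeNth (i.insertNth (α := fun _ => Fin 5) a y)) *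
      g.coeff (i.insertNth (α := fun _ => Fin 5) a y) = _
    rw [Fin.removeNth_insertNth]
    ring
  simp only [this]
  simp

variable [CharP k 5]

/-- Pairing with a basis form returns `n!` times a coefficient. -/
theorem AltForm.eq_zero_of_pairing_eq_zero {n : ℕ} (hn : n < 5) {f : AltForm k n}
    (h : ∀ g, AltForm.pairing k _ g f = 0) : f = 0 := by
  apply AltForm.ext_coeff
  intro x _
  rw [AltForm.coeff_zero]
  have h1 : AltForm.pairing k _ (dualForm k x) f = n.factorial * f.coeff x := by
    rw [AltForm.pairing_apply]
    simp only [coeff_dualForm, Finset.sum_mul]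
    rw [Finset.sum_comm]
    have : ∀ σ : Equiv.Perm (Fin n), ∑ y : Fin n → Fin 5,
        ((Equiv.Perm.sign σ : ℤ) : k) * (if y ∘ σ = x then 1 else 0) * f.coeff y = f.coeff x := by
      intro σ
      rw [Finset.sum_eq_single (x ∘ ⇑σ⁻¹)]
      · rw [AltForm.coeff_comp_perm, if_pos (by ext; simp)]
        rw [Equiv.Perm.sign_inv, mul_one, ← mul_assoc, ← Int.cast_mul, ← Units.val_mul,
          Int.units_mul_self]
        simp
      · intro y _ hy
        rw [if_neg, mul_zero, zero_mul]
        rintro rfl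
        exact hy (by ext; simp)
      · simp
    rw [Finset.sum_congr rfl fun σ _ => this σ]
    simp [Fintype.card_perm]
  rw [h] at h1
  exact (mul_eq_zero.mp h1.symm).resolve_left (factorial_ne_zero hn)

theorem AltForm.exists_pairing_eq {n : ℕ} (hn : n < 5) (l : Module.Dual k (AltForm k n)) :
    ∃ f, AltForm.pairing k _ f = l := by
  have hinj : Function.Injective (AltForm.pairing k n) := by
    rw [injective_iff_map_eq_zero]
    intro f hf
    refine AltForm.eq_zero_of_pairing_eq_zero hn fun g => ?_
    rw [AltForm.pairing_comm, hf]
    rfl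
  exact (LinearMap.injective_iff_surjective_of_finrank_eq_finrank
    (Subspace.dual_finrank_eq (K := k) (V := AltForm k n)).symm).mp hinj l

variable (k) in
/-- The pairing of `L₁ × L₃` with the kernel of the total map in it. -/
noncomputable def pairingKer : ((altRep k 1).prod (altRep k 3)).IntertwiningMap
    (totalMap k 1).ker.toRepresentation.dual where
  toLinearMap := LinearMap.mk₂ k
    (fun (x : AltForm k 1 × AltForm k 3) (y : (totalMap k 1).ker.toSubmodule) =>
      AltForm.pairing k _ x.1 y.1.1 + AltForm.pairing k _ x.2 y.1.2)
    (fun x x' y => by simp; ring) (fun c x y => by simp; ring)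
    (fun x y y' => by simp; ring) (fun c x y => by simp; ring)
  isIntertwining' g := LinearMap.ext fun x => LinearMap.ext fun y => by
    change AltForm.pairing k _ (altRep k 1 g x.1) y.1.1 +
      AltForm.pairing k _ (altRep k 3 g x.2) y.1.2 =
      AltForm.pairing k _ x.1 (altRep k 1 g⁻¹ y.1.1) +
      AltForm.pairing k _ x.2 (altRep k 3 g⁻¹ y.1.2)
    rw [← AltForm.pairing_altRep x.1 _ g, ← AltForm.pairing_altRep x.2 _ g,
      ← Module.End.mul_apply, ← Module.End.mul_apply, ← map_mul, ← map_mul]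
    simp

omit [CharP k 5] in
theorem pairingKer_apply (x : AltForm k 1 × AltForm k 3) (y : (totalMap k 1).ker.toSubmodule) :
    pairingKer k x y = AltForm.pairing k _ x.1 y.1.1 + AltForm.pairing k _ x.2 y.1.2 := rfl

theorem pairingKer_surjective : Function.Surjective (pairingKer k) := by
  intro l
  obtain ⟨l', hl'⟩ := LinearMap.exists_extend l
  obtain ⟨f, hf⟩ := AltForm.exists_pairing_eq (by norm_num) (l' ∘ₗ LinearMap.inl k _ _)
  obtain ⟨g, hg⟩ := AltForm.exists_pairing_eq (by norm_num) (l' ∘ₗ LinearMap.inr k _ _)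
  refine ⟨(f, g), ?_⟩
  ext y
  rw [pairingKer_apply, hf, hg, ← hl']
  change l' (y.1.1, 0) + l' (0, y.1.2) = l' y.1
  rw [← map_add]
  simp

/-- Adjunction gives the factor 1/2 for e in degree one and 3 for d in degree three. In
characteristic 5 these agree, which lets the two terms combine into the first component of
`totalCover`. -/
theorem pairingKer_totalCocover (x : AltForm k 1 × AltForm k 3) (y : AltForm k 2 × AltForm k 4) :
    pairingKer k x (totalCocover k 1 y) =
      3 * AltForm.pairing k _ y.1 (wedgeSum k 1 x.1 + contractSum k 2 x.2) +
        4⁻¹ * AltForm.pairing k _ y.2 (wedgeSum k 3 x.2) := by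
  have h5 := five_eq_zero (k := k)
  have h4 : (4 : k) ≠ 0 := by
    intro h
    have : (1 : k) = 0 := by linear_combination h5 - h
    exact one_ne_zero this
  rw [pairingKer_apply, coe_totalCocover, map_add, map_add, AltForm.pairing_comm x.2 (_),
    AltForm.pairing_wedgeSum, AltForm.pairing_comm y.1 (wedgeSum k 1 x.1),
    AltForm.pairing_wedgeSum, AltForm.pairing_comm y.2, AltForm.pairing_wedgeSum]
  push_cast
  have : (3 + 1 : k) = 4 := by norm_num
  rw [this, inv_mul_cancel_left₀ h4]
  linear_combination (-AltForm.pairing k _ x.1 (contractSum k 1 y.1)) * h5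

/-- By nondegeneracy, the annihilator in L_1 ⊕ L_3 of the first kernel is the kernel of
`totalCover`. So U and the dual of the first kernel are quotients of L_1 ⊕ L_3 by the same
submodule. -/
theorem pairingKer_eq_zero_iff (x : AltForm k 1 × AltForm k 3) :
    pairingKer k x = 0 ↔ totalCover k 1 x = 0 := by
  have h4 : (4 : k)⁻¹ ≠ 0 := by
    refine inv_ne_zero fun h => one_ne_zero (α := k) ?_
    linear_combination five_eq_zero (k := k) - h
  constructor
  · intro h
    have key : ∀ y : AltForm k 2 × AltForm k 4, 3 * AltForm.pairing k _ y.1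
        (wedgeSum k 1 x.1 + contractSum k 2 x.2) + 4⁻¹ * AltForm.pairing k _ y.2 (wedgeSum k 3 x.2)
        = 0 := by
      intro y
      rw [← pairingKer_totalCocover, h]
      rfl
    refine Subtype.ext (Prod.ext ?_ ?_)
    · refine AltForm.eq_zero_of_pairing_eq_zero (by norm_num) fun g => ?_
      have := key (g, 0)
      rw [map_zero, LinearMap.zero_apply, mul_zero, add_zero] at this
      exact (mul_eq_zero.mp this).resolve_left three_ne_zero_of_charP_five
    · refine AltForm.eq_zero_of_pairing_eq_zero (by norm_num) fun g => ?_
      have := key (0, g)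
      rw [map_zero, LinearMap.zero_apply, mul_zero, zero_add] at this
      exact (mul_eq_zero.mp this).resolve_left h4
  · intro h
    ext y
    obtain ⟨y, rfl⟩ := totalCocover_surjective y
    have h1 : wedgeSum k 1 x.1 + contractSum k 2 x.2 = 0 := congrArg (fun z => z.1.1) h
    have h2 : wedgeSum k 3 x.2 = 0 := congrArg (fun z => z.1.2) h
    rw [pairingKer_totalCocover, h1, h2]
    simp

variable (k) in
/-- The kernels of the first and the second total map are dual to each other. -/
theorem nonempty_equiv_dual_ker_totalMap : Nonempty ((totalMap k 2).ker.toRepresentation.Equiv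
    (totalMap k 1).ker.toRepresentation.dual) :=
  (totalCover k 1).nonempty_equiv_of_ker_eq (W := (totalMap k 2).ker.toSubmodule)
    (X := Module.Dual k (totalMap k 1).ker.toSubmodule) (pairingKer k) totalCover_surjective
    pairingKer_surjective fun x => (pairingKer_eq_zero_iff x).symm

end Duality

/-! ### Vanishing of the first cohomology -/

section Cohomology

open Representation

variable {k : Type*} [Field k] {G : Type*} [Group G] {V W X : Type*}
  [AddCommGroup V] [Module k V] [AddCommGroup W] [Module k W] [AddCommGroup X] [Module k X]
  {ρ : Representation k G V} {σ : Representation k G W} {τ : Representation k G X}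

/-- The first cohomology of `ρ` vanishes: all cocycles are coboundaries. -/
def H1Trivial (ρ : Representation k G V) : Prop :=
  ∀ c : G → V, (∀ g h, c (g * h) = c g + ρ g (c h)) → ∃ v, ∀ g, c g = ρ g v - v

theorem H1Trivial.of_exact (hρ : H1Trivial ρ) (hτ : H1Trivial τ) (f : ρ.IntertwiningMap σ)
    (p : σ.IntertwiningMap τ) (hf : Function.Injective f) (hp : Function.Surjective p)
    (hfp : ∀ x, p x = 0 → ∃ y, f y = x) : H1Trivial σ := by
  intro c hc
  obtain ⟨w, hw⟩ := hτ (fun g => p (c g)) fun g h => by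
    simp only [hc, map_add, p.isIntertwining]
  obtain ⟨v, rfl⟩ := hp w
  have h1 : ∀ g, ∃ y, f y = c g - (σ g v - v) := by
    intro g
    apply hfp
    rw [map_sub, map_sub, p.isIntertwining, hw, sub_self]
  choose d hd using h1
  obtain ⟨y, hy⟩ := hρ d fun g h => hf <| by
    rw [map_add, f.isIntertwining, hd, hd, hd, hc, map_sub, map_sub, map_mul,
      Module.End.mul_apply]
    abel
  refine ⟨f y + v, fun g => ?_⟩
  rw [map_add, ← f.isIntertwining, ← sub_add_cancel (c g) (σ g v - v), ← hd, hy, map_sub]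
  abel

theorem H1Trivial.congr (hρ : H1Trivial ρ) (e : ρ.Equiv σ) : H1Trivial σ := by
  intro c hc
  obtain ⟨v, hv⟩ := hρ (fun g => e.symm (c g)) fun g h => by
    simp only [hc, map_add, e.symm.map_apply]
  refine ⟨e v, fun g => e.symm.toLinearEquiv.injective ?_⟩
  change e.symm (c g) = e.symm (σ g (e v) - e v)
  rw [hv, map_sub, e.symm.map_apply, e.symm_apply_apply]

theorem H1Trivial.of_subsingleton [Subsingleton V] (ρ : Representation k G V) : H1Trivial ρ :=
  fun _ _ => ⟨0, fun _ => Subsingleton.elim _ _⟩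

/-- If the first cohomology of the linear maps into the kernel of `p` vanishes, then intertwining
maps with values in the range of `p` lift along `p`. -/
theorem H1Trivial.exists_lift {p : σ.IntertwiningMap τ}
    (h : H1Trivial (linHom ρ p.ker.toRepresentation)) (φ : ρ.IntertwiningMap τ)
    (hφ : ∀ v, ∃ w, p w = φ v) : ∃ ψ : ρ.IntertwiningMap σ, ∀ v, p (ψ v) = φ v := by
  obtain ⟨t, ht⟩ := p.toLinearMap.rangeRestrict.exists_rightInverse_of_surjective
    p.toLinearMap.range_rangeRestrict
  -- `s` is a linear lift of `φ`. Its failure to be equivariant is a cocycle with values in the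
  -- linear maps into the kernel of `p`, and a primitive of that cocycle corrects it.
  let s : V →ₗ[k] W := t ∘ₗ φ.toLinearMap.codRestrict p.toLinearMap.range hφ
  have hs : ∀ v, p (s v) = φ v := fun v =>
    congrArg Subtype.val congr($ht (φ.toLinearMap.codRestrict p.toLinearMap.range hφ v))
  have hmem : ∀ g v, (linHom ρ σ g s - s) v ∈ p.ker.toSubmodule := by
    intro g v
    change p (σ g (s (ρ g⁻¹ v)) - s v) = 0
    rw [map_sub, p.isIntertwining, hs, hs, φ.apply_inv, sub_self]
  obtain ⟨θ, hθ⟩ := h (fun g => (linHom ρ σ g s - s).codRestrict _ (hmem g)) fun g h => by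
    ext v
    change (linHom ρ σ (g * h) s) v - s v = (linHom ρ σ g s) v - s v +
      σ g ((linHom ρ σ h s) (ρ g⁻¹ v) - s (ρ g⁻¹ v))
    rw [map_mul, map_sub]
    simp
  have hθ' : ∀ g v, σ g (s (ρ g⁻¹ v)) - s v = σ g (θ (ρ g⁻¹ v)).1 - (θ v).1 := fun g v =>
    congrArg Subtype.val congr($(hθ g) v)
  refine ⟨⟨s - p.ker.toSubmodule.subtype ∘ₗ θ, fun g => ?_⟩, fun v => ?_⟩
  · ext v
    have := hθ' g (ρ g v)
    rw [← Module.End.mul_apply, ← map_mul, inv_mul_cancel, map_one] at this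
    change s (ρ g v) - (θ (ρ g v)).1 = σ g (s v - (θ v).1)
    rw [map_sub]
    simp only [Module.End.one_apply] at this
    rw [sub_eq_sub_iff_add_eq_add] at this ⊢
    rw [this, add_comm]
  · change p (s v - (θ v).1) = φ v
    have : p (θ v).1 = 0 := (θ v).2
    rw [map_sub, hs, this, sub_zero]

theorem H1Trivial.exists_lift_of_equiv {V' W' : Type*} [AddCommGroup V'] [Module k V']
    [AddCommGroup W'] [Module k W'] {ρ' : Representation k G V'} {σ' : Representation k G W'}
    {p : σ.IntertwiningMap τ} (h : H1Trivial (linHom ρ' σ')) (e : ρ'.Equiv ρ)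
    (e' : σ'.Equiv p.ker.toRepresentation) (φ : ρ.IntertwiningMap τ) (hφ : ∀ v, ∃ w, p w = φ v) :
    ∃ ψ : ρ.IntertwiningMap σ, ∀ v, p (ψ v) = φ v :=
  (h.congr (Representation.Equiv.linHomCongr e e')).exists_lift φ hφ

/-! ### Filtrations -/

theorem H1Trivial.of_subquotientIso {A B : Subrepresentation ρ} (h : SubquotientIso A B σ)
    (hA : H1Trivial A.toRepresentation) (hσ : H1Trivial σ) : H1Trivial B.toRepresentation := by
  obtain ⟨hAB, f, hf, hf'⟩ := h
  let i : A.toRepresentation.IntertwiningMap B.toRepresentation :=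
    ⟨Submodule.inclusion hAB, fun _ => rfl⟩
  exact hA.of_exact hσ i f (Submodule.inclusion_injective hAB) hf
    fun x hx => ⟨⟨x, (hf' x).mp hx⟩, rfl⟩

/-- The transpose of an intertwining map. -/
def Representation.IntertwiningMap.dualMap (f : ρ.IntertwiningMap σ) :
    σ.dual.IntertwiningMap ρ.dual where
  toLinearMap := f.toLinearMap.dualMap
  isIntertwining' g := by
    ext l v
    change l (σ g⁻¹ (f v)) = l (f (ρ g⁻¹ v))
    rw [f.isIntertwining]

theorem H1Trivial.dual_of_exact (hρ : H1Trivial ρ.dual) (hτ : H1Trivial τ.dual)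
    (f : ρ.IntertwiningMap σ) (p : σ.IntertwiningMap τ) (hf : Function.Injective f)
    (hp : Function.Surjective p) (hfp : ∀ x, p x = 0 ↔ ∃ y, f y = x) : H1Trivial σ.dual := by
  refine hτ.of_exact hρ p.dualMap f.dualMap (LinearMap.dualMap_injective_of_surjective hp)
    (LinearMap.dualMap_surjective_of_injective hf) fun l hl => ?_
  have hl' : ∀ y, l (f y) = 0 := fun y => congr($hl y)
  obtain ⟨s, hs⟩ := p.toLinearMap.exists_rightInverse_of_surjective
    (LinearMap.range_eq_top.mpr hp)
  have hs' : ∀ w, p (s w) = w := fun w => congr($hs w)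
  refine ⟨l ∘ₗ s, ?_⟩
  ext x
  change l (s (p x)) = l x
  rw [← sub_eq_zero, ← map_sub]
  obtain ⟨y, hy⟩ := (hfp (s (p x) - x)).mp (by rw [map_sub, hs', sub_self])
  rw [← hy, hl']

theorem H1Trivial.dual_of_subquotientIso {A B : Subrepresentation ρ} (h : SubquotientIso A B σ)
    (hA : H1Trivial A.toRepresentation.dual) (hσ : H1Trivial σ.dual) :
    H1Trivial B.toRepresentation.dual := by
  obtain ⟨hAB, f, hf, hf'⟩ := h
  let i : A.toRepresentation.IntertwiningMap B.toRepresentation :=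
    ⟨Submodule.inclusion hAB, fun _ => rfl⟩
  refine hA.dual_of_exact hσ i f (Submodule.inclusion_injective hAB) hf
    fun x => ⟨fun hx => ⟨⟨x, (hf' x).mp hx⟩, rfl⟩, ?_⟩
  rintro ⟨y, rfl⟩
  exact (hf' _).mpr y.2

/-- The isomorphism of the largest subrepresentation with the whole representation. -/
def Representation.Equiv.top (ρ : Representation k G V) :
    (⊤ : Subrepresentation ρ).toRepresentation.Equiv ρ :=
  Representation.Equiv.mk Submodule.topEquiv fun _ => rfl

theorem subsingleton_bot (ρ : Representation k G V) :
    Subsingleton (⊥ : Subrepresentation ρ).toSubmodule :=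
  ⟨fun x y => Subtype.ext (((Submodule.mem_bot k).mp x.2).trans ((Submodule.mem_bot k).mp y.2).symm)⟩

theorem HasDualSpechtFiltration.h1Trivial {d : ℕ} {ρ : Representation k (Equiv.Perm (Fin d)) V}
    (h : HasDualSpechtFiltration ρ)
    (hS : ∀ μ : YoungDiagram, μ.card = d → H1Trivial (spechtRep k μ d).dual) : H1Trivial ρ := by
  obtain ⟨n, F, h0, h1, h2⟩ := h
  have : ∀ i, H1Trivial (F i).toRepresentation := by
    intro i
    induction i using Fin.induction with
    | zero =>
      rw [h0]
      have := subsingleton_bot ρ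
      exact H1Trivial.of_subsingleton _
    | succ i ih =>
      obtain ⟨μ, hμ, hs⟩ := h2 i
      exact H1Trivial.of_subquotientIso hs ih (hS μ hμ)
  have h3 := this (Fin.last n)
  rw [h1] at h3
  exact h3.congr (Representation.Equiv.top ρ)

theorem HasSpechtFiltration.h1Trivial {d : ℕ} {ρ : Representation k (Equiv.Perm (Fin d)) V}
    (h : HasSpechtFiltration ρ)
    (hS : ∀ μ : YoungDiagram, μ.card = d → H1Trivial (spechtRep k μ d).dual) :
    H1Trivial ρ.dual := by
  obtain ⟨n, F, h0, h1, h2⟩ := h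
  have : ∀ i, H1Trivial (F i).toRepresentation.dual := by
    intro i
    induction i using Fin.induction with
    | zero =>
      rw [h0]
      have := subsingleton_bot ρ
      exact H1Trivial.of_subsingleton _
    | succ i ih =>
      obtain ⟨μ, hμ, hs⟩ := h2 i
      exact H1Trivial.dual_of_subquotientIso hs ih (hS μ hμ)
  have h3 := this (Fin.last n)
  rw [h1] at h3
  exact h3.congr (Representation.Equiv.top ρ).symm.dualEquiv

/-! ### Vanishing theorems -/

/-- If `A → B → C → 0` is exact, the first cohomology of the dual of `B` vanishes and `A` has no
nonzero invariant linear form, then the first cohomology of the dual of `C` vanishes. -/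
theorem H1Trivial.dual_of_rightExact (f : ρ.IntertwiningMap σ) (p : σ.IntertwiningMap τ)
    (hp : Function.Surjective p) (hfp : ∀ x, p x = 0 ↔ ∃ y, f y = x) (hσ : H1Trivial σ.dual)
    (hρ : ∀ l : Module.Dual k V, (∀ g, ρ.dual g l = l) → l = 0) : H1Trivial τ.dual := by
  intro c hc
  obtain ⟨l, hl⟩ := hσ (fun g => p.dualMap (c g)) fun g h => by
    simp only [hc, map_add, p.dualMap.isIntertwining]
  -- Pulled back to A, the form `l` is invariant, hence zero, so it descends to C.
  have h1 : f.dualMap l = 0 := by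
    refine hρ _ fun g => ?_
    rw [← f.dualMap.isIntertwining, ← sub_eq_zero, ← map_sub, ← hl]
    ext v
    change c g (p (f v)) = 0
    rw [(hfp _).mpr ⟨v, rfl⟩, map_zero]
  have hl' : ∀ y, l (f y) = 0 := fun y => congr($h1 y)
  obtain ⟨s, hs⟩ := p.toLinearMap.exists_rightInverse_of_surjective
    (LinearMap.range_eq_top.mpr hp)
  have hs' : ∀ w, p (s w) = w := fun w => congr($hs w)
  have h2 : p.dualMap (l ∘ₗ s) = l := by
    ext x
    change l (s (p x)) = l x
    rw [← sub_eq_zero, ← map_sub]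
    obtain ⟨y, hy⟩ := (hfp (s (p x) - x)).mp (by rw [map_sub, hs', sub_self])
    rw [← hy, hl']
  refine ⟨l ∘ₗ s, fun g => LinearMap.dualMap_injective_of_surjective hp ?_⟩
  change p.dualMap (c g) = p.dualMap (τ.dual g (l ∘ₗ s) - l ∘ₗ s)
  rw [hl, map_sub, p.dualMap.isIntertwining, h2]

/-- The cocycle condition turns the translate by `h` of the averaged cocycle into the average of `c
g - c h`, and the Higman element averages the constant `c h` to itself. -/
theorem HasHigmanElement.h1Trivial [Fintype G] (hρ : HasHigmanElement ρ) : H1Trivial ρ := by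
  obtain ⟨θ, hθ⟩ := hρ
  intro c hc
  refine ⟨-∑ g, ρ g (θ (ρ g⁻¹ (c g))), fun h => ?_⟩
  have h1 : ∑ g, ρ g (θ (ρ g⁻¹ (c h))) = c h := hθ _
  have h2 : ρ h (∑ g, ρ g (θ (ρ g⁻¹ (c g)))) = ∑ g, ρ g (θ (ρ g⁻¹ (c g - c h))) := by
    rw [map_sum]
    refine Fintype.sum_equiv (Equiv.mulLeft h) _ _ fun g => ?_
    have : c (h * g) - c h = ρ h (c g) := by rw [hc]; abel
    rw [Equiv.coe_mulLeft, this, mul_inv_rev]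
    simp only [← Module.End.mul_apply, ← map_mul]
    simp
  rw [map_neg, h2]
  simp only [map_sub, Finset.sum_sub_distrib]
  rw [h1]
  abel

theorem HasHigmanElement.dual [Fintype G] (hρ : HasHigmanElement ρ) :
    HasHigmanElement ρ.dual := by
  obtain ⟨θ, hθ⟩ := hρ
  refine ⟨θ.dualMap, fun l => ?_⟩
  ext v
  rw [LinearMap.sum_apply]
  conv_rhs => rw [← hθ v, map_sum]
  refine Finset.sum_congr rfl fun g _ => ?_
  change l (ρ g⁻¹⁻¹ (θ (ρ g⁻¹ v))) = _
  rw [inv_inv]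

/-- A central element of the group algebra, the sum of a family of elements of the group, that acts
as a scalar different from its augmentation kills the cohomology. -/
theorem H1Trivial.of_sum_smul {ι : Type*} [Fintype ι] (x : ι → G) (e : G → ι ≃ ι)
    (he : ∀ g i, x (e g i) = g * x i * g⁻¹) {a : k} (ha : a ≠ Fintype.card ι)
    (h : ∀ v, ∑ i, ρ (x i) v = a • v) : H1Trivial ρ := by
  intro c hc
  have hconj : ∀ g, ∑ i, c (g * x i) = ∑ i, c (x i * g) := by
    intro g
    refine Fintype.sum_equiv (e g) _ _ fun i => ?_
    rw [he, inv_mul_cancel_right]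
  -- Expanding the cocycle on `g * x i` and on `x i * g` and comparing the sums makes a nonzero
  -- multiple of `c` a coboundary.
  have key : ∀ g, (a - Fintype.card ι) • c g = ρ g (∑ i, c (x i)) - ∑ i, c (x i) := by
    intro g
    have h1 := hconj g
    simp only [hc, Finset.sum_add_distrib, h, Finset.sum_const, Finset.card_univ] at h1
    rw [map_sum, sub_smul, Nat.cast_smul_eq_nsmul, sub_eq_sub_iff_add_eq_add, add_comm, ← h1,
      add_comm]
  refine ⟨(a - Fintype.card ι)⁻¹ • (∑ i, c (x i)), fun g => ?_⟩
  rw [map_smul, ← smul_sub, ← key, inv_smul_smul₀ (sub_ne_zero.mpr ha)]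

end Cohomology

/-! ### Specht modules of hook shape -/

section Hook

open Representation

/-- The tabloid, as a function, with the entry `x r` in row `r + 1` and all others in row `0`. -/
def hookRow {i : ℕ} (x : Fin i → Fin 5) (y : Fin 5) : ℕ :=
  ∑ r : Fin i, if x r = y then (r : ℕ) + 1 else 0

theorem hookRow_apply_self {i : ℕ} {x : Fin i → Fin 5} (hx : Function.Injective x) (r : Fin i) :
    hookRow x (x r) = r + 1 := by
  rw [hookRow, Finset.sum_eq_single r]
  · simp
  · intro s _ hs
    exact if_neg fun h => hs (hx h)
  · simp

theorem hookRow_eq_zero {i : ℕ} {x : Fin i → Fin 5} {y : Fin 5} (hy : ∀ r, x r ≠ y) :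
    hookRow x y = 0 :=
  Finset.sum_eq_zero fun r _ => if_neg (hy r)

theorem hookRow_comp {i : ℕ} (x : Fin i → Fin 5) (g : Equiv.Perm (Fin 5)) (y : Fin 5) :
    hookRow (g ∘ x) y = hookRow x (g⁻¹ y) := by
  simp only [hookRow, Function.comp_apply, Equiv.Perm.eq_inv_iff_eq]

theorem hookRow_injective {i : ℕ} {x x' : Fin i → Fin 5} (hx : Function.Injective x)
    (hx' : Function.Injective x') (h : hookRow x = hookRow x') : x = x' := by
  funext r
  have h1 : hookRow x' (x r) = r + 1 := by rw [← h, hookRow_apply_self hx]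
  by_cases h2 : ∃ s, x' s = x r
  · obtain ⟨s, hs⟩ := h2
    rw [← hs, hookRow_apply_self hx'] at h1
    rw [← hs, Fin.ext (Nat.succ_injective h1)]
  · rw [hookRow_eq_zero (not_exists.mp h2)] at h1
    omega

/-- `μ` is a hook with `5` cells and `i + 1` rows. -/
structure IsHook (μ : YoungDiagram) (i : ℕ) : Prop where
  card : μ.card = 5
  notMem : (1, 1) ∉ μ
  colLen : μ.colLen 0 = i + 1

variable {μ : YoungDiagram} {i : ℕ}

theorem IsHook.mem (h : IsHook μ i) (r : Fin (i + 1)) : ((r : ℕ), 0) ∈ μ.cells :=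
  (YoungDiagram.mem_cells _).mpr (YoungDiagram.mem_iff_lt_colLen.mpr (by rw [h.colLen]; exact r.2))

theorem IsHook.snd_eq_zero (h : IsHook μ i) {a b : ℕ} (hab : (a + 1, b) ∈ μ.cells) : b = 0 := by
  by_contra hb
  exact h.notMem (μ.up_left_mem (Nat.le_add_left 1 a) (Nat.one_le_iff_ne_zero.mpr hb)
    ((YoungDiagram.mem_cells _).mp hab))

/-- The first column of a tableau. -/
def YTableau.firstColumn (t : YTableau μ 5) (h : IsHook μ i) (r : Fin (i + 1)) : Fin 5 :=
  t ⟨(r, 0), h.mem r⟩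

theorem YTableau.firstColumn_injective (t : YTableau μ 5) (h : IsHook μ i) :
    Function.Injective (t.firstColumn h) := fun _ _ hrs =>
  Fin.ext (congrArg (fun c : μ.cells => c.1.1) (t.injective hrs))

/-- Below its first row a hook has one cell per row, so a tabloid is an injective tuple, the tail of
the first column. -/
theorem YTableau.tabloid_eq_hookRow (t : YTableau μ 5) (h : IsHook μ i) (y : Fin 5) :
    (t.tabloid).1 y = hookRow (Fin.tail (t.firstColumn h)) y := by
  obtain ⟨⟨⟨a, b⟩, hc⟩, rfl⟩ := t.surjective y
  change (t.symm (t ⟨(a, b), hc⟩)).1.1 = _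
  rw [t.symm_apply_apply]
  rcases a with _ | a
  · rw [hookRow_eq_zero]
    intro r hr
    have := congrArg (fun c : μ.cells => c.1.1) (t.injective hr)
    simp at this
  · obtain rfl := h.snd_eq_zero hc
    have ha : a < i := by
      have := YoungDiagram.mem_iff_lt_colLen.mp ((YoungDiagram.mem_cells _).mp hc)
      rw [h.colLen] at this
      omega
    exact (hookRow_apply_self ((t.firstColumn_injective h).comp (Fin.succ_injective i))
      ⟨a, ha⟩).symm

theorem IsHook.exists_firstColumn_eq (h : IsHook μ i) {c : Fin (i + 1) → Fin 5}
    (hc : Function.Injective c) : ∃ t : YTableau μ 5, t.firstColumn h = c := by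
  let t₀ : YTableau μ 5 := Finset.equivFinOfCardEq h.card
  obtain ⟨g, hg⟩ := exists_perm_comp_eq (t₀.firstColumn_injective h) hc
  exact ⟨t₀.trans g, hg⟩

theorem IsHook.exists_tabloid (h : IsHook μ i) (x : Fin i ↪ Fin 5) :
    ∃ t : YTableau μ 5, ∀ y, hookRow x y = (t.symm y).1.1 := by
  let t₀ : YTableau μ 5 := Finset.equivFinOfCardEq h.card
  obtain ⟨g, hg⟩ := exists_perm_comp_eq
    ((t₀.firstColumn_injective h).comp (Fin.succ_injective i)) x.injective
  refine ⟨t₀.trans g, fun y => ?_⟩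
  have h1 := YTableau.tabloid_eq_hookRow (μ := μ) (t₀.trans g) h y
  rw [← hg]
  exact h1.symm

/-- The tabloid with the entry `x r` in row `r + 1`. -/
def IsHook.tabloid (h : IsHook μ i) (x : Fin i ↪ Fin 5) : Tabloid μ 5 :=
  ⟨hookRow x, h.exists_tabloid x⟩

theorem IsHook.tabloid_injective (h : IsHook μ i) : Function.Injective h.tabloid := fun x x' hxx =>
  DFunLike.coe_injective (hookRow_injective x.injective x'.injective (congrArg Subtype.val hxx))

variable {k : Type u} [Field k]

variable (k) in
/-- The map from alternating forms to the permutation module on the tabloids of hook shape. -/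
noncomputable def IsHook.toTabloids (h : IsHook μ i) : AltForm k (i + 1) →ₗ[k] k[Tabloid μ 5] :=
  ∑ x : Fin i ↪ Fin 5, ((AltForm.coeffₗ (k := k) x) ∘ₗ
    (contractSum k i).toLinearMap).smulRight (MonoidAlgebra.single (h.tabloid x) 1)

theorem IsHook.toTabloids_apply (h : IsHook μ i) (f : AltForm k (i + 1)) :
    h.toTabloids k f = ∑ x : Fin i ↪ Fin 5,
      MonoidAlgebra.single (h.tabloid x) ((contractSum k i f).coeff x) := by
  rw [IsHook.toTabloids, LinearMap.sum_apply]
  refine Finset.sum_congr rfl fun x _ => ?_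
  rw [LinearMap.smulRight_apply, MonoidAlgebra.smul_single, smul_eq_mul, mul_one]
  rfl

/-- The map writes the contraction of `f` in the tabloid basis; distinct injective tuples give
distinct tabloids. -/
theorem IsHook.toTabloids_eq_zero_iff (h : IsHook μ i) (f : AltForm k (i + 1)) :
    h.toTabloids k f = 0 ↔ contractSum k i f = 0 := by
  classical
  constructor
  · intro hf
    refine AltForm.ext_coeff fun x hx => ?_
    have h1 := congrArg (fun z => z.coeff (h.tabloid ⟨x, hx⟩)) hf
    simp only [h.toTabloids_apply, MonoidAlgebra.coeff_sum, MonoidAlgebra.coeff_single,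
      Finsupp.coe_finsetSum, Finset.sum_apply, MonoidAlgebra.coeff_zero, Finsupp.coe_zero,
      Pi.zero_apply] at h1
    rw [Finset.sum_eq_single ⟨x, hx⟩] at h1
    · rw [Finsupp.single_eq_same] at h1
      rw [AltForm.coeff_zero]
      exact h1
    · intro y _ hy
      exact Finsupp.single_eq_of_ne fun h' => hy (h.tabloid_injective h').symm
    · simp
  · intro hf
    rw [h.toTabloids_apply, hf]
    simp

/-- The column stabilizer of a hook is the symmetric group on its first column, so the polytabloid
is the signed sum that the contraction of a basis form produces. -/
theorem IsHook.toTabloids_dualForm (h : IsHook μ i) (t : YTableau μ 5) :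
    h.toTabloids k (dualForm k (t.firstColumn h)) = t.polytabloid k := by
  classical
  let c : Fin (i + 1) ↪ Fin 5 := ⟨t.firstColumn h, t.firstColumn_injective h⟩
  let z : Equiv.Perm (Fin (i + 1)) → (Fin i ↪ Fin 5) := fun π =>
    (Fin.succEmb i).trans (π⁻¹.toEmbedding.trans c)
  have h1 : h.toTabloids k (dualForm k c) = ∑ π : Equiv.Perm (Fin (i + 1)),
      MonoidAlgebra.single (h.tabloid (z π)) (((Equiv.Perm.sign π : ℤˣ) : ℤ) : k) := by
    rw [h.toTabloids_apply]
    simp only [coeff_contractSum, coeff_dualForm]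
    have h2 : ∀ x : Fin i ↪ Fin 5, (∑ a, ∑ π : Equiv.Perm (Fin (i + 1)),
        ((Equiv.Perm.sign π : ℤ) : k) * if Matrix.vecCons a x ∘ π = c then 1 else 0) =
        ∑ π : Equiv.Perm (Fin (i + 1)),
          ((Equiv.Perm.sign π : ℤ) : k) * if x = z π then 1 else 0 := by
      intro x
      rw [Finset.sum_comm]
      refine Finset.sum_congr rfl fun π _ => ?_
      rw [← Finset.mul_sum]
      congr 1
      rw [Finset.sum_eq_single (c (π⁻¹ 0))]
      · refine if_congr ⟨fun hx => ?_, fun hx => ?_⟩ rfl rfl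
        · ext r : 1
          have := congrFun hx (π⁻¹ r.succ)
          rwa [Function.comp_apply, show π (π⁻¹ r.succ) = r.succ from π.apply_symm_apply _] at this
        · subst hx
          ext1 s
          obtain ⟨s, rfl⟩ := π⁻¹.surjective s
          refine Fin.cases ?_ (fun s => ?_) s <;> simp [z]
      · intro a _ ha
        refine if_neg fun hx => ha ?_
        have := congrFun hx (π⁻¹ 0)
        simpa using this
      · simp
    simp only [h2, ← MonoidAlgebra.singleAddHom_apply, map_sum]
    rw [Finset.sum_comm]
    refine Finset.sum_congr rfl fun π _ => ?_
    rw [Finset.sum_eq_single (z π)]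
    · simp
    · intro x _ hx
      simp [hx]
    · simp
  change h.toTabloids k (dualForm k c) = _
  rw [h1, YTableau.polytabloid]
  -- A permutation of positions in the first column corresponds to the permutation of its entries by
  -- the inverse.
  refine Finset.sum_bij (fun π _ => Equiv.Perm.viaFintypeEmbedding π⁻¹ c) ?_ ?_ ?_ ?_
  · intro π _
    simp only [YTableau.columnStabilizer, Finset.mem_filter, Finset.mem_univ, true_and]
    intro y
    by_cases hy : y ∈ Set.range c
    · obtain ⟨r, rfl⟩ := hy
      rw [Equiv.Perm.viaFintypeEmbedding_apply_image]
      change (t.symm (t _)).1.2 = (t.symm (t _)).1.2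
      simp
    · rw [Equiv.Perm.viaFintypeEmbedding_apply_notMem_range _ _ hy]
  · intro π _ π' _ hππ
    apply inv_injective
    ext1 r
    apply c.injective
    rw [← Equiv.Perm.viaFintypeEmbedding_apply_image, hππ,
      Equiv.Perm.viaFintypeEmbedding_apply_image]
  · intro σ hσ
    simp only [YTableau.columnStabilizer, Finset.mem_filter, Finset.mem_univ, true_and] at hσ
    have hfix : ∀ y ∉ Set.range c, σ y = y := by
      intro y hy
      obtain ⟨⟨⟨a, b⟩, hab⟩, rfl⟩ := t.surjective y
      have h3 := hσ (t ⟨(a, b), hab⟩)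
      obtain ⟨⟨⟨a', b'⟩, hab'⟩, hσy⟩ := t.surjective (σ (t ⟨(a, b), hab⟩))
      rw [← hσy] at h3 ⊢
      simp only [Equiv.symm_apply_apply] at h3
      subst h3
      -- Every other column of a hook has a single cell, so its entry is fixed.
      have hb : b' ≠ 0 := by
        rintro rfl
        refine hy ⟨⟨a, ?_⟩, rfl⟩
        have := YoungDiagram.mem_iff_lt_colLen.mp ((YoungDiagram.mem_cells _).mp hab)
        rwa [h.colLen] at this
      have ha : ∀ {a}, (a, b') ∈ μ.cells → a = 0 := by
        intro a ha
        rcases a with _ | a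
        · rfl
        · exact absurd (h.snd_eq_zero ha) hb
      obtain rfl := ha hab
      obtain rfl := ha hab'
      rfl
    have hrange : ∀ r, (σ ∘ c) r ∈ Set.range c := by
      intro r
      by_contra hr
      have := hfix _ hr
      exact hr ⟨r, σ.injective this.symm⟩
    obtain ⟨π, hπ⟩ := exists_comp_perm_eq (σ.injective.comp c.injective) hrange
    refine ⟨π⁻¹, Finset.mem_univ _, ?_⟩
    ext1 y
    by_cases hy : y ∈ Set.range c
    · obtain ⟨r, rfl⟩ := hy
      rw [inv_inv, Equiv.Perm.viaFintypeEmbedding_apply_image]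
      exact congrFun hπ r
    · rw [Equiv.Perm.viaFintypeEmbedding_apply_notMem_range _ _ hy, hfix y hy]
  · intro π _
    have hsign : Equiv.Perm.sign (Equiv.Perm.viaFintypeEmbedding π⁻¹ c) = Equiv.Perm.sign π := by
      rw [Equiv.Perm.viaFintypeEmbedding_sign, Equiv.Perm.sign_inv]
    rw [hsign]
    congr 1
    apply Subtype.ext
    funext y
    change hookRow (z π) y = (t.tabloid).1 ((Equiv.Perm.viaFintypeEmbedding π⁻¹ c)⁻¹ y)
    rw [t.tabloid_eq_hookRow h, ← hookRow_comp]
    congr 1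
    funext r
    exact (Equiv.Perm.viaFintypeEmbedding_apply_image π⁻¹ c r.succ).symm

variable [CharP k 5]

theorem IsHook.toTabloids_mem (h : IsHook μ i) (f : AltForm k (i + 1)) :
    h.toTabloids k f ∈ (spechtSub k μ 5).toSubmodule := by
  have : (spechtSub k μ 5).toSubmodule.mkQ ∘ₗ h.toTabloids k = 0 := by
    refine AltForm.linearMap_ext fun c hc => ?_
    obtain ⟨t, rfl⟩ := h.exists_firstColumn_eq hc
    rw [LinearMap.comp_apply, h.toTabloids_dualForm, LinearMap.zero_apply, Submodule.mkQ_apply,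
      Submodule.Quotient.mk_eq_zero]
    exact Submodule.subset_span ⟨t, rfl⟩
  exact (Submodule.Quotient.mk_eq_zero _).mp congr($this f)

theorem IsHook.toTabloids_altRep (h : IsHook μ i) (g : Equiv.Perm (Fin 5))
    (f : AltForm k (i + 1)) :
    h.toTabloids k (altRep k (i + 1) g f) = tabloidRep k μ 5 g (h.toTabloids k f) := by
  have : h.toTabloids k ∘ₗ altRep k (i + 1) g = tabloidRep k μ 5 g ∘ₗ h.toTabloids k := by
    refine AltForm.linearMap_ext fun c hc => ?_
    obtain ⟨t, rfl⟩ := h.exists_firstColumn_eq hc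
    rw [LinearMap.comp_apply, LinearMap.comp_apply, h.toTabloids_dualForm,
      YTableau.map_polytabloid, altRep_dualForm, ← h.toTabloids_dualForm]
    rfl
  exact congr($this f)

variable (k) in
/-- The map from alternating forms onto the Specht module of hook shape. -/
noncomputable def IsHook.toSpecht (h : IsHook μ i) :
    (altRep k (i + 1)).IntertwiningMap (spechtRep k μ 5) where
  toLinearMap := (h.toTabloids k).codRestrict _ h.toTabloids_mem
  isIntertwining' g := LinearMap.ext fun f => Subtype.ext (h.toTabloids_altRep g f)

theorem IsHook.toSpecht_eq_zero_iff (h : IsHook μ i) (f : AltForm k (i + 1)) :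
    h.toSpecht k f = 0 ↔ contractSum k i f = 0 :=
  Subtype.ext_iff.trans (h.toTabloids_eq_zero_iff f)

theorem IsHook.toSpecht_surjective (h : IsHook μ i) : Function.Surjective (h.toSpecht k) := by
  rintro ⟨v, hv⟩
  have : (spechtSub k μ 5).toSubmodule ≤ (h.toTabloids k).range := by
    refine Submodule.span_le.mpr ?_
    rintro _ ⟨t, rfl⟩
    exact ⟨_, h.toTabloids_dualForm t⟩
  obtain ⟨f, hf⟩ := this hv
  exact ⟨f, Subtype.ext hf⟩

/-- The Specht module is L_{i+1} modulo dL_{i+2}. Here L_{i+1} is projective, and L_{i+2} has no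
invariant linear form because its degree is at least two. -/
theorem IsHook.h1Trivial (h : IsHook μ i) : H1Trivial (spechtRep k μ 5).dual := by
  have hi : i < 5 := by
    let t₀ : YTableau μ 5 := Finset.equivFinOfCardEq h.card
    have := Fintype.card_le_of_injective _ (t₀.firstColumn_injective h)
    simpa using this
  rcases Nat.lt_or_ge i 4 with hi4 | hi4
  · refine H1Trivial.dual_of_rightExact (contractSum k (i + 1)) (h.toSpecht k)
      h.toSpecht_surjective (fun f => ?_) (hasHigmanElement_altRep hi4).dual.h1Trivial
      fun l hl => AltForm.linearForm_eq_zero fun g f => ?_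
    · rw [h.toSpecht_eq_zero_iff]
      refine ⟨exists_contractSum_eq, ?_⟩
      rintro ⟨f, rfl⟩
      exact contractSum_contractSum f
    · have := congr($(hl g⁻¹) f)
      change l (altRep k (i + 2) g⁻¹⁻¹ f) = l f at this
      rwa [inv_inv] at this
  -- For the single column L_5 is not projective, so it is presented instead as L_4 modulo eL_3.
  · obtain rfl : i = 4 := by omega
    refine H1Trivial.dual_of_rightExact (wedgeSum k 3) ((h.toSpecht k).comp (wedgeSum k 4))
      (h.toSpecht_surjective.comp wedgeSum_four_surjective) (fun f => ?_)
      (hasHigmanElement_altRep (n := 3) (by norm_num)).dual.h1Trivial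
      fun l hl => AltForm.linearForm_eq_zero fun g f => ?_
    · rw [IntertwiningMap.comp_apply, h.toSpecht_eq_zero_iff]
      refine ⟨fun hf => exists_wedgeSum_eq (contractSum_four_injective hf), ?_⟩
      rintro ⟨f, rfl⟩
      rw [wedgeSum_wedgeSum, map_zero]
    · have := congr($(hl g⁻¹) f)
      change l (altRep k 3 g⁻¹⁻¹ f) = l f at this
      rwa [inv_inv] at this

end Hook

/-! ### The sum of the transpositions on a Specht module -/

section Transpositions

open Representation

variable {k : Type u} [Field k] {μ : YoungDiagram} {d : ℕ} (t : YTableau μ d)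

/-- The column of a tableau containing an entry. -/
def YTableau.column (x : Fin d) : ℕ := (t.symm x).1.2

/-- The row containing an entry in the tabloid `σ{t}`. -/
def YTableau.rowOf (σ : Equiv.Perm (Fin d)) (x : Fin d) : ℕ := (t.symm (σ⁻¹ x)).1.1

theorem YTableau.mem_columnStabilizer {σ : Equiv.Perm (Fin d)} :
    σ ∈ t.columnStabilizer ↔ ∀ x, t.column (σ x) = t.column x := by
  simp [YTableau.columnStabilizer, YTableau.column]

variable {t}

theorem YTableau.column_inv {σ : Equiv.Perm (Fin d)} (hσ : σ ∈ t.columnStabilizer) (x : Fin d) :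
    t.column (σ⁻¹ x) = t.column x := by
  rw [← t.mem_columnStabilizer.mp hσ (σ⁻¹ x)]
  simp

theorem YTableau.mul_mem_columnStabilizer {σ τ : Equiv.Perm (Fin d)}
    (hσ : σ ∈ t.columnStabilizer) (hτ : τ ∈ t.columnStabilizer) : σ * τ ∈ t.columnStabilizer := by
  rw [t.mem_columnStabilizer] at hσ hτ ⊢
  intro x
  rw [Equiv.Perm.mul_apply, hσ, hτ]

theorem YTableau.swap_mem_columnStabilizer {x y : Fin d} (h : t.column x = t.column y) :
    Equiv.swap x y ∈ t.columnStabilizer := by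
  rw [t.mem_columnStabilizer]
  intro z
  rw [Equiv.swap_apply_def]
  split_ifs with h1 h2
  · rw [h1, h]
  · rw [h2, h]
  · rfl

theorem YTableau.eq_of_rowOf_eq {σ : Equiv.Perm (Fin d)} (hσ : σ ∈ t.columnStabilizer)
    {x y : Fin d} (h1 : t.column x = t.column y) (h2 : t.rowOf σ x = t.rowOf σ y) : x = y := by
  apply σ⁻¹.injective
  apply t.symm.injective
  refine Subtype.ext (Prod.ext h2 ?_)
  change t.column (σ⁻¹ x) = t.column (σ⁻¹ y)
  rw [YTableau.column_inv hσ, YTableau.column_inv hσ, h1]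

theorem YTableau.exists_rowOf_eq {σ : Equiv.Perm (Fin d)} (hσ : σ ∈ t.columnStabilizer)
    {y : Fin d} {j : ℕ} (hj : j < t.column y) :
    ∃ a, t.column a = j ∧ t.rowOf σ a = t.rowOf σ y := by
  have hmem : (t.rowOf σ y, j) ∈ μ.cells := by
    refine (YoungDiagram.mem_cells _).mpr (μ.up_left_mem le_rfl hj.le ?_)
    rw [← YTableau.column_inv hσ y]
    exact (YoungDiagram.mem_cells _).mp (t.symm (σ⁻¹ y)).2
  refine ⟨σ (t ⟨(t.rowOf σ y, j), hmem⟩), ?_, ?_⟩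
  · rw [t.mem_columnStabilizer.mp hσ]
    simp [YTableau.column]
  · rw [YTableau.rowOf, show σ⁻¹ (σ (t ⟨(t.rowOf σ y, j), hmem⟩)) = t ⟨(t.rowOf σ y, j), hmem⟩ from
      σ.symm_apply_apply _, t.symm_apply_apply]

theorem YTableau.tabloidRep_polytabloid (k : Type u) [Field k] (t : YTableau μ d)
    (g : Equiv.Perm (Fin d)) : tabloidRep k μ d g (t.polytabloid k) = ∑ σ ∈ t.columnStabilizer,
      MonoidAlgebra.single (g • σ • t.tabloid) (((Equiv.Perm.sign σ : ℤˣ) : ℤ) : k) := by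
  rw [YTableau.polytabloid, map_sum]
  exact Finset.sum_congr rfl fun σ _ => Representation.ofMulAction_single _ _ _

theorem YTableau.tabloidRep_swap_of_column_eq (k : Type u) [Field k] {x y : Fin d} (hxy : x ≠ y)
    (h : t.column x = t.column y) :
    tabloidRep k μ d (Equiv.swap x y) (t.polytabloid k) = -t.polytabloid k := by
  rw [YTableau.tabloidRep_polytabloid k t, YTableau.polytabloid, ← Finset.sum_neg_distrib]
  have hs := YTableau.swap_mem_columnStabilizer h
  refine Finset.sum_bij' (fun σ _ => Equiv.swap x y * σ) (fun σ _ => Equiv.swap x y * σ)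
    (fun σ hσ => YTableau.mul_mem_columnStabilizer hs hσ)
    (fun σ hσ => YTableau.mul_mem_columnStabilizer hs hσ) (fun σ _ => ?_) (fun σ _ => ?_)
    (fun σ _ => ?_)
  · rw [← mul_assoc, Equiv.swap_mul_self, one_mul]
  · rw [← mul_assoc, Equiv.swap_mul_self, one_mul]
  · rw [smul_smul, Equiv.Perm.sign_mul, Equiv.Perm.sign_swap hxy, ← MonoidAlgebra.single_neg]
    simp

/-- The Garnir relation for one column and one entry. -/
theorem YTableau.sum_tabloidRep_swap (k : Type u) [Field k] {y : Fin d} {j : ℕ}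
    (hj : j < t.column y) :
    ∑ a with t.column a = j, tabloidRep k μ d (Equiv.swap a y) (t.polytabloid k) =
      t.polytabloid k := by
  classical
  simp only [YTableau.tabloidRep_polytabloid k t]
  -- In the tabloid `σ{t}` the row of `y` meets the earlier column `j` in exactly one entry `a₀ σ`.
  -- Swapping that entry with `y` leaves the tabloid unchanged, so these terms sum to the
  -- polytabloid.
  have hex : ∀ σ, ∃ a, σ ∈ t.columnStabilizer → t.column a = j ∧ t.rowOf σ a = t.rowOf σ y := by
    intro σ
    by_cases hσ : σ ∈ t.columnStabilizer
    · obtain ⟨a, ha⟩ := YTableau.exists_rowOf_eq hσ hj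
      exact ⟨a, fun _ => ha⟩
    · exact ⟨y, fun h => absurd h hσ⟩
  choose a₀ ha₀ using hex
  have hy : ∀ {a}, t.column a = j → a ≠ y := by
    rintro _ h rfl
    exact hj.ne' h
  rw [Finset.sum_comm]
  have h1 : ∀ σ ∈ t.columnStabilizer, ∑ a with t.column a = j,
      MonoidAlgebra.single (Equiv.swap a y • σ • t.tabloid) (((Equiv.Perm.sign σ : ℤˣ) : ℤ) : k) =
      MonoidAlgebra.single (σ • t.tabloid) (((Equiv.Perm.sign σ : ℤˣ) : ℤ) : k) +
      ∑ a ∈ ({a | t.column a = j} : Finset (Fin d)).erase (a₀ σ), MonoidAlgebra.single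
        (Equiv.swap a y • σ • t.tabloid) (((Equiv.Perm.sign σ : ℤˣ) : ℤ) : k) := by
    intro σ hσ
    rw [← Finset.add_sum_erase _ _ (Finset.mem_filter.mpr ⟨Finset.mem_univ (a₀ σ), (ha₀ σ hσ).1⟩)]
    congr 2
    apply Subtype.ext
    funext z
    change t.rowOf σ (Equiv.swap (a₀ σ) y z) = t.rowOf σ z
    rw [Equiv.swap_apply_def]
    split_ifs with h2 h3
    · rw [h2, (ha₀ σ hσ).2]
    · rw [h3, (ha₀ σ hσ).2]
    · rfl
  rw [Finset.sum_congr rfl h1, Finset.sum_add_distrib, ← YTableau.polytabloid]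
  refine add_eq_left.mpr ?_
  rw [Finset.sum_sigma']
  have hmem : ∀ {σ a}, σ ∈ t.columnStabilizer → t.column a = j →
      Equiv.swap a (a₀ σ) * σ ∈ t.columnStabilizer := fun hσ ha =>
    YTableau.mul_mem_columnStabilizer
      (YTableau.swap_mem_columnStabilizer (ha.trans (ha₀ _ hσ).1.symm)) hσ
  have hrow : ∀ σ a z, t.rowOf (Equiv.swap a (a₀ σ) * σ) z = t.rowOf σ (Equiv.swap a (a₀ σ) z) :=
    fun σ a z => rfl
  have ha₀' : ∀ {σ a}, σ ∈ t.columnStabilizer → t.column a = j →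
      a₀ (Equiv.swap a (a₀ σ) * σ) = a := by
    intro σ a hσ ha
    obtain ⟨h2, h3⟩ := ha₀ _ (hmem hσ ha)
    refine YTableau.eq_of_rowOf_eq (hmem hσ ha) (h2.trans ha.symm) (h3.trans ?_)
    rw [hrow, hrow, Equiv.swap_apply_left,
      Equiv.swap_apply_of_ne_of_ne (hy ha).symm (hy (ha₀ σ hσ).1).symm, (ha₀ σ hσ).2]
  -- The terms with `a ≠ a₀ σ` cancel in pairs: exchanging `a` and `a₀ σ` gives the same tabloid
  -- with the opposite sign.
  refine Finset.sum_involution (fun p _ => ⟨Equiv.swap p.2 (a₀ p.1) * p.1, a₀ p.1⟩) ?_ ?_ ?_ ?_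
  · rintro ⟨σ, a⟩ hp
    simp only [Finset.mem_sigma, Finset.mem_erase, Finset.mem_filter, Finset.mem_univ,
      true_and] at hp
    obtain ⟨hσ, hne, ha⟩ := hp
    have htab : Equiv.swap (a₀ σ) y • (Equiv.swap a (a₀ σ) * σ) • t.tabloid =
        Equiv.swap a y • σ • t.tabloid := by
      apply Subtype.ext
      funext z
      change t.rowOf σ (Equiv.swap a (a₀ σ) (Equiv.swap (a₀ σ) y z)) = t.rowOf σ (Equiv.swap a y z)
      rcases eq_or_ne z y with rfl | hzy
      · rw [Equiv.swap_apply_right, Equiv.swap_apply_right, Equiv.swap_apply_right]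
      rcases eq_or_ne z a with rfl | hza
      · rw [Equiv.swap_apply_of_ne_of_ne hne hzy, Equiv.swap_apply_left, Equiv.swap_apply_left,
          (ha₀ σ hσ).2]
      rw [Equiv.swap_apply_of_ne_of_ne hza hzy]
      rcases eq_or_ne z (a₀ σ) with rfl | hz
      · rw [Equiv.swap_apply_left, Equiv.swap_apply_of_ne_of_ne (hy ha).symm hzy.symm,
          (ha₀ σ hσ).2]
      · rw [Equiv.swap_apply_of_ne_of_ne hz hzy, Equiv.swap_apply_of_ne_of_ne hza hz]
    simp only [htab]
    rw [Equiv.Perm.sign_mul, Equiv.Perm.sign_swap hne, ← MonoidAlgebra.single_add]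
    simp
  · rintro ⟨σ, a⟩ hp _ h
    simp only [Finset.mem_sigma, Finset.mem_erase, Finset.mem_filter, Finset.mem_univ,
      true_and] at hp
    exact hp.2.1 (congrArg Sigma.snd h).symm
  · rintro ⟨σ, a⟩ hp
    simp only [Finset.mem_sigma, Finset.mem_erase, Finset.mem_filter, Finset.mem_univ,
      true_and] at hp ⊢
    refine ⟨hmem hp.1 hp.2.2, ?_, (ha₀ σ hp.1).1⟩
    rw [ha₀' hp.1 hp.2.2]
    exact hp.2.1.symm
  · rintro ⟨σ, a⟩ hp
    simp only [Finset.mem_sigma, Finset.mem_erase, Finset.mem_filter, Finset.mem_univ,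
      true_and] at hp
    simp only [ha₀' hp.1 hp.2.2]
    rw [Equiv.swap_comm, ← mul_assoc, Equiv.swap_mul_self, one_mul]

theorem YTableau.card_column (t : YTableau μ d) (j : ℕ) :
    (Finset.univ.filter fun x => t.column x = j).card = (μ.col j).card := by
  refine Finset.card_bij (fun x _ => (t.symm x).1) ?_ ?_ ?_
  · intro x hx
    rw [YoungDiagram.mem_col_iff]
    exact ⟨(YoungDiagram.mem_cells _).mp (t.symm x).2, (Finset.mem_filter.mp hx).2⟩
  · intro x _ y _ h
    exact t.symm.injective (Subtype.ext h)
  · intro c hc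
    rw [YoungDiagram.mem_col_iff] at hc
    refine ⟨t ⟨c, (YoungDiagram.mem_cells _).mpr hc.1⟩,
      Finset.mem_filter.mpr ⟨Finset.mem_univ _, ?_⟩, by simp⟩
    rw [YTableau.column, t.symm_apply_apply, hc.2]

/-- Twice the sum of the transpositions, plus `d`, acts on a polytabloid as a scalar. -/
theorem YTableau.sum_sum_tabloidRep_swap (k : Type u) [Field k] (t : YTableau μ d) :
    ∑ y, ∑ x, tabloidRep k μ d (Equiv.swap x y) (t.polytabloid k) =
      ((∑ c ∈ μ.cells, (2 * c.2 + 2 - (μ.col c.2).card : ℤ) : ℤ) : k) • t.polytabloid k := by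
  classical
  let T : Fin d → Fin d → k[Tabloid μ d] := fun x y =>
    tabloidRep k μ d (Equiv.swap x y) (t.polytabloid k)
  -- By the Garnir relation each column to the left of `y` contributes the polytabloid once.
  have hlt : ∀ y, ∑ x with t.column x < t.column y, T x y = (t.column y : k) • t.polytabloid k := by
    intro y
    rw [← Finset.sum_fiberwise_of_maps_to (t := Finset.range (t.column y)) (g := t.column)
      (fun x hx => Finset.mem_range.mpr (Finset.mem_filter.mp hx).2)]
    have h1 : ∀ j ∈ Finset.range (t.column y), ∑ x ∈ Finset.univ.filter
        (fun x => t.column x < t.column y) with t.column x = j, T x y = t.polytabloid k := by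
      intro j hj
      rw [Finset.filter_filter, ← YTableau.sum_tabloidRep_swap k (Finset.mem_range.mp hj)]
      refine Finset.sum_congr (Finset.filter_congr fun x _ => ?_) fun _ _ => rfl
      exact ⟨fun h => h.2, fun h => ⟨h ▸ Finset.mem_range.mp hj, h⟩⟩
    rw [Finset.sum_congr rfl h1, Finset.sum_const, Finset.card_range, Nat.cast_smul_eq_nsmul]
  -- Within the column of `y` the trivial swap contributes +1 and every other entry -1, in total 2
  -- minus the column length.
  have heq : ∀ y, ∑ x with t.column x = t.column y, T x y =
      (2 - (μ.col (t.column y)).card : k) • t.polytabloid k := by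
    intro y
    rw [← Finset.add_sum_erase _ _ (Finset.mem_filter.mpr ⟨Finset.mem_univ y,
      (rfl : t.column y = t.column y)⟩)]
    have h1 : ∀ x ∈ ({x | t.column x = t.column y} : Finset (Fin d)).erase y,
        T x y = -t.polytabloid k := fun x hx =>
      YTableau.tabloidRep_swap_of_column_eq k (Finset.ne_of_mem_erase hx)
        (Finset.mem_filter.mp (Finset.mem_of_mem_erase hx)).2
    have h2 : T y y = t.polytabloid k := by
      change tabloidRep k μ d (Equiv.swap y y) _ = _
      rw [Equiv.swap_self]
      exact congr($(map_one (tabloidRep k μ d)) _)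
    have h3 : 0 < (μ.col (t.column y)).card := by
      rw [← t.card_column, Finset.card_pos]
      exact ⟨y, by simp⟩
    rw [Finset.sum_congr rfl h1, h2, Finset.sum_const, Finset.card_erase_of_mem (by simp),
      t.card_column, ← Nat.cast_smul_eq_nsmul k, Nat.cast_sub h3, smul_neg, ← sub_eq_add_neg]
    nth_rewrite 1 [← one_smul k (t.polytabloid k)]
    rw [← sub_smul]
    congr 1
    push_cast
    ring
  -- Pairs with `x` to the right of `y` mirror those to the left, which doubles that contribution.
  have hgt : ∑ y, ∑ x with t.column y < t.column x, T x y =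
      ∑ y, ∑ x with t.column x < t.column y, T x y := by
    simp only [Finset.sum_filter]
    rw [Finset.sum_comm]
    simp only [T, Equiv.swap_comm]
  have hsplit : ∀ y, ∑ x, T x y = ∑ x with t.column x < t.column y, T x y +
      ∑ x with t.column x = t.column y, T x y + ∑ x with t.column y < t.column x, T x y := by
    intro y
    simp only [Finset.sum_filter, ← Finset.sum_add_distrib]
    refine Finset.sum_congr rfl fun x _ => ?_
    rcases lt_trichotomy (t.column x) (t.column y) with h | h | h
    · simp [h, h.ne, h.not_gt]
    · simp [h]
    · simp [h, h.ne', h.not_gt]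
  change ∑ y, ∑ x, T x y = _
  rw [Finset.sum_congr rfl fun y _ => hsplit y, Finset.sum_add_distrib, hgt,
    ← Finset.sum_add_distrib]
  simp only [hlt, heq, ← add_smul, ← Finset.sum_smul]
  congr 1
  rw [Int.cast_sum, ← Finset.sum_coe_sort μ.cells]
  refine Fintype.sum_equiv t.symm _ _ fun y => ?_
  simp only [YTableau.column]
  push_cast
  ring

end Transpositions

/-! ### The two partitions of 5 that are not hooks. -/

section NonHook

open Representation

variable {k : Type u} [Field k] [CharP k 5]

/-- The cell (1,1) forces a 2 × 2 square, which leaves one further cell: the shapes are (3,2) and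
(2,2,1). -/
theorem cells_of_one_one_mem {μ : YoungDiagram} (hμ : μ.card = 5) (h : (1, 1) ∈ μ) :
    μ.cells = {(0, 0), (0, 1), (1, 0), (1, 1), (0, 2)} ∨
      μ.cells = {(0, 0), (0, 1), (1, 0), (1, 1), (2, 0)} := by
  have hsub : ({(0, 0), (0, 1), (1, 0), (1, 1)} : Finset (ℕ × ℕ)) ⊆ μ.cells := by
    intro c hc
    simp only [Finset.mem_insert, Finset.mem_singleton] at hc
    rw [YoungDiagram.mem_cells]
    rcases hc with rfl | rfl | rfl | rfl <;> exact μ.up_left_mem (by norm_num) (by norm_num) h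
  have hlt : ({(0, 0), (0, 1), (1, 0), (1, 1)} : Finset (ℕ × ℕ)).card < μ.cells.card := by
    rw [show μ.cells.card = 5 from hμ]
    decide
  obtain ⟨⟨a, b⟩, hab, hab'⟩ := Finset.exists_mem_notMem_of_card_lt_card hlt
  have key : ∀ c ∈ μ.cells, c ∉ ({(0, 0), (0, 1), (1, 0), (1, 1)} : Finset (ℕ × ℕ)) →
      μ.cells = {(0, 0), (0, 1), (1, 0), (1, 1), c} := by
    intro c hc hc'
    symm
    refine Finset.eq_of_subset_of_card_le ?_ ?_
    · intro x hx
      simp only [Finset.mem_insert, Finset.mem_singleton] at hx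
      rcases hx with rfl | rfl | rfl | rfl | rfl
      · exact hsub (by decide)
      · exact hsub (by decide)
      · exact hsub (by decide)
      · exact hsub (by decide)
      · exact hc
    · rw [show μ.cells.card = 5 from hμ]
      have : ({(0, 0), (0, 1), (1, 0), (1, 1), c} : Finset (ℕ × ℕ)) =
          insert c {(0, 0), (0, 1), (1, 0), (1, 1)} := by
        ext x
        simp only [Finset.mem_insert, Finset.mem_singleton]
        tauto
      rw [this, Finset.card_insert_of_notMem hc']
      decide
  by_cases hb : 2 ≤ b
  · left
    refine key _ ?_ (by decide)
    exact (YoungDiagram.mem_cells _).mpr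
      (μ.up_left_mem (Nat.zero_le _) hb ((YoungDiagram.mem_cells _).mp hab))
  · right
    refine key _ ?_ (by decide)
    have ha : 2 ≤ a := by
      by_contra ha
      refine hab' ?_
      interval_cases a <;> interval_cases b <;> simp
    exact (YoungDiagram.mem_cells _).mpr
      (μ.up_left_mem ha (Nat.zero_le _) ((YoungDiagram.mem_cells _).mp hab))

/-- The sum is 9 for (3,2) and 1 for (2,2,1). -/
theorem sum_content_ne_zero {μ : YoungDiagram} (hμ : μ.card = 5) (h : (1, 1) ∈ μ) :
    ((∑ c ∈ μ.cells, (2 * c.2 + 2 - (μ.col c.2).card : ℤ) : ℤ) : k) ≠ 0 := by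
  rw [Ne, CharP.intCast_eq_zero_iff k 5]
  simp only [YoungDiagram.col]
  rcases cells_of_one_one_mem hμ h with h | h <;> rw [h] <;> decide

/-- The swaps over all ordered pairs, diagonal included, form a conjugation-stable family of size 25
= 0 in k, while their sum acts by a nonzero scalar. -/
theorem h1Trivial_dual_spechtRep_of_mem {μ : YoungDiagram} (hμ : μ.card = 5) (h : (1, 1) ∈ μ) :
    H1Trivial (spechtRep k μ 5).dual := by
  have hs : ∀ v : SpechtModule k μ 5, ∑ p : Fin 5 × Fin 5,
      spechtRep k μ 5 (Equiv.swap p.1 p.2) v =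
      ((∑ c ∈ μ.cells, (2 * c.2 + 2 - (μ.col c.2).card : ℤ) : ℤ) : k) • v := by
    rintro ⟨v, hv⟩
    apply Subtype.ext
    have hv' : ∑ p : Fin 5 × Fin 5, tabloidRep k μ 5 (Equiv.swap p.1 p.2) v =
        ((∑ c ∈ μ.cells, (2 * c.2 + 2 - (μ.col c.2).card : ℤ) : ℤ) : k) • v := by
      induction hv using Submodule.span_induction with
      | mem x hx =>
        obtain ⟨t, rfl⟩ := hx
        rw [← YTableau.sum_sum_tabloidRep_swap k t, Fintype.sum_prod_type, Finset.sum_comm]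
      | zero => simp
      | add x y _ _ hx hy => simp only [map_add, Finset.sum_add_distrib, hx, hy, smul_add]
      | smul a x _ hx => rw [smul_comm, ← hx, Finset.smul_sum]; simp only [map_smul]
    refine Eq.trans ?_ hv'
    exact map_sum (spechtSub k μ 5).toSubmodule.subtype
      (fun p : Fin 5 × Fin 5 => spechtRep k μ 5 (Equiv.swap p.1 p.2) ⟨v, hv⟩) Finset.univ
  refine H1Trivial.of_sum_smul (ι := Fin 5 × Fin 5) (fun p => Equiv.swap p.1 p.2)
    (fun g => g.prodCongr g) (fun g p => ?_) (a := ((∑ c ∈ μ.cells,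
      (2 * c.2 + 2 - (μ.col c.2).card : ℤ) : ℤ) : k)) ?_ fun l => ?_
  · exact Equiv.swap_apply_apply g p.1 p.2
  · have : ((Fintype.card (Fin 5 × Fin 5) : ℕ) : k) = 0 := by
      rw [CharP.cast_eq_zero_iff k 5]
      simp
    rw [this]
    exact sum_content_ne_zero hμ h
  · ext v
    rw [LinearMap.sum_apply, LinearMap.smul_apply]
    change ∑ p : Fin 5 × Fin 5, l (spechtRep k μ 5 (Equiv.swap p.1 p.2)⁻¹ v) = _
    rw [← map_smul, ← hs, map_sum]
    simp only [Equiv.swap_inv]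

/-- The first cohomology of every dual Specht module of the symmetric group on five letters
vanishes in characteristic `5`. -/
theorem h1Trivial_dual_spechtRep {μ : YoungDiagram} (hμ : μ.card = 5) :
    H1Trivial (spechtRep k μ 5).dual := by
  by_cases h : (1, 1) ∈ μ
  · exact h1Trivial_dual_spechtRep_of_mem hμ h
  · have h0 : (0, 0) ∈ μ := by
      obtain ⟨⟨a, b⟩, hab⟩ := Finset.card_pos.mp (show 0 < μ.cells.card by
        rw [show μ.cells.card = 5 from hμ]; norm_num)
      exact μ.up_left_mem (Nat.zero_le _) (Nat.zero_le _) ((YoungDiagram.mem_cells _).mp hab)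
    obtain ⟨i, hi⟩ := Nat.exists_eq_succ_of_ne_zero
      (YoungDiagram.mem_iff_lt_colLen.mp h0).ne'
    exact IsHook.h1Trivial ⟨hμ, h, hi⟩

end NonHook

/-! ### The socle of the Specht module of the partition `(2, 1, 1, 1)` -/

section Socle

open Representation

/-- An element lying below every nonzero element is the only atom. This computes the socle without a
separate proof of simplicity. -/
theorem sSup_isAtom_eq {α : Type*} [CompleteLattice α] {R : α} (hR : R ≠ ⊥)
    (h : ∀ N : α, N ≠ ⊥ → R ≤ N) : sSup {N : α | IsAtom N} = R := by
  have hatom : IsAtom R := ⟨hR, fun N hN => by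
    by_contra hN'
    exact hN.not_ge (h N hN')⟩
  refine le_antisymm (sSup_le fun N hN => ?_) (le_sSup hatom)
  exact ((hN.le_iff.mp (h N hN.1)).resolve_left hR).ge

variable {k : Type u} [Field k]

/-- The linear map `f ↦ ∑ g, f (g x) • g h` of alternating forms. -/
noncomputable def averageLinearMap {n m : ℕ} (x : Fin n → Fin 5) (h : AltForm k m) :
    AltForm k n →ₗ[k] AltForm k m :=
  ∑ g : Equiv.Perm (Fin 5), (AltForm.coeffₗ (k := k) (g ∘ x)).smulRight (altRep k m g h)

theorem averageLinearMap_apply {n m : ℕ} (x : Fin n → Fin 5) (h : AltForm k m) (f : AltForm k n) :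
    averageLinearMap x h f = ∑ g : Equiv.Perm (Fin 5), f.coeff (g ∘ x) • altRep k m g h := by
  rw [averageLinearMap, LinearMap.sum_apply]
  exact Finset.sum_congr rfl fun g _ => rfl

/-- The intertwining map `f ↦ ∑ g, f (g x) • g h` of alternating forms. -/
noncomputable def averageMap {n m : ℕ} (x : Fin n → Fin 5) (h : AltForm k m) :
    (altRep k n).IntertwiningMap (altRep k m) where
  toLinearMap := averageLinearMap x h
  isIntertwining' a := LinearMap.ext fun f => by
    rw [LinearMap.comp_apply, LinearMap.comp_apply, averageLinearMap_apply,
      averageLinearMap_apply, map_sum]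
    refine Fintype.sum_equiv (Equiv.mulLeft a⁻¹) _ _ fun g => ?_
    rw [map_smul, Equiv.coe_mulLeft, ← Module.End.mul_apply, ← map_mul, mul_inv_cancel_left,
      AltForm.coeff_altRep]
    rfl

theorem averageMap_apply {n m : ℕ} (x : Fin n → Fin 5) (h : AltForm k m) (f : AltForm k n) :
    averageMap x h f = ∑ g : Equiv.Perm (Fin 5), f.coeff (g ∘ x) • altRep k m g h :=
  averageLinearMap_apply x h f

/-- The number of permutations preserving the set of entries of a tuple. -/
def stabilizerCard {n : ℕ} (x : Fin n → Fin 5) : ℕ :=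
  (Finset.univ.filter fun g : Equiv.Perm (Fin 5) => ∀ i, ∃ j, x j = g (x i)).card

theorem stabilizerCard_comp {n : ℕ} (x : Fin n → Fin 5) (a : Equiv.Perm (Fin 5)) :
    stabilizerCard (a ∘ x) = stabilizerCard x := by
  refine Finset.card_equiv (MulAut.conj a⁻¹).toEquiv fun g => ?_
  simp only [Finset.mem_filter, Finset.mem_univ, true_and]
  refine forall_congr' fun i => exists_congr fun j => ?_
  change a _ = g (a _) ↔ _ = (a⁻¹ * g * a⁻¹⁻¹) _
  rw [inv_inv, Equiv.Perm.mul_apply, Equiv.Perm.mul_apply, Equiv.Perm.eq_inv_iff_eq]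

/-- The stabilizer of a three-element subset has order 3! · 2! = 12. -/
theorem stabilizerCard_three {x : Fin 3 → Fin 5} (hx : Function.Injective x) :
    stabilizerCard x = 12 := by
  obtain ⟨a, rfl⟩ := exists_perm_comp_eq (x := ![0, 1, 2]) (by decide) hx
  rw [stabilizerCard_comp]
  decide +kernel

/-- Only permutations preserving the set of entries of `x` contribute, and for these the same sign
occurs twice. -/
theorem coeff_averageMap_dualForm {n : ℕ} {x : Fin n → Fin 5} (hx : Function.Injective x)
    (h : AltForm k n) : (averageMap x h (dualForm k x)).coeff x =
      stabilizerCard x * h.coeff x := by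
  classical
  rw [averageMap_apply, AltForm.coeff_sum, stabilizerCard, Finset.card_filter, Nat.cast_sum, Finset.sum_mul]
  refine Finset.sum_congr rfl fun g _ => ?_
  rw [AltForm.coeff_smul, AltForm.coeff_altRep]
  split_ifs with hg
  · obtain ⟨σ, hσ⟩ := exists_comp_perm_eq (g.injective.comp hx) hg
    have h2 : ⇑g⁻¹ ∘ x = x ∘ ⇑σ⁻¹ := by
      funext i
      change g⁻¹ (x i) = x (σ⁻¹ i)
      rw [Equiv.Perm.inv_eq_iff_eq]
      have := congrFun hσ (σ⁻¹ i)
      rwa [Function.comp_apply, show σ (σ⁻¹ i) = i from σ.apply_symm_apply _] at this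
    rw [← hσ, h2, AltForm.coeff_comp_perm, AltForm.coeff_comp_perm, coeff_dualForm_self hx,
      Equiv.Perm.sign_inv, mul_one, ← mul_assoc, ← Int.cast_mul, ← Units.val_mul,
      Int.units_mul_self]
    simp
  · push Not at hg
    obtain ⟨i, hi⟩ := hg
    rw [coeff_dualForm_eq_zero (i := i) (by rintro ⟨j, hj⟩; exact hi j hj)]
    simp

theorem isHook_partition2111 : IsHook partition2111 3 where
  card := by decide
  notMem := by decide
  colLen := by
    have h1 := (YoungDiagram.mem_iff_lt_colLen (μ := partition2111) (i := 3) (j := 0)).mp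
      (by decide)
    have h2 : ¬ (4 < partition2111.colLen 0) := fun h =>
      absurd (YoungDiagram.mem_iff_lt_colLen.mpr h) (by decide)
    omega

variable [CharP k 5]

/-- The averaged map is equivariant from L_3 to L_4, hence a multiple of e. The multiple is nonzero
because, after contraction, its coefficient at `x` is 12 times that of `d h`, and 12 is invertible.
So the submodule generated by `h` contains eL_3. -/
theorem exists_averageMap_eq {h : AltForm k 4} (hh : contractSum k 3 h ≠ 0) :
    ∃ (x : Fin 3 → Fin 5) (b : k), b ≠ 0 ∧ averageMap x h = b • wedgeSum k 3 := by
  obtain ⟨x, hx, hhx⟩ : ∃ x, Function.Injective x ∧ (contractSum k 3 h).coeff x ≠ 0 := by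
    by_contra hcon
    push Not at hcon
    exact hh (AltForm.ext_coeff fun x hx => by rw [hcon x hx, AltForm.coeff_zero])
  obtain ⟨b, hb⟩ := exists_eq_smul_wedgeSum (by norm_num) (averageMap x h)
  have hb' : ∀ f, averageMap x h f = b • wedgeSum k 3 f := fun f => by rw [hb]; rfl
  refine ⟨x, b, ?_, hb⟩
  rintro rfl
  have h1 : ∀ f, contractSum k 3 (averageMap x h f) = averageMap x (contractSum k 3 h) f := by
    intro f
    rw [averageMap_apply, averageMap_apply, map_sum]
    refine Finset.sum_congr rfl fun g _ => ?_
    rw [map_smul, (contractSum k 3).isIntertwining]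
  have h2 := coeff_averageMap_dualForm hx (contractSum k 3 h)
  rw [← h1, hb', zero_smul, map_zero, AltForm.coeff_zero] at h2
  refine (mul_ne_zero ?_ hhx) h2.symm
  rw [stabilizerCard_three hx]
  intro h4
  have h5 := five_eq_zero (k := k)
  push_cast at h4
  exact two_ne_zero_of_charP_five (k := k) (by linear_combination h4 - 2 * h5)

variable (k) in
/-- The map from the forms of degree three to the Specht module of `(2, 1, 1, 1)`. -/
noncomputable def altToSpecht2111 : (altRep k 3).IntertwiningMap (spechtRep k partition2111 5) :=
  (isHook_partition2111.toSpecht k).comp (wedgeSum k 3)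

theorem altToSpecht2111_eq_zero_iff (f : AltForm k 3) :
    altToSpecht2111 k f = 0 ↔ wedgeSum k 2 (contractSum k 2 f) = 0 := by
  rw [altToSpecht2111, IntertwiningMap.comp_apply, IsHook.toSpecht_eq_zero_iff,
    contractSum_wedgeSum, neg_eq_zero]

/-- Any nonzero element of the Specht module comes from some h with dh ≠ 0, and the average of its
translates produces every image of eL_3. That image therefore lies in each nonzero submodule. -/
theorem socleSub_partition2111 :
    socleSub (spechtRep k partition2111 5) = (altToSpecht2111 k).range := by
  rw [socleSub]
  have h1 : sSup {N : Submodule k[Equiv.Perm (Fin 5)] (spechtRep k partition2111 5).asModule |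
      IsAtom N} = (altToSpecht2111 k).range.asSubmodule := by
    refine sSup_isAtom_eq ?_ fun N hN => ?_
    · obtain ⟨f, hf⟩ := exists_wedgeSum_contractSum_ne_zero' k
      rw [Ne, Submodule.eq_bot_iff]
      intro hbot
      refine hf ((altToSpecht2111_eq_zero_iff f).mp (hbot (altToSpecht2111 k f) ?_))
      exact ⟨f, rfl⟩
    · obtain ⟨n, hn, hn0⟩ := Submodule.exists_mem_ne_zero_of_ne_bot hN
      obtain ⟨h, hh⟩ := isHook_partition2111.toSpecht_surjective (k := k) n
      have hh0 : contractSum k 3 h ≠ 0 := by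
        intro h0
        rw [← isHook_partition2111.toSpecht_eq_zero_iff, hh] at h0
        exact hn0 h0
      obtain ⟨x, b, hb, hxb⟩ := exists_averageMap_eq hh0
      rintro _ ⟨f, rfl⟩
      change altToSpecht2111 k f ∈ (Subrepresentation.ofSubmodule' N).toSubmodule
      have h2 : altToSpecht2111 k f = b⁻¹ • ∑ g : Equiv.Perm (Fin 5),
          f.coeff (g ∘ x) • spechtRep k partition2111 5 g (isHook_partition2111.toSpecht k h) := by
        have h3 : averageMap x h f = b • wedgeSum k 3 f := by rw [hxb]; rfl
        rw [altToSpecht2111, IntertwiningMap.comp_apply, eq_inv_smul_iff₀ hb, ← map_smul, ← h3,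
          averageMap_apply, map_sum]
        refine Finset.sum_congr rfl fun g _ => ?_
        rw [map_smul, IntertwiningMap.isIntertwining]
      rw [h2, hh]
      refine Submodule.smul_mem _ _ (Submodule.sum_mem _ fun g _ => Submodule.smul_mem _ _ ?_)
      exact (Subrepresentation.ofSubmodule' N).apply_mem_toSubmodule g hn
  rw [h1]
  rfl

theorem exists_altRep_three_surjective_simpleRep :
    ∃ q : (altRep k 3).IntertwiningMap (simpleRep k partition2111 5), Function.Surjective q ∧
      ∀ f, q f = 0 ↔ wedgeSum k 2 (contractSum k 2 f) = 0 := by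
  have hmem : ∀ f, altToSpecht2111 k f ∈ (socleSub (spechtRep k partition2111 5)).toSubmodule := by
    intro f
    rw [socleSub_partition2111]
    exact ⟨f, rfl⟩
  refine ⟨(altToSpecht2111 k).codRestrict _ hmem, ?_, fun f => ?_⟩
  · rintro ⟨y, hy⟩
    have hy' := hy
    rw [socleSub_partition2111] at hy'
    obtain ⟨f, hf⟩ := hy'
    exact ⟨f, Subtype.ext hf⟩
  · rw [← altToSpecht2111_eq_zero_iff]
    exact Subtype.ext_iff

end Socle

/-! ### Nonvanishing of cohomology -/

section NonVanishing

open Representation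

variable {k : Type u} [Field k] [CharP k 5]

/-- Every second Heller translate of the simple module is isomorphic to the kernel of a total
map. -/
theorem IsHellerTranslateSq.nonempty_equiv {V : Type u} [AddCommGroup V] [Module k V]
    {ρ : Representation k (Equiv.Perm (Fin 5)) V}
    (h : IsHellerTranslateSq (simpleRep k partition2111 5) ρ) :
    Nonempty (ρ.Equiv (totalMap k 2).ker.toRepresentation) := by
  obtain ⟨q, hq, hq'⟩ := exists_altRep_three_surjective_simpleRep (k := k)
  exact h.equiv_ker_totalMap q hq hq'

theorem hasHigmanElement_altRep_prod {n : ℕ} (hn : n < 2) :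
    HasHigmanElement ((altRep k (n + 1)).prod (altRep k (n + 3))) :=
  (hasHigmanElement_altRep (by omega)).prod (hasHigmanElement_altRep (by omega))

variable (k) in
theorem exists_kerFst_two_ne_zero : ∃ x, kerFst k 2 x ≠ 0 := by
  obtain ⟨f, hf⟩ := exists_wedgeSum_contractSum_ne_zero k
  exact ⟨totalCover k 1 (contractSum k 1 f, 0), fun h => hf (by
    rw [kerFst_apply, coe_totalCover] at h
    simpa using h)⟩

variable (k) in
/-- The first projection of the kernel of the second total map does not lift along the first. -/
theorem not_exists_lift_kerFst :
    ¬ ∃ ψ : (totalMap k 2).ker.toRepresentation.IntertwiningMap ((altRep k 1).prod (altRep k 3)),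
      ∀ x, totalMap k 1 (ψ x) = kerFst k 2 x := by
  rintro ⟨ψ, hψ⟩
  obtain ⟨x, hx⟩ := exists_kerFst_two_ne_zero k
  refine hx ?_
  rw [← hψ]
  have hV : (Module.finrank k (totalMap k 2).ker.toSubmodule : k) ≠ 0 := by
    rw [finrank_ker_totalMap]
    exact three_ne_zero_of_charP_five
  -- A lift would make `totalCover ∘ ψ` an endomorphism of U through a projective, hence zero; but
  -- its first component is the first projection.
  have := (hasHigmanElement_altRep_prod (k := k) (n := 0) (by norm_num)).eq_zero_of_factor
    (V := (totalMap k 2).ker.toSubmodule)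
    card_perm_eq_zero hV hasScalarEndomorphisms_ker_totalMap_two ψ (totalCover k 1) x
  exact congrArg (fun z => z.1.1) this

theorem finrank_ker_totalMap_eq : Module.finrank k (totalMap k 1).ker.toSubmodule =
    Module.finrank k (totalMap k 2).ker.toSubmodule := by
  obtain ⟨e⟩ := nonempty_equiv_dual_ker_totalMap k
  rw [e.toLinearEquiv.finrank_eq]
  exact (Subspace.dual_finrank_eq (K := k) (V := (totalMap k 1).ker.toSubmodule)).symm

variable (k) in
/-- The second projection of the kernel of the first total map does not lift along the second. -/
theorem not_exists_lift_kerSnd :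
    ¬ ∃ ψ : (totalMap k 1).ker.toRepresentation.IntertwiningMap ((altRep k 2).prod (altRep k 4)),
      ∀ x, totalMap k 2 (ψ x) = kerSnd k 1 x := by
  rintro ⟨ψ, hψ⟩
  obtain ⟨f, hf⟩ := exists_wedgeSum_contractSum_ne_zero' k
  have hV : (Module.finrank k (totalMap k 1).ker.toSubmodule : k) ≠ 0 := by
    rw [finrank_ker_totalMap_eq, finrank_ker_totalMap]
    exact three_ne_zero_of_charP_five
  have := (hasHigmanElement_altRep_prod (k := k) (n := 1) (by norm_num)).eq_zero_of_factor
    (V := (totalMap k 1).ker.toSubmodule)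
    card_perm_eq_zero hV hasScalarEndomorphisms_ker_totalMap_one ψ (totalCocover k 1)
    (totalCocover k 1 (contractSum k 2 f, 0))
  have h2 := congrArg (fun z => z.1.2) this
  change totalMap k 2 (ψ _) = 0 at h2
  rw [hψ, kerSnd_apply, coe_totalCocover] at h2
  exact hf (by simpa using h2)

variable {V : Type*} [AddCommGroup V] [Module k V] {ρ : Representation k (Equiv.Perm (Fin 5)) V}
  {W : Type*} [AddCommGroup W] [Module k W] {σ : Representation k (Equiv.Perm (Fin 5)) W}

theorem not_h1Trivial_linHom_dual (e : ρ.Equiv (totalMap k 2).ker.toRepresentation)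
    (e' : σ.Equiv (totalMap k 1).ker.toRepresentation) : ¬ H1Trivial (linHom ρ σ) := fun h =>
  not_exists_lift_kerFst k (H1Trivial.exists_lift_of_equiv
    (V := (totalMap k 2).ker.toSubmodule) h e e' (kerFst k 2) fun x => by
      obtain ⟨y, rfl⟩ := totalCover_surjective x
      exact ⟨y, rfl⟩)

theorem not_h1Trivial_linHom (e : ρ.Equiv (totalMap k 2).ker.toRepresentation)
    (e' : σ.Equiv (totalMap k 1).ker.toRepresentation) : ¬ H1Trivial (linHom σ ρ) := fun h =>
  not_exists_lift_kerSnd k (H1Trivial.exists_lift_of_equiv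
    (V := (totalMap k 1).ker.toSubmodule) h e' e (kerSnd k 1) fun x => by
      obtain ⟨y, rfl⟩ := totalCocover_surjective x
      exact ⟨y, rfl⟩)

omit [CharP k 5] in
theorem Representation.nonempty_dual_equiv {G W X : Type*} [Group G] [AddCommGroup W] [Module k W]
    [AddCommGroup X] [Module k X] [FiniteDimensional k X] {ρ : Representation k G V}
    {σ : Representation k G W} {τ : Representation k G X} (e : ρ.Equiv σ) (d : σ.Equiv τ.dual) :
    Nonempty (ρ.dual.Equiv τ) :=
  ⟨(e.trans d).symm.dualEquiv.trans (Representation.Equiv.bidual τ).symm⟩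

/-- The dual of a representation isomorphic to the kernel of the second total map is isomorphic
to the kernel of the first. -/
theorem nonempty_dual_equiv (e : ρ.Equiv (totalMap k 2).ker.toRepresentation) :
    Nonempty (ρ.dual.Equiv (totalMap k 1).ker.toRepresentation) := by
  obtain ⟨d⟩ := nonempty_equiv_dual_ker_totalMap k
  exact Representation.nonempty_dual_equiv (W := (totalMap k 2).ker.toSubmodule)
    (X := (totalMap k 1).ker.toSubmodule) e d

/-- The dual of U ⊗ U is Hom(U, U^*), whose first cohomology does not vanish. -/
theorem not_hasSpechtFiltration_tprod (e : ρ.Equiv (totalMap k 2).ker.toRepresentation) :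
    ¬ HasSpechtFiltration (ρ.tprod ρ) := by
  intro h
  obtain ⟨e'⟩ := nonempty_dual_equiv e
  have h1 := h.h1Trivial fun μ hμ => h1Trivial_dual_spechtRep hμ
  exact not_h1Trivial_linHom_dual e e' (h1.congr (Representation.Equiv.tprodDual ρ ρ))

/-- Here U ⊗ U is read as Hom(U^*, U). -/
theorem not_hasDualSpechtFiltration_tprod [FiniteDimensional k V]
    (e : ρ.Equiv (totalMap k 2).ker.toRepresentation) :
    ¬ HasDualSpechtFiltration (ρ.tprod ρ) := by
  intro h
  obtain ⟨e'⟩ := nonempty_dual_equiv e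
  have h1 := h.h1Trivial fun μ hμ => h1Trivial_dual_spechtRep hμ
  exact not_h1Trivial_linHom e e' (h1.congr (Representation.Equiv.tprodLinHom ρ ρ))

end NonVanishing

/-! ### Extensions -/

section Extensions

open Representation CategoryTheory

/-- If `φ` spans the morphisms to the quotient of an injective object and does not lift to that
object, then the extensions by the kernel form a line. -/
theorem CategoryTheory.ShortComplex.ShortExact.nonempty_ext_one_linearEquiv {k : Type*} [Field k]
    {C : Type*} [Category* C] [Abelian C] [Linear k C] [HasExt.{w} C] {S : ShortComplex C}
    (hS : S.ShortExact) [Injective S.X₂] {X : C} (φ : X ⟶ S.X₃)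
    (hφ : ∀ ψ : X ⟶ S.X₃, ∃ c : k, ψ = c • φ) (hlift : ¬ ∃ ψ : X ⟶ S.X₂, ψ ≫ S.g = φ) :
    Nonempty (Abelian.Ext X S.X₁ 1 ≃ₗ[k] k) := by
  -- The class is the image of `φ` under the connecting map. It is nonzero because `φ` does not
  -- lift, and it spans because the extensions by the injective term vanish.
  let ε : Abelian.Ext X S.X₁ 1 := (Abelian.Ext.mk₀ φ).comp hS.extClass (zero_add 1)
  have hε : ε ≠ 0 := by
    intro h
    obtain ⟨x, hx⟩ := Abelian.Ext.covariant_sequence_exact₃ X hS (Abelian.Ext.mk₀ φ) (zero_add 1) h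
    obtain ⟨ψ, rfl⟩ := (Abelian.Ext.mk₀_bijective X S.X₂).2 x
    refine hlift ⟨ψ, (Abelian.Ext.mk₀_bijective X S.X₃).1 ?_⟩
    rw [← hx, Abelian.Ext.mk₀_comp_mk₀]
  have hspan : ∀ x : Abelian.Ext X S.X₁ 1, ∃ c : k, c • ε = x := by
    intro x
    have : Subsingleton (Abelian.Ext X S.X₂ 1) := Abelian.Ext.subsingleton_of_injective X S.X₂ 0
    obtain ⟨y, rfl⟩ := Abelian.Ext.covariant_sequence_exact₁ X hS x (Subsingleton.elim _ _)
      (zero_add 1)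
    obtain ⟨ψ, rfl⟩ := (Abelian.Ext.mk₀_bijective X S.X₃).2 y
    obtain ⟨c, rfl⟩ := hφ ψ
    exact ⟨c, by rw [Abelian.Ext.mk₀_smul, Abelian.Ext.smul_comp]⟩
  exact ⟨(LinearEquiv.ofBijective (LinearMap.toSpanSingleton k _ ε)
    ⟨(injective_iff_map_eq_zero _).mpr fun c hc => (smul_eq_zero.mp hc).resolve_right hε,
      hspan⟩).symm⟩

variable {k : Type u} [Field k] {G : Type} [Group G]

theorem Representation.ofModule'_apply (M : Type*) [AddCommGroup M] [Module k M] [Module k[G] M]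
    [IsScalarTower k k[G] M] (g : G) (x : M) :
    ofModule' (k := k) (G := G) M g x = MonoidAlgebra.single g (1 : k) • x := rfl

theorem Representation.algebraMap_smul_asModule {V : Type*} [AddCommGroup V] [Module k V]
    {ρ : Representation k G V} (c : k) (x : ρ.asModule) :
    algebraMap k k[G] c • x = ρ.asModuleEquiv.symm (c • ρ.asModuleEquiv x) := by
  rw [MonoidAlgebra.coe_algebraMap]
  refine (Representation.single_smul ρ c 1 x).trans ?_
  rw [map_one]
  rfl

theorem HasHigmanElement.injective [Fintype G] {V : Type u} [AddCommGroup V] [Module k V]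
    {ρ : Representation k G V} (hρ : HasHigmanElement ρ) : Module.Injective k[G] ρ.asModule where
  out X Y _ _ _ _ f hf h := by
    let _ := Module.restrictScalars k k[G] X
    have := IsScalarTower.restrictScalars k k[G] X
    let _ := Module.restrictScalars k k[G] Y
    have := IsScalarTower.restrictScalars k k[G] Y
    let f' : (ofModule' (k := k) (G := G) X).IntertwiningMap (ofModule' (k := k) (G := G) Y) :=
      ⟨f.restrictScalars k, fun g => LinearMap.ext fun x => f.map_smul _ _⟩
    let h' : (ofModule' (k := k) (G := G) X).IntertwiningMap ρ :=
      { toFun := h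
        map_add' := map_add h
        map_smul' := fun c x => by
          have := h.map_smul (algebraMap k k[G] c) x
          rw [algebraMap_smul] at this
          rw [this]
          exact algebraMap_smul_asModule c (h x)
        isIntertwining' := fun g => LinearMap.ext fun x => by
          have := h.map_smul (MonoidAlgebra.single g 1) x
          change h (MonoidAlgebra.single g (1 : k) • x) = ρ g (h x)
          rw [this, single_smul, one_smul]
          rfl }
    obtain ⟨e, he⟩ := hρ.exists_extension f' hf h'
    refine ⟨{ toFun := e, map_add' := map_add e, map_smul' := fun m y => ?_ }, he⟩
    induction m using MonoidAlgebra.induction_linear with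
    | zero =>
      rw [zero_smul, map_zero]
      exact (zero_smul (M₀ := k[G]) (A := ρ.asModule) (e y)).symm
    | add a b ha hb =>
      rw [add_smul, map_add, ha, hb]
      exact (add_smul (M := ρ.asModule) a b (e y)).symm
    | single g a =>
      have h1 : MonoidAlgebra.single g a • y = a • ofModule' (k := k) (G := G) Y g y := by
        rw [ofModule'_apply, ← smul_assoc, MonoidAlgebra.smul_single, smul_eq_mul, mul_one]
      rw [h1, map_smul, e.isIntertwining]
      exact (Representation.single_smul ρ a g (e y)).symm

theorem nonempty_extRep_one_linearEquiv [Fintype G] {V W X Y : Type u} [AddCommGroup V]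
    [Module k V] [AddCommGroup W] [Module k W] [AddCommGroup X] [Module k X] [AddCommGroup Y]
    [Module k Y] {ρ : Representation k G V} {σ : Representation k G W} {τ : Representation k G X}
    {υ : Representation k G Y} (hτ : HasHigmanElement τ) (i : σ.IntertwiningMap τ)
    (p : τ.IntertwiningMap υ) (hi : Function.Injective i) (hp : Function.Surjective p)
    (hip : ∀ x, p x = 0 ↔ ∃ y, i y = x) (φ : ρ.IntertwiningMap υ)
    (hφ : ∀ ψ : ρ.IntertwiningMap υ, ∃ c : k, ψ = c • φ)
    (hlift : ¬ ∃ ψ : ρ.IntertwiningMap τ, ∀ v, p (ψ v) = φ v) :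
    Nonempty (ExtRep ρ σ 1 ≃ₗ[k] k) := by
  let E {V W : Type u} [AddCommGroup V] [Module k V] [AddCommGroup W] [Module k W]
    {ρ : Representation k G V} {σ : Representation k G W} (f : ρ.IntertwiningMap σ) :
    ModuleCat.of k[G] ρ.asModule ⟶ ModuleCat.of k[G] σ.asModule :=
    ModuleCat.ofHom (IntertwiningMap.equivLinearMapAsModule ρ σ f)
  let S : ShortComplex (ModuleCat.{u} k[G]) := ShortComplex.mk (E i) (E p) <| by
    ext x
    exact (hip _).mpr ⟨x, rfl⟩
  have hS : S.ShortExact := ModuleCat.shortComplex_shortExact S (fun x => hip x) hi hp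
  have := hτ.injective
  have : Injective S.X₂ := Module.injective_object_of_injective_module k[G] τ.asModule
  refine hS.nonempty_ext_one_linearEquiv (E φ) (fun ψ => ?_) ?_
  · obtain ⟨c, hc⟩ := hφ ((IntertwiningMap.equivLinearMapAsModule ρ υ).symm ψ.hom)
    refine ⟨c, ?_⟩
    have h1 : ψ.hom = IntertwiningMap.equivLinearMapAsModule ρ υ (c • φ) := by
      rw [← hc, LinearEquiv.apply_symm_apply]
    rw [map_smul] at h1
    apply ModuleCat.hom_ext
    rw [h1]
    exact LinearMap.ext fun v => (algebraMap_smul_asModule (ρ := υ) c (φ v)).symm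
  · rintro ⟨ψ, hψ⟩
    refine hlift ⟨(IntertwiningMap.equivLinearMapAsModule ρ τ).symm ψ.hom, fun v => ?_⟩
    exact congr(ModuleCat.Hom.hom $hψ v)

variable [CharP k 5]

/-- The sequence used is 0 → U^* → L_1 ⊕ L_3 → im → 0, with the image of the total map inside L_2.
Maps from U to the image are multiples of the first projection, which does not lift. -/
theorem nonempty_extRep_dual_linearEquiv {V : Type u} [AddCommGroup V] [Module k V]
    {ρ : Representation k (Equiv.Perm (Fin 5)) V}
    (e : ρ.Equiv (totalMap k 2).ker.toRepresentation) :
    Nonempty (ExtRep ρ ρ.dual 1 ≃ₗ[k] k) := by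
  obtain ⟨e'⟩ := nonempty_dual_equiv e
  let i : ρ.dual.IntertwiningMap ((altRep k 1).prod (altRep k 3)) :=
    IntertwiningMap.comp ⟨(totalMap k 1).ker.toSubmodule.subtype, fun _ => rfl⟩ e'.toIntertwiningMap
  let p : ((altRep k 1).prod (altRep k 3)).IntertwiningMap (totalMap k 1).range.toRepresentation :=
    (totalMap k 1).codRestrict _ fun x => ⟨x, rfl⟩
  let φ : ρ.IntertwiningMap (totalMap k 1).range.toRepresentation :=
    ((kerFst k 2).comp e.toIntertwiningMap).codRestrict _ fun v => by
      obtain ⟨y, hy⟩ := totalCover_surjective (e v)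
      exact ⟨y, congrArg (fun z => z.1.1) hy⟩
  let ι : (totalMap k 1).range.toRepresentation.IntertwiningMap (altRep k 2) :=
    ⟨(totalMap k 1).range.toSubmodule.subtype, fun _ => rfl⟩
  refine nonempty_extRep_one_linearEquiv (X := AltForm k 1 × AltForm k 3)
    (Y := (totalMap k 1).range.toSubmodule)
    (hasHigmanElement_altRep_prod (n := 0) (by norm_num)) i p ?_ ?_ ?_ φ ?_ ?_
  · exact Subtype.val_injective.comp e'.toLinearEquiv.injective
  · rintro ⟨_, x, rfl⟩
    exact ⟨x, rfl⟩
  · intro x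
    refine Subtype.ext_iff.trans ⟨fun hx => ?_, ?_⟩
    · obtain ⟨y, hy⟩ := e'.toLinearEquiv.surjective ⟨x, hx⟩
      exact ⟨y, congrArg Subtype.val hy⟩
    · rintro ⟨y, rfl⟩
      exact (e' y).2
  · intro ψ
    obtain ⟨c, hc⟩ := exists_eq_smul_kerFst_two ((ι.comp ψ).comp e.symm.toIntertwiningMap)
    refine ⟨c, DFunLike.ext _ _ fun v => Subtype.ext ?_⟩
    have := hc (e v)
    change (ψ (e.symm (e v))).1 = c • kerFst k 2 (e v) at this
    rw [e.symm_apply_apply] at this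
    exact this
  · rintro ⟨ψ, hψ⟩
    refine not_exists_lift_kerFst k ⟨ψ.comp e.symm.toIntertwiningMap, fun x => ?_⟩
    have := congrArg Subtype.val (hψ (e.symm x))
    change totalMap k 1 (ψ (e.symm x)) = kerFst k 2 (e (e.symm x)) at this
    rw [e.apply_symm_apply] at this
    exact this

end Extensions

/-! ### Nilpotent endomorphisms -/

section Nilpotent

variable {k : Type*} [Field k] {V : Type*} [AddCommGroup V] [Module k V]

/-- `x` maps the kernel of `x ^ (n + 1)` into that of `x ^ n`, with kernel inside that of `x`. -/
theorem Module.End.finrank_ker_pow_le [FiniteDimensional k V] (x : Module.End k V) (n : ℕ) :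
    Module.finrank k (LinearMap.ker (x ^ n)) ≤ n * Module.finrank k (LinearMap.ker x) := by
  induction n with
  | zero => simp [Module.End.one_eq_id, LinearMap.ker_id]
  | succ n ih =>
    let f : LinearMap.ker (x ^ (n + 1)) →ₗ[k] LinearMap.ker (x ^ n) :=
      x.restrict fun v hv => by
        rw [LinearMap.mem_ker, pow_succ, Module.End.mul_apply] at hv
        exact hv
    have h1 := LinearMap.finrank_range_add_finrank_ker f
    have h2 := Submodule.finrank_le (LinearMap.range f)
    have h3 : Module.finrank k (LinearMap.ker f) ≤ Module.finrank k (LinearMap.ker x) := by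
      let i : LinearMap.ker f →ₗ[k] LinearMap.ker x :=
        ((LinearMap.ker (x ^ (n + 1))).subtype.comp (LinearMap.ker f).subtype).codRestrict _
          fun v => congrArg Subtype.val (LinearMap.mem_ker.mp v.2)
      refine LinearMap.finrank_le_finrank_of_injective (f := i) fun a b hab => ?_
      exact Subtype.ext (Subtype.ext (congrArg (fun z : LinearMap.ker x => (z : V)) hab))
    rw [add_mul, one_mul]
    lia

variable {x : Module.End k V} {n : ℕ}

theorem Module.End.pow_apply_eq_zero_of_lt (hx : x ^ (n + 1) = 0) {m : ℕ} (hm : n < m) (v : V) :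
    (x ^ m) v = 0 := by
  rw [pow_eq_zero_of_le hm hx, LinearMap.zero_apply]

theorem Module.End.linearIndependent_pow_apply (hx : x ^ (n + 1) = 0) {v : V}
    (hv : (x ^ n) v ≠ 0) : LinearIndependent k fun i : Fin (n + 1) => (x ^ (i : ℕ)) v := by
  rw [Fintype.linearIndependent_iff]
  intro c hc
  have key : ∀ m (hm : m < n + 1), c ⟨m, hm⟩ = 0 := by
    intro m
    induction m using Nat.strong_induction_on with
    | _ m ih =>
      intro hm
      have h := congrArg (x ^ (n - m)) hc
      rw [map_sum, map_zero, Finset.sum_eq_single (⟨m, hm⟩ : Fin (n + 1))] at h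
      · rw [map_smul, ← Module.End.mul_apply, ← pow_add, Nat.sub_add_cancel (by lia)] at h
        exact (smul_eq_zero.mp h).resolve_right hv
      · intro i _ hi
        rcases lt_or_gt_of_ne (fun h => hi (Fin.ext h) : (i : ℕ) ≠ m) with hlt | hgt
        · rw [ih i hlt i.2, zero_smul, map_zero]
        · rw [map_smul, ← Module.End.mul_apply, ← pow_add,
            Module.End.pow_apply_eq_zero_of_lt hx (by lia), smul_zero]
      · simp
  exact fun i => key i i.2

/-- The cyclic subspace generated by a vector of maximal height is a direct summand. -/
theorem Module.End.exists_projection (hx : x ^ (n + 1) = 0) {v : V} (hv : (x ^ n) v ≠ 0) :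
    ∃ e : Module.End k V, x * e = e * x ∧ e v = v ∧
      (∀ w, e w ∈ Submodule.span k (Set.range fun i : Fin (n + 1) => (x ^ (i : ℕ)) v)) ∧
      ∃ c : k, LinearMap.trace k V e = (n + 1 : ℕ) * c := by
  have hli := Module.End.linearIndependent_pow_apply hx hv
  -- `l` reads off the coordinate of the last vector `x ^ n v` of the chain.
  obtain ⟨l, hl⟩ : ∃ l : V →ₗ[k] k, ∀ i : Fin (n + 1),
      l ((x ^ (i : ℕ)) v) = if (i : ℕ) = n then 1 else 0 := by
    obtain ⟨l, hl⟩ := LinearMap.exists_extend ((Module.Basis.span hli).constr k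
      fun i => if (i : ℕ) = n then (1 : k) else 0)
    refine ⟨l, fun i => ?_⟩
    have := LinearMap.congr_fun hl (Module.Basis.span hli i)
    rw [Module.Basis.constr_basis, LinearMap.comp_apply, Submodule.subtype_apply,
      Module.Basis.span_apply] at this
    exact this
  let θ : Module.End k V := l.smulRight v
  -- Commutation with `x` is a telescoping that uses `x ^ (n + 1) = 0`. By cyclicity each of the `n
  -- + 1` summands has the same trace.
  refine ⟨∑ i ∈ Finset.range (n + 1), x ^ i * θ * x ^ (n - i), ?_, ?_, fun w => ?_,
    LinearMap.trace k V (θ * x ^ n), ?_⟩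
  · rw [Finset.mul_sum, Finset.sum_mul, Finset.sum_range_succ, Finset.sum_range_succ',
      Nat.sub_self]
    congr 1
    · refine Finset.sum_congr rfl fun i hi => ?_
      have : n - i = n - (i + 1) + 1 := by have := Finset.mem_range.mp hi; lia
      rw [this, pow_succ x (n - (i + 1)), pow_succ' x i]
      simp only [mul_assoc]
    · simp only [pow_zero, one_mul, mul_one, Nat.sub_zero]
      rw [← mul_assoc, ← pow_succ', hx, zero_mul, mul_assoc, ← pow_succ, hx, mul_zero]
  · rw [LinearMap.sum_apply, Finset.sum_eq_single 0]
    · have := hl (Fin.last n)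
      simp only [Fin.val_last, if_true] at this
      simp [θ, this]
    · intro i hi hi0
      have := hl ⟨n - i, by lia⟩
      rw [if_neg (by have := Finset.mem_range.mp hi; simp only; lia)] at this
      simp only at this
      simp [θ, this]
    · simp
  · rw [LinearMap.sum_apply]
    refine Submodule.sum_mem _ fun i hi => ?_
    simp only [Module.End.mul_apply, θ, LinearMap.smulRight_apply, map_smul]
    exact Submodule.smul_mem _ _ (Submodule.subset_span ⟨⟨i, Finset.mem_range.mp hi⟩, rfl⟩)
  · rw [map_sum, Finset.sum_congr rfl fun i hi => ?_, Finset.sum_const, Finset.card_range,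
      nsmul_eq_mul]
    rw [mul_assoc, LinearMap.trace_mul_comm, mul_assoc, ← pow_add, Nat.sub_add_cancel]
    have := Finset.mem_range.mp hi; lia

/-- A nilpotent endomorphism with one-dimensional kernel is a single Jordan block. -/
theorem Module.End.exists_pow_apply_ne_zero [FiniteDimensional k V]
    (hV : Module.finrank k V = n + 1) (h1 : Module.finrank k (LinearMap.ker x) ≤ 1) :
    ∃ v, (x ^ n) v ≠ 0 := by
  by_contra! h
  have h0 : x ^ n = 0 := LinearMap.ext h
  have := Module.End.finrank_ker_pow_le x n
  rw [h0, LinearMap.ker_zero, finrank_top, hV] at this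
  have := Nat.mul_le_mul_left n h1
  lia

open Polynomial in
theorem sub_one_pow_char_of_pow_eq_one {p : ℕ} [Fact p.Prime] [CharP k p] {A : Type*} [Ring A]
    [Algebra k A] {a : A} (ha : a ^ p = 1) : (a - 1) ^ p = 0 := by
  have h : (X - 1 : k[X]) ^ p = X ^ p - 1 := by rw [sub_pow_char, one_pow]
  have := congrArg (aeval a) h
  simpa [ha] using this

open Polynomial in
theorem sum_pow_eq_sub_one_pow {p : ℕ} [Fact p.Prime] [CharP k p] {A : Type*} [Ring A]
    [Algebra k A] (a : A) : ∑ i ∈ Finset.range p, a ^ i = (a - 1) ^ (p - 1) := by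
  have h : ∑ i ∈ Finset.range p, (X : k[X]) ^ i = (X - 1) ^ (p - 1) := by
    have h1 : (X - 1 : k[X]) ≠ 0 := by simpa using X_sub_C_ne_zero (1 : k)
    refine mul_right_cancel₀ h1 ?_
    rw [geom_sum_mul, ← pow_succ, Nat.sub_add_cancel (Nat.Prime.pos Fact.out), sub_pow_char,
      one_pow]
  have := congrArg (aeval a) h
  simpa using this

end Nilpotent

/-! ### The action of a 5-cycle -/

section FiveCycle

open Representation

variable {k : Type u} [Field k] {n : ℕ}

theorem altRep_pow_apply_of_fixed {g : Equiv.Perm (Fin 5)} {f : AltForm k n}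
    (hf : altRep k n g f = f) (m : ℕ) (x : Fin n → Fin 5) :
    f.coeff (⇑(g ^ m) ∘ x) = f.coeff x := by
  have h : altRep k n (g ^ m) f = f := by
    rw [map_pow]
    induction m with
    | zero => rfl
    | succ m ih => rw [pow_succ, Module.End.mul_apply, hf, ih]
  conv_lhs => rw [← h, AltForm.coeff_altRep]
  congr 1
  funext i
  exact (g ^ m).symm_apply_apply _

/-- A four-element subset is determined by the point it omits, so rotations move it to {0, 1, 2, 3}.
-/
theorem eq_zero_of_finRotate_fixed_four {h : AltForm k 4}
    (hh : altRep k 4 (finRotate 5) h = h) (h0 : h.coeff ![0, 1, 2, 3] = 0) : h = 0 := by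
  refine AltForm.ext_coeff fun x hx => ?_
  obtain ⟨z, hz⟩ : ∃ z, z ∉ Set.range x := by
    by_contra! hall
    simpa using Fintype.card_le_of_surjective x hall
  obtain ⟨m, hm⟩ : ∃ m : Fin 5, (finRotate 5 ^ (m : ℕ)) z = 4 := by
    have : ∀ z : Fin 5, ∃ m : Fin 5, (finRotate 5 ^ (m : ℕ)) z = 4 := by decide
    exact this z
  have h4 : ∀ j : Fin 5, j ≠ 4 → j ∈ Set.range ![(0 : Fin 5), 1, 2, 3] := by decide
  obtain ⟨σ, hσ⟩ := exists_comp_perm_eq (x := ![(0 : Fin 5), 1, 2, 3])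
    (y := ⇑(finRotate 5 ^ (m : ℕ)) ∘ x) ((finRotate 5 ^ (m : ℕ)).injective.comp hx)
    fun i => h4 _ fun hi => hz ⟨i, (finRotate 5 ^ (m : ℕ)).injective (hi.trans hm.symm)⟩
  rw [← altRep_pow_apply_of_fixed hh m x, ← hσ, AltForm.coeff_comp_perm, h0, mul_zero]
  rfl

/-- Rotations have two orbits on pairs, at cyclic distances 1 and 2. -/
theorem eq_zero_of_finRotate_fixed_two {f : AltForm k 2}
    (hf : altRep k 2 (finRotate 5) f = f) (h1 : f.coeff ![0, 1] = 0) (h2 : f.coeff ![0, 2] = 0) :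
    f = 0 := by
  have hswap : ∀ i j, f.coeff ![i, j] = 0 → f.coeff ![j, i] = 0 := by
    intro i j hij
    have : (![j, i] : Fin 2 → Fin 5) = ![i, j] ∘ Equiv.swap 0 1 := by
      funext l; fin_cases l <;> rfl
    rw [this, AltForm.coeff_comp_perm, hij, mul_zero]
  refine AltForm.ext_coeff fun x hx => ?_
  obtain ⟨m, hm⟩ : ∃ m : Fin 5, ⇑(finRotate 5 ^ (m : ℕ)) ∘ x = ![0, 1] ∨
      ⇑(finRotate 5 ^ (m : ℕ)) ∘ x = ![1, 0] ∨ ⇑(finRotate 5 ^ (m : ℕ)) ∘ x = ![0, 2] ∨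
      ⇑(finRotate 5 ^ (m : ℕ)) ∘ x = ![2, 0] := by
    have key : ∀ i j : Fin 5, i ≠ j → ∃ m : Fin 5,
        ⇑(finRotate 5 ^ (m : ℕ)) ∘ ![i, j] = ![0, 1] ∨
        ⇑(finRotate 5 ^ (m : ℕ)) ∘ ![i, j] = ![1, 0] ∨
        ⇑(finRotate 5 ^ (m : ℕ)) ∘ ![i, j] = ![0, 2] ∨
        ⇑(finRotate 5 ^ (m : ℕ)) ∘ ![i, j] = ![2, 0] := by decide
    have hx2 : x = ![x 0, x 1] := by funext l; fin_cases l <;> rfl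
    rw [hx2]
    exact key _ _ fun h => absurd (hx h) (by decide)
  rw [← altRep_pow_apply_of_fixed hf m x, AltForm.coeff_zero]
  rcases hm with hm | hm | hm | hm <;> rw [hm]
  exacts [h1, hswap _ _ h1, h2, hswap _ _ h2]

/-- Once the second component vanishes, ef = 0 evaluated at (0, 1, 2) expresses the coefficient at
(0, 2) through those at (1, 2) and (0, 1), which are equal by rotation. So two coefficients detect a
fixed vector. -/
theorem eq_zero_of_finRotate_fixed {x : AltForm k 2 × AltForm k 4}
    (hx : totalMap k 2 x = 0) (h1 : altRep k 2 (finRotate 5) x.1 = x.1)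
    (h2 : altRep k 4 (finRotate 5) x.2 = x.2) (h3 : x.1.coeff ![0, 1] = 0)
    (h4 : x.2.coeff ![0, 1, 2, 3] = 0) : x = 0 := by
  have hx2 := eq_zero_of_finRotate_fixed_four h2 h4
  have h5 : x.1.coeff ![1, 2] = 0 := by
    rw [← h3, ← altRep_pow_apply_of_fixed h1 1 ![0, 1]]
    congr 1
    decide
  refine Prod.ext (eq_zero_of_finRotate_fixed_two h1 h3 ?_) hx2
  rw [totalMap_apply, hx2, map_zero, add_zero] at hx
  have := congrArg (fun f => AltForm.coeff f ![0, 1, 2]) hx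
  rw [coeff_wedgeSum, Fin.sum_univ_three] at this
  have e0 : (0 : Fin 3).removeNth ![(0 : Fin 5), 1, 2] = ![1, 2] := by decide
  have e1 : (1 : Fin 3).removeNth ![(0 : Fin 5), 1, 2] = ![0, 2] := by decide
  have e2 : (2 : Fin 3).removeNth ![(0 : Fin 5), 1, 2] = ![0, 1] := by decide
  rw [e0, e1, e2, h3, h5] at this
  simpa using this

theorem exists_sum_finRotate_ne_zero [CharP k 5] :
    ∃ f : AltForm k 3, ∑ i ∈ Finset.range 5,
      altRep k 2 (finRotate 5 ^ i) (contractSum k 2 f) ≠ 0 := by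
  refine ⟨dualForm k ![0, 1, 2], fun h => two_ne_zero_of_charP_five (k := k) ?_⟩
  have h1 := congrArg (fun f => AltForm.coeff f ![0, 1]) h
  simp only [AltForm.coeff_sum, AltForm.coeff_altRep, coeff_contractSum, coeff_dualForm_intCast,
    AltForm.coeff_zero] at h1
  norm_cast at h1
  rw [← h1]
  have h2 : ∀ z : ℤ, z = 2 → (2 : k) = (z : k) := by rintro _ rfl; simp
  refine h2 _ ?_
  decide

instance Nat.fact_prime_five : Fact (Nat.Prime 5) := ⟨Nat.prime_five⟩

/-- The action of an element of order five: it has at most two Jordan blocks, one of which has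
size five. -/
structure HasTwoBlocks {V : Type*} [AddCommGroup V] [Module k V] (a : Module.End k V) : Prop where
  pow_eq_zero : (a - 1) ^ 5 = 0
  finrank_ker_le : Module.finrank k (LinearMap.ker (a - 1)) ≤ 2
  pow_ne_zero : (a - 1) ^ 4 ≠ 0

variable [CharP k 5]

/-- Two coefficients embed the fixed space in k × k. The fourth power of g - 1 is the norm 1 + g +
... + g^4, which is nonzero on an explicit element. -/
theorem hasTwoBlocks_finRotate {V : Type*} [AddCommGroup V] [Module k V]
    {ρ : Representation k (Equiv.Perm (Fin 5)) V}
    (e : ρ.Equiv (totalMap k 2).ker.toRepresentation) : HasTwoBlocks (ρ (finRotate 5)) where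
  pow_eq_zero := sub_one_pow_char_of_pow_eq_one (k := k) <| by
    rw [← map_pow, show finRotate 5 ^ 5 = 1 by decide, map_one]
  finrank_ker_le := by
    let i : ρ.IntertwiningMap ((altRep k 2).prod (altRep k 4)) :=
      IntertwiningMap.comp ⟨(totalMap k 2).ker.toSubmodule.subtype, fun _ => rfl⟩
        e.toIntertwiningMap
    let l : LinearMap.ker (ρ (finRotate 5) - 1) →ₗ[k] k × k :=
      ((AltForm.coeffₗ ![0, 1]).comp (LinearMap.fst k _ _)).prod
        ((AltForm.coeffₗ ![0, 1, 2, 3]).comp (LinearMap.snd k _ _)) ∘ₗ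
        i.toLinearMap ∘ₗ Submodule.subtype _
    have hl : Function.Injective l := by
      refine (injective_iff_map_eq_zero l).mpr fun y hy => Subtype.ext ?_
      have h : ρ (finRotate 5) y.1 = y.1 := sub_eq_zero.mp (LinearMap.mem_ker.mp y.2)
      have h' := congrArg i h
      rw [i.isIntertwining] at h'
      have h0 : i y.1 = 0 := eq_zero_of_finRotate_fixed (e y.1).2 (congrArg Prod.fst h')
        (congrArg Prod.snd h') (congrArg Prod.fst hy) (congrArg Prod.snd hy)
      have h1 : e y.1 = 0 := Subtype.ext h0
      exact e.toLinearEquiv.map_eq_zero_iff.mp h1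
    simpa using LinearMap.finrank_le_finrank_of_injective hl
  pow_ne_zero := by
    obtain ⟨f, hf⟩ := exists_sum_finRotate_ne_zero (k := k)
    intro h
    have h1 := sum_pow_eq_sub_one_pow (k := k) (p := 5) (ρ (finRotate 5))
    rw [h] at h1
    have h2 := LinearMap.congr_fun h1 (e.symm (totalCover k 1 (0, f)))
    refine hf ?_
    have h3 := congrArg ((kerFst k 2).comp e.toIntertwiningMap) h2
    rw [LinearMap.sum_apply, map_sum, LinearMap.zero_apply, map_zero] at h3
    rw [← h3]
    refine Finset.sum_congr rfl fun i _ => ?_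
    rw [← map_pow, IntertwiningMap.isIntertwining]
    congr 1
    change _ = kerFst k 2 (e (e.symm _))
    rw [e.apply_symm_apply, kerFst_apply, coe_totalCover]
    simp

omit [CharP k 5] in
theorem HasTwoBlocks.of_equiv {V W : Type*} [AddCommGroup V] [Module k V] [AddCommGroup W]
    [Module k W] {a : Module.End k V} {b : Module.End k W} (hb : HasTwoBlocks b)
    (e : V ≃ₗ[k] W) (he : ∀ v, e (a v) = b (e v)) : HasTwoBlocks a := by
  obtain rfl : a = e.symm.conjRingEquiv b := LinearMap.ext fun v => e.injective <| by
    simp [he, LinearEquiv.conjRingEquiv]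
  have hx : e.symm.conjRingEquiv b - 1 = e.symm.conjRingEquiv (b - 1) := by
    rw [map_sub, map_one]
  refine ⟨?_, ?_, ?_⟩
  · rw [hx, ← map_pow, hb.pow_eq_zero, map_zero]
  · have h : LinearMap.ker (b - 1) =
        (LinearMap.ker (e.symm.conjRingEquiv b - 1)).map (e : V →ₗ[k] W) := by
      rw [hx]
      ext w
      simp [Submodule.mem_map_equiv, LinearEquiv.conjRingEquiv, -map_sub]
    rw [← LinearEquiv.finrank_map_eq e, ← h]
    exact hb.finrank_ker_le
  · rw [hx, ← map_pow, Ne, EmbeddingLike.map_eq_zero_iff]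
    exact hb.pow_ne_zero

omit [CharP k 5] in
theorem HasTwoBlocks.conj {G V : Type*} [Group G] [AddCommGroup V] [Module k V]
    {ρ : Representation k G V} {g g' : G} (hg : HasTwoBlocks (ρ g)) (h : IsConj g g') :
    HasTwoBlocks (ρ g') := by
  obtain ⟨c, rfl⟩ := isConj_iff.mp h
  refine hg.of_equiv (LinearEquiv.ofBijective (ρ c⁻¹) (ρ.apply_bijective c⁻¹)) fun v => ?_
  simp only [LinearEquiv.ofBijective_apply, ← Module.End.mul_apply, ← map_mul]
  congr 2
  group

/-- Two blocks of size at most 5, one of size 5, give a dimension between 5 and 10; it is 3 modulo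
5, hence 8. -/
theorem HasTwoBlocks.finrank_eq {V : Type*} [AddCommGroup V] [Module k V] [FiniteDimensional k V]
    {a : Module.End k V} (ha : HasTwoBlocks a) (hV : (Module.finrank k V : k) = 3) :
    Module.finrank k V = 8 := by
  have h1 := Module.End.finrank_ker_pow_le (a - 1) 5
  rw [ha.pow_eq_zero, LinearMap.ker_zero, finrank_top] at h1
  have h2 := ha.finrank_ker_le
  obtain ⟨v, hv⟩ : ∃ v, ((a - 1) ^ 4 : Module.End k V) v ≠ 0 := by
    by_contra! h
    exact ha.pow_ne_zero (LinearMap.ext h)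
  have h3 := (Module.End.linearIndependent_pow_apply ha.pow_eq_zero hv).fintype_card_le_finrank
  rw [Fintype.card_fin] at h3
  have h4 : (5 : ℕ) ∣ Module.finrank k V + 2 := by
    rw [← CharP.cast_eq_zero_iff k 5]
    push_cast
    rw [hV]
    have := five_eq_zero (k := k)
    linear_combination this
  lia

end FiveCycle

/-! ### Lattices over discrete valuation rings -/

section Lattice

variable {O : Type*} [CommRing O] [IsDomain O] {L : Type*} [AddCommGroup L] [Module O L]
  [Module.Free O L] [Module.Finite O L]

omit [IsDomain O] [Module.Free O L] [Module.Finite O L] in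
theorem Module.End.HasEigenvalue.pow_eq_one [IsDomain O] [Module.IsTorsionFree O L]
    {T : Module.End O L} {n : ℕ} (hT : T ^ n = 1) {μ : O} (hμ : T.HasEigenvalue μ) : μ ^ n = 1 := by
  have h2 := hμ.pow n
  rw [hT] at h2
  obtain ⟨v, hv⟩ := h2.exists_hasEigenvector
  have h5 : v = μ ^ n • v := hv.apply_eq_smul
  have h6 : (μ ^ n - 1) • v = 0 := by rw [sub_smul, one_smul, ← h5, sub_self]
  exact sub_eq_zero.mp ((smul_eq_zero.mp h6).resolve_right hv.2)

/-- The trace of an endomorphism of finite order is an algebraic integer. -/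
theorem LinearMap.isIntegral_trace_of_pow_eq_one {T : Module.End O L} {n : ℕ} (hn : n ≠ 0)
    (hT : T ^ n = 1) : IsIntegral ℤ (LinearMap.trace O L T) := by
  let K := AlgebraicClosure (FractionRing O)
  have hinj : Function.Injective (algebraMap O K) := by
    rw [IsScalarTower.algebraMap_eq O (FractionRing O) K]
    exact (algebraMap (FractionRing O) K).injective.comp (IsFractionRing.injective O _)
  rw [← isIntegral_algebraMap_iff hinj, ← LinearMap.trace_baseChange,
    Module.End.trace_eq_sum_roots_charpoly_of_splits (IsAlgClosed.splits _)]
  -- The trace is a sum of eigenvalues over an algebraic closure, all of them roots of unity.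
  refine IsIntegral.multiset_sum fun μ hμ => ?_
  have h1 := (Module.End.hasEigenvalue_iff_isRoot_charpoly _ μ).mpr (Polynomial.isRoot_of_mem_roots hμ)
  have h3 := congrArg (Module.End.baseChangeHom O K L) hT
  rw [map_pow, map_one] at h3
  have h4 : μ ^ n = 1 := Module.End.HasEigenvalue.pow_eq_one h3 h1
  exact ⟨Polynomial.X ^ n - 1, Polynomial.monic_X_pow_sub_C 1 hn, by simp [h4]⟩

/-- The element is the rational number b / a and is integral over ℤ, hence an integer. -/
theorem IsIntegral.dvd_of_mul_eq_intCast {R : Type*} [CommRing R] (K : Type*) [Field K]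
    [CharZero K] [Algebra R K] {t : R} (ht : IsIntegral ℤ t) {a b : ℤ} (ha : a ≠ 0)
    (h : (a : R) * t = b) : a ∣ b := by
  replace h := congrArg (algebraMap R K) h
  rw [map_mul, map_intCast, map_intCast] at h
  replace ht := ht.map (algebraMap R K).toIntAlgHom
  change IsIntegral ℤ (algebraMap R K t) at ht
  generalize algebraMap R K t = t at h ht
  have h1 : t = algebraMap ℚ K (b / a) := by
    have h3 : (a : K) ≠ 0 := by exact_mod_cast ha
    rw [map_div₀, map_intCast, map_intCast, eq_div_iff h3, mul_comm, h]
  have h2 : IsIntegral ℤ (b / a : ℚ) := by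
    rwa [← isIntegral_algebraMap_iff (algebraMap ℚ K).injective, ← h1]
  obtain ⟨y, hy⟩ := IsIntegrallyClosed.isIntegral_iff.mp h2
  refine ⟨y, ?_⟩
  have h3 : (a : ℚ) ≠ 0 := by exact_mod_cast ha
  rw [eq_div_iff h3, eq_intCast] at hy
  have : (y * a : ℤ) = b := by exact_mod_cast hy
  rw [← this, mul_comm]

/-- The trace of `1 + T + ... + T ^ (n - 1)` for an endomorphism `T` with `T ^ n = 1`. -/
theorem LinearMap.trace_sum_pow_of_pow_eq_one [IsPrincipalIdealRing O] {T : Module.End O L} {n : ℕ}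
    (hT : T ^ n = 1) : LinearMap.trace O L (∑ i ∈ Finset.range n, T ^ i) =
      n * Module.finrank O (LinearMap.ker (T - 1)) := by
  -- The norm maps into the fixed submodule and acts on it as multiplication by `n`.
  have hmem : ∀ v, (∑ i ∈ Finset.range n, T ^ i) v ∈ LinearMap.ker (T - 1) := by
    intro v
    rw [LinearMap.mem_ker, ← Module.End.mul_apply, mul_geom_sum, hT, sub_self, LinearMap.zero_apply]
  rw [← LinearMap.trace_restrict_eq_of_forall_mem _ _ hmem]
  have : (∑ i ∈ Finset.range n, T ^ i).restrict (fun x _ => hmem x) =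
      (n : O) • (LinearMap.id : LinearMap.ker (T - 1) →ₗ[O] LinearMap.ker (T - 1)) := by
    refine LinearMap.ext fun v => Subtype.ext ?_
    have hv : T v.1 = v.1 := sub_eq_zero.mp (LinearMap.mem_ker.mp v.2)
    have hp : ∀ i, (T ^ i) v.1 = v.1 := by
      intro i
      induction i with
      | zero => rfl
      | succ i ih => rw [pow_succ, Module.End.mul_apply, hv, ih]
    simp [LinearMap.sum_apply, hp, Nat.cast_smul_eq_nsmul]
  rw [this, map_smul, LinearMap.trace_id, smul_eq_mul]

omit [Module.Free O L] [Module.Finite O L] in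
/-- The rank of the kernel of an endomorphism does not drop under reduction. -/
theorem LinearMap.finrank_ker_le_of_reduction [IsPrincipalIdealRing O] [Module.Free O L]
    [Module.Finite O L] {k : Type*} [Field k] [Algebra O k]
    (hk : Function.Surjective (algebraMap O k)) {V : Type*} [AddCommGroup V] [Module k V]
    [FiniteDimensional k V] (j : L →+ V) (hj : ∀ a v, j (a • v) = algebraMap O k a • j v) {ϖ : O}
    (hϖ : ϖ ≠ 0) (h0 : ∀ v, j v = 0 → ∃ w, v = ϖ • w) (h1 : algebraMap O k ϖ = 0)
    {T : Module.End O L} {T' : Module.End k V} (hT : ∀ v, j (T v) = T' (j v)) :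
    Module.finrank O (LinearMap.ker T) ≤ Module.finrank k (LinearMap.ker T') := by
  let b := Module.finBasis O (LinearMap.ker T)
  let c : Fin (Module.finrank O (LinearMap.ker T)) → LinearMap.ker T' := fun i =>
    ⟨j (b i : L), by rw [LinearMap.mem_ker, ← hT, LinearMap.mem_ker.mp (b i).2, map_zero]⟩
  have hc : LinearIndependent k c := by
    refine Fintype.linearIndependent_iff.mpr fun a ha i => ?_
    choose a' ha' using fun i => hk (a i)
    let y : LinearMap.ker T := ∑ i, a' i • b i
    have hy : j (y : L) = 0 := by
      have := congrArg Subtype.val ha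
      rw [AddSubmonoidClass.coe_finsetSum] at this
      simp only [y, AddSubmonoidClass.coe_finsetSum, map_sum]
      refine (Finset.sum_congr rfl fun i _ => ?_).trans this
      rw [Submodule.coe_smul, Submodule.coe_smul, hj, ha']
    -- The kernel of `T` is saturated: if `ϖ • w` lies in it then so does `w`. A basis of it
    -- therefore stays independent after reduction.
    obtain ⟨w, hw⟩ := h0 _ hy
    have hw' : w ∈ LinearMap.ker T := by
      have h2 := y.2
      rw [hw, LinearMap.mem_ker, map_smul] at h2
      exact LinearMap.mem_ker.mpr ((smul_eq_zero.mp h2).resolve_left hϖ)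
    have h3 : y = ϖ • ⟨w, hw'⟩ := Subtype.ext hw
    have h4 := congrArg (fun z => b.repr z i) h3
    simp only [y, map_sum, map_smul, Module.Basis.repr_self, Finsupp.smul_single, smul_eq_mul,
      mul_one, Finsupp.finsetSum_apply, Finsupp.single_apply, Finset.sum_ite_eq',
      Finset.mem_univ, if_true, Finsupp.smul_apply] at h4
    rw [← ha' i, h4, map_mul, h1, zero_mul]
  simpa using hc.fintype_card_le_finrank

omit [IsDomain O] in
theorem Module.Free.exists_eq_smul_of_one_tmul_eq_zero {k : Type*} [Field k] [Algebra O k] {ϖ : O}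
    (hϖ : ∀ a, algebraMap O k a = 0 → ϖ ∣ a) {v : L} (hv : (1 : k) ⊗ₜ[O] v = 0) :
    ∃ w, v = ϖ • w := by
  let b := Module.Free.chooseBasis O L
  have h : ∀ i, ϖ ∣ b.repr v i := by
    intro i
    refine hϖ _ ?_
    have := congrArg (fun z => (Algebra.TensorProduct.basis k b).repr z i) hv
    simpa [Algebra.smul_def] using this
  choose c hc using h
  refine ⟨∑ i, c i • b i, ?_⟩
  rw [← b.sum_repr v, Finset.smul_sum]
  exact Finset.sum_congr rfl fun i _ => by rw [hc i, mul_smul]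

theorem TensorProduct.exists_one_tmul_eq {R k M : Type*} [CommRing R] [CommRing k] [Algebra R k]
    [AddCommGroup M] [Module R M] (hk : Function.Surjective (algebraMap R k)) (z : k ⊗[R] M) :
    ∃ v, (1 : k) ⊗ₜ[R] v = z := by
  induction z with
  | zero => exact ⟨0, TensorProduct.tmul_zero _ _⟩
  | add x y hx hy =>
    obtain ⟨v, rfl⟩ := hx
    obtain ⟨w, rfl⟩ := hy
    exact ⟨v + w, TensorProduct.tmul_add _ _ _⟩
  | tmul c v =>
    obtain ⟨a, rfl⟩ := hk c
    exact ⟨a • v, by rw [TensorProduct.tmul_smul, TensorProduct.smul_tmul', Algebra.algebraMap_eq_smul_one]⟩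

end Lattice

/-! ### The module does not lift to characteristic zero. -/

section Lifting

open Representation

variable {k : Type u} [Field k] [CharP k 5] {V : Type v} [AddCommGroup V] [Module k V]

theorem finrank_eq_of_equiv_ker_totalMap {ρ : Representation k (Equiv.Perm (Fin 5)) V}
    (e : ρ.Equiv (totalMap k 2).ker.toRepresentation) : (Module.finrank k V : k) = 3 := by
  rw [e.toLinearEquiv.finrank_eq]
  exact finrank_ker_totalMap

omit [CharP k 5] in
theorem finite_of_equiv_ker_totalMap {ρ : Representation k (Equiv.Perm (Fin 5)) V}
    (e : ρ.Equiv (totalMap k 2).ker.toRepresentation) : Module.Finite k V :=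
  Module.Finite.of_injective ((totalMap k 2).ker.toSubmodule.subtype ∘ₗ e.toLinearEquiv.toLinearMap)
    (Subtype.val_injective.comp e.toLinearEquiv.injective)

theorem not_liftsToCharZero {ρ : Representation k (Equiv.Perm (Fin 5)) V}
    (e : ρ.Equiv (totalMap k 2).ker.toRepresentation) : ¬ LiftsToCharZero.{w} ρ := by
  rintro ⟨O, _, _, _, _, _, L, _, _, τ, hk, _, _, ⟨e'⟩⟩
  let g : Equiv.Perm (Fin 5) := finRotate 5
  have hρ := hasTwoBlocks_finRotate e
  have := finite_of_equiv_ker_totalMap e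
  have hV := hρ.finrank_eq (finrank_eq_of_equiv_ker_totalMap e)
  let j : L →+ V := e'.toLinearEquiv.toLinearMap.toAddMonoidHom.comp
    (TensorProduct.mk O k L 1).toAddMonoidHom
  have hj : ∀ a v, j (a • v) = algebraMap O k a • j v := fun a v => by
    change e' ((1 : k) ⊗ₜ[O] (a • v)) = algebraMap O k a • e' ((1 : k) ⊗ₜ[O] v)
    rw [← map_smul, TensorProduct.tmul_smul, algebraMap_smul]
  have hjτ : ∀ v, j (τ g v) = ρ g (j v) := fun v =>
    IntertwiningMap.isIntertwining _ _ e'.toIntertwiningMap g ((1 : k) ⊗ₜ[O] v)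
  have hjs : Function.Surjective j := fun x => by
    obtain ⟨v, hv⟩ := TensorProduct.exists_one_tmul_eq hk (e'.symm x)
    exact ⟨v, (congrArg e' hv).trans (e'.apply_symm_apply x)⟩
  obtain ⟨ϖ, hϖ⟩ := IsDiscreteValuationRing.exists_irreducible O
  have hker : ∀ a, algebraMap O k a = 0 ↔ ϖ ∣ a := by
    intro a
    rw [← Ideal.mem_span_singleton, ← hϖ.maximalIdeal_eq,
      ← IsLocalRing.eq_maximalIdeal (RingHom.ker_isMaximal_of_surjective _ hk), RingHom.mem_ker]
  have hL : Module.finrank O L = 8 := by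
    rw [← hV, ← e'.toLinearEquiv.finrank_eq, Module.finrank_baseChange]
  have hg : τ g ^ 5 = 1 := by rw [← map_pow, show g ^ 5 = 1 by decide, map_one]
  have h2 : Module.finrank O (LinearMap.ker (τ g - 1)) ≤ 2 :=
    (LinearMap.finrank_ker_le_of_reduction hk j hj hϖ.ne_zero
      (fun v hv => Module.Free.exists_eq_smul_of_one_tmul_eq_zero (fun a => (hker a).mp)
        (e'.toLinearEquiv.map_eq_zero_iff.mp hv)) ((hker ϖ).mpr dvd_rfl) (T' := ρ g - 1)
      fun v => by simp [hjτ]).trans hρ.finrank_ker_le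
  -- Without fixed vectors the norm would vanish on the lattice, hence (g - 1)^4 would vanish on its
  -- reduction.
  have h0 : Module.finrank O (LinearMap.ker (τ g - 1)) ≠ 0 := by
    intro h0
    rw [Module.finrank_eq_zero_iff_of_free, Submodule.subsingleton_iff_eq_bot] at h0
    refine hρ.pow_ne_zero ?_
    rw [← sum_pow_eq_sub_one_pow (k := k) (p := 5)]
    refine LinearMap.ext fun x => ?_
    obtain ⟨v, rfl⟩ := hjs x
    have hv : (∑ i ∈ Finset.range 5, τ g ^ i) v ∈ LinearMap.ker (τ g - 1) := by
      rw [LinearMap.mem_ker, ← Module.End.mul_apply, mul_geom_sum, hg, sub_self,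
        LinearMap.zero_apply]
    rw [h0, Submodule.mem_bot, LinearMap.sum_apply] at hv
    have hjp : ∀ i, j ((τ g ^ i) v) = (ρ g ^ i) (j v) := by
      intro i
      induction i with
      | zero => rfl
      | succ i ih => rw [pow_succ', Module.End.mul_apply, hjτ, ih, pow_succ', Module.End.mul_apply]
    simpa [hjp] using congrArg j hv
  have htr : ∀ (h : Equiv.Perm (Fin 5)), LinearMap.trace O L (τ (h * g * h⁻¹)) =
      LinearMap.trace O L (τ g) := by
    intro h
    rw [mul_assoc, map_mul, LinearMap.trace_mul_comm, ← map_mul, inv_mul_cancel_right]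
  have htr' : ∀ i ∈ Finset.range 4, LinearMap.trace O L (τ g ^ (i + 1)) =
      LinearMap.trace O L (τ g) := by
    intro i hi
    have : ∀ i < 4, ∃ h, g ^ (i + 1) = h * g * h⁻¹ := by
      -- `c` is multiplication by 2 modulo 5, a generator of the automorphisms of the cyclic group,
      -- so its powers conjugate `g` to all its nontrivial powers.
      let c : Equiv.Perm (Fin 5) := Equiv.swap 1 2 * Equiv.swap 2 4 * Equiv.swap 4 3
      intro i hi
      interval_cases i
      exacts [⟨1, by decide⟩, ⟨c, by decide⟩, ⟨c ^ 3, by decide⟩, ⟨c ^ 2, by decide⟩]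
    obtain ⟨h, hh⟩ := this i (Finset.mem_range.mp hi)
    rw [← map_pow, hh, htr]
  have h3 := LinearMap.trace_sum_pow_of_pow_eq_one hg
  rw [map_sum, Finset.sum_range_succ', Finset.sum_congr rfl htr', pow_zero, LinearMap.trace_one, hL,
    Finset.sum_const, Finset.card_range] at h3
  have : CharZero (FractionRing O) :=
    charZero_of_injective_algebraMap (IsFractionRing.injective O (FractionRing O))
  -- With r the rank of the fixed lattice, 4 · trace = 5r - 8, so 4 divides r, contradicting 0 < r ≤
  -- 2.
  have h4 := (LinearMap.isIntegral_trace_of_pow_eq_one (by norm_num) hg).dvd_of_mul_eq_intCast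
    (FractionRing O) (a := 4) (b := 5 * Module.finrank O (LinearMap.ker (τ g - 1)) - 8)
    (by norm_num) (by
      push_cast at h3 ⊢
      rw [← h3]
      simp)
  lia

end Lifting

/-! ### Jordan blocks -/

section JordanBlock

variable {k : Type*} [Field k] {V W : Type*} [AddCommGroup V] [Module k V] [AddCommGroup W]
  [Module k W]

/-- `a` acts as a single nilpotent Jordan block of size `n + 1`. -/
def IsJordanBlock (a : Module.End k V) (n : ℕ) : Prop :=
  a ^ (n + 1) = 0 ∧ ∃ v, (a ^ n) v ≠ 0 ∧
    ∀ w, w ∈ Submodule.span k (Set.range fun i : Fin (n + 1) => (a ^ (i : ℕ)) v)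

namespace IsJordanBlock

variable {a : Module.End k V} {b : Module.End k W} {n : ℕ}

theorem finite (ha : IsJordanBlock a n) : Module.Finite k V := by
  obtain ⟨_, v, _, hv⟩ := ha
  exact Module.Finite.of_fg_top
    ((Submodule.eq_top_iff'.mpr hv) ▸ Submodule.fg_span (Set.finite_range _))

theorem of_finrank_ker_le [FiniteDimensional k V] (ha : IsNilpotent a)
    (hV : Module.finrank k V = n + 1) (h1 : Module.finrank k (LinearMap.ker a) ≤ 1) :
    IsJordanBlock a n := by
  obtain ⟨v, hv⟩ := Module.End.exists_pow_apply_ne_zero hV h1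
  have h0 : a ^ (n + 1) = 0 := by
    classical
    by_contra h
    obtain ⟨m, hm⟩ : ∃ m, Nat.find ha = m + 1 :=
      Nat.exists_eq_succ_of_ne_zero fun h0 =>
        h (pow_eq_zero_of_le (Nat.zero_le _) (h0 ▸ Nat.find_spec ha))
    have hm1 : a ^ (m + 1) = 0 := hm ▸ Nat.find_spec ha
    have hm2 : a ^ m ≠ 0 := Nat.find_min ha (by lia)
    obtain ⟨w, hw⟩ : ∃ w, (a ^ m) w ≠ 0 := by
      by_contra! h
      exact hm2 (LinearMap.ext h)
    have := (Module.End.linearIndependent_pow_apply hm1 hw).fintype_card_le_finrank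
    rw [Fintype.card_fin, hV] at this
    exact h (pow_eq_zero_of_le this hm1)
  refine ⟨h0, v, hv, fun w => ?_⟩
  rw [(Module.End.linearIndependent_pow_apply h0 hv).span_eq_top_of_card_eq_finrank
    (by rw [Fintype.card_fin, hV])]
  trivial

theorem exists_equiv (ha : IsJordanBlock a n) (hb : IsJordanBlock b n) :
    ∃ e : V ≃ₗ[k] W, ∀ v, e (a v) = b (e v) := by
  obtain ⟨ha0, v, hv, hv'⟩ := ha
  obtain ⟨hb0, w, hw, hw'⟩ := hb
  let B := Module.Basis.mk (Module.End.linearIndependent_pow_apply ha0 hv) fun x _ => hv' x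
  let C := Module.Basis.mk (Module.End.linearIndependent_pow_apply hb0 hw) fun x _ => hw' x
  let e := B.equiv C (Equiv.refl _)
  have he : ∀ i < n + 1, e ((a ^ i) v) = (b ^ i) w := by
    intro i hi
    have := B.equiv_apply ⟨i, hi⟩ C (Equiv.refl _)
    rwa [Module.Basis.mk_apply, Equiv.refl_apply, Module.Basis.mk_apply] at this
  refine ⟨e, fun x => ?_⟩
  have h : (e : V →ₗ[k] W) ∘ₗ a = b ∘ₗ (e : V →ₗ[k] W) := by
    refine B.ext fun i => ?_
    simp only [B, Module.Basis.mk_apply, LinearMap.comp_apply, LinearEquiv.coe_coe]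
    rw [he i i.2, ← Module.End.mul_apply, ← Module.End.mul_apply, ← pow_succ', ← pow_succ']
    by_cases hi : (i : ℕ) + 1 < n + 1
    · exact he _ hi
    · rw [pow_eq_zero_of_le (not_lt.mp hi) ha0, pow_eq_zero_of_le (not_lt.mp hi) hb0]
      simp
  exact LinearMap.congr_fun h x

/-- One component of the generating vector must survive `a ^ n`, and an invariant subspace
containing such a vector is everything. -/
theorem eq_bot_or_eq_bot (ha : IsJordanBlock a n) {A B : Submodule k V} (hAB : A ⊔ B = ⊤)
    (hd : ∀ x ∈ A, x ∈ B → x = 0) (hA : ∀ x ∈ A, a x ∈ A) (hB : ∀ x ∈ B, a x ∈ B) :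
    A = ⊥ ∨ B = ⊥ := by
  have := ha.finite
  obtain ⟨ha0, v, hv, hv'⟩ := ha
  have hrank : ∀ C : Submodule k V, (∀ x ∈ C, a x ∈ C) → (∃ x ∈ C, (a ^ n) x ≠ 0) → C = ⊤ := by
    rintro C hC ⟨x, hx, hxn⟩
    have hli := Module.End.linearIndependent_pow_apply ha0 hxn
    have hV : Module.finrank k V = n + 1 := by
      rw [Module.finrank_eq_card_basis (Module.Basis.mk
        (Module.End.linearIndependent_pow_apply ha0 hv) fun x _ => hv' x), Fintype.card_fin]
    rw [eq_top_iff, ← hli.span_eq_top_of_card_eq_finrank (by rw [Fintype.card_fin, hV]),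
      Submodule.span_le]
    have hpow : ∀ i : ℕ, (a ^ i) x ∈ C := by
      intro i
      induction i with
      | zero => exact hx
      | succ i ih =>
        rw [pow_succ', Module.End.mul_apply]
        exact hC _ ih
    rintro _ ⟨i, rfl⟩
    exact hpow i
  obtain ⟨x, hx, y, hy, rfl⟩ := Submodule.mem_sup.mp (hAB ▸ Submodule.mem_top : v ∈ A ⊔ B)
  by_cases hxn : (a ^ n) x = 0
  · rw [map_add, hxn, zero_add] at hv
    left
    have hB := hrank B hB ⟨y, hy, hv⟩
    exact (Submodule.eq_bot_iff _).mpr fun z hz => hd z hz (hB ▸ Submodule.mem_top)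
  · right
    have hA := hrank A hA ⟨x, hx, hxn⟩
    exact (Submodule.eq_bot_iff _).mpr fun z hz => hd z (hA ▸ Submodule.mem_top) hz

end IsJordanBlock

theorem Module.End.eq_self_of_mem_span {a e : Module.End k V} (hae : a * e = e * a) {v : V}
    (hv : e v = v) {n : ℕ} {w : V}
    (hw : w ∈ Submodule.span k (Set.range fun i : Fin (n + 1) => (a ^ (i : ℕ)) v)) : e w = w := by
  have : Submodule.span k (Set.range fun i : Fin (n + 1) => (a ^ (i : ℕ)) v) ≤
      LinearMap.eqLocus e LinearMap.id := by
    rw [Submodule.span_le]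
    rintro _ ⟨i, rfl⟩
    have h : e * a ^ (i : ℕ) = a ^ (i : ℕ) * e := (Commute.pow_left hae i).symm
    change (e * a ^ (i : ℕ)) v = _
    rw [h, Module.End.mul_apply, hv]
    rfl
  exact this hw

end JordanBlock

/-! ### Radical powers -/

section RadicalPower

/-- With the radical generated by one central element, its powers act through the powers of that
element. This is applied to g - 1 in the group algebra of a cyclic group. -/
theorem mem_radicalPower_iff {R : Type u} {M : Type v} [Ring R] [AddCommGroup M] [Module R M]
    {s : R} (hs : s ∈ Ring.jacobson R) (hc : ∀ r, Commute s r)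
    (hJ : ∀ j ∈ Ring.jacobson R, ∃ r, j = s * r) (n : ℕ) (m : M) :
    m ∈ radicalPower R M n ↔ ∃ v, m = s ^ n • v := by
  induction n generalizing m with
  | zero => exact ⟨fun _ => ⟨m, by simp⟩, fun _ => trivial⟩
  | succ n ih =>
    constructor
    · intro hm
      induction hm using Submodule.smul_induction_on' with
      | smul j hj x hx =>
        obtain ⟨r, rfl⟩ := hJ j hj
        obtain ⟨v, rfl⟩ := (ih x).mp hx
        refine ⟨r • v, ?_⟩
        rw [smul_smul, smul_smul, mul_assoc, ← ((hc r).pow_left n).eq, ← mul_assoc, ← pow_succ']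
      | add x _ y _ hx hy =>
        obtain ⟨v, rfl⟩ := hx
        obtain ⟨w, rfl⟩ := hy
        exact ⟨v + w, (smul_add _ _ _).symm⟩
    · rintro ⟨v, rfl⟩
      rw [pow_succ', mul_smul]
      exact Submodule.smul_mem_smul hs ((ih _).mpr ⟨v, rfl⟩)

open MonoidAlgebra

variable {k : Type u} [Field k] {Q : Type w} [Group Q] {g : Q} (hg : ∀ h, ∃ i : ℕ, g ^ i = h)

include hg in
theorem MonoidAlgebra.commute_single_sub_one (r : k[Q]) : Commute (single g 1 - 1 : k[Q]) r := by
  refine Commute.sub_left ?_ (Commute.one_left r)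
  induction r using MonoidAlgebra.induction_linear with
  | zero => exact Commute.zero_right _
  | add a b ha hb => exact ha.add_right hb
  | single h a =>
    obtain ⟨i, rfl⟩ := hg h
    simp only [Commute, SemiconjBy, MonoidAlgebra.single_mul_single, one_mul, mul_one,
      ← pow_succ, ← pow_succ']

theorem MonoidAlgebra.single_sub_one_pow [CharP k 5] (h5 : g ^ 5 = 1) :
    (single g 1 - 1 : k[Q]) ^ 5 = 0 :=
  sub_one_pow_char_of_pow_eq_one (k := k) <| by
    rw [MonoidAlgebra.single_pow, h5, one_pow, MonoidAlgebra.one_def]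

include hg in
theorem MonoidAlgebra.single_sub_one_mem_jacobson [CharP k 5] (h5 : g ^ 5 = 1) :
    (single g 1 - 1 : k[Q]) ∈ Ring.jacobson k[Q] := by
  rw [← Ideal.jacobson_bot, Ideal.mem_jacobson_iff]
  intro y
  have h : IsNilpotent (y * (single g 1 - 1 : k[Q])) :=
    ⟨5, by rw [(commute_single_sub_one hg y).symm.mul_pow, single_sub_one_pow h5, mul_zero]⟩
  obtain ⟨z, hz⟩ := h.isUnit_one_add.exists_left_inv
  refine ⟨z, (Ideal.mem_bot).mpr ?_⟩
  rw [mul_add, mul_one] at hz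
  rw [mul_assoc, add_comm (z * _), hz, sub_self]

-- The radical lies in the augmentation ideal, which is maximal, and g^i - 1 is divisible by g - 1
-- through a geometric sum.
include hg in
theorem MonoidAlgebra.exists_eq_single_sub_one_mul {j : k[Q]} (hj : j ∈ Ring.jacobson k[Q]) :
    ∃ r, j = (single g 1 - 1 : k[Q]) * r := by
  let ε : k[Q] →ₐ[k] k := MonoidAlgebra.lift k k Q 1
  have hε : ε j = 0 := by
    have : (RingHom.ker ε.toRingHom).IsMaximal :=
      RingHom.ker_isMaximal_of_surjective _ fun c => ⟨algebraMap k _ c, ε.commutes c⟩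
    exact Ring.jacobson_le_of_isMaximal (RingHom.ker ε.toRingHom) hj
  have key : ∀ r : k[Q], ∃ r', r - algebraMap k _ (ε r) = (single g 1 - 1 : k[Q]) * r' := by
    intro r
    induction r using MonoidAlgebra.induction_linear with
    | zero => exact ⟨0, by simp⟩
    | add a b ha hb =>
      obtain ⟨a', ha⟩ := ha
      obtain ⟨b', hb⟩ := hb
      refine ⟨a' + b', ?_⟩
      rw [mul_add, ← ha, ← hb, map_add, map_add]
      abel
    | single h a =>
      obtain ⟨i, rfl⟩ := hg h
      refine ⟨a • ∑ l ∈ Finset.range i, single g 1 ^ l, ?_⟩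
      rw [mul_smul_comm, mul_geom_sum, MonoidAlgebra.single_pow, one_pow, smul_sub]
      simp [ε, Algebra.algebraMap_eq_smul_one]
  obtain ⟨r, hr⟩ := key j
  exact ⟨r, by rw [← hr, hε, map_zero, sub_zero]⟩

include hg in
theorem mem_radicalSub_iff [CharP k 5] (h5 : g ^ 5 = 1) {V : Type v} [AddCommGroup V] [Module k V]
    (ρ : Representation k Q V) (n : ℕ) (v : V) :
    v ∈ (radicalSub ρ n).toSubmodule ↔ ∃ w, v = ((ρ g - 1) ^ n : Module.End k V) w := by
  refine (mem_radicalPower_iff (M := ρ.asModule) (single_sub_one_mem_jacobson hg h5)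
    (commute_single_sub_one hg) (fun j => exists_eq_single_sub_one_mul hg) n v).trans ?_
  have : ρ.asAlgebraHom ((single g 1 - 1 : k[Q]) ^ n) = (ρ g - 1) ^ n := by
    rw [map_pow, map_sub, map_one, Representation.asAlgebraHom_single_one]
  rw [← this]
  rfl

include hg in
theorem hasLoewyLength_iff [CharP k 5] (h5 : g ^ 5 = 1) {V : Type v} [AddCommGroup V]
    [Module k V] (ρ : Representation k Q V) (n : ℕ) :
    HasLoewyLength ρ (n + 1) ↔ (ρ g - 1) ^ (n + 1) = 0 ∧ (ρ g - 1) ^ n ≠ 0 := by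
  have h : ∀ m, radicalSub ρ m = ⊥ ↔ (ρ g - 1) ^ m = 0 := by
    intro m
    rw [← Subrepresentation.toSubmodule_injective.eq_iff]
    refine (Submodule.eq_bot_iff _).trans ?_
    simp only [mem_radicalSub_iff hg h5]
    exact ⟨fun h => LinearMap.ext fun w => h _ ⟨w, rfl⟩, by rintro h _ ⟨w, rfl⟩; rw [h]; rfl⟩
  constructor
  · rintro ⟨h1, h2⟩
    refine ⟨(h _).mp h1, fun h0 => ?_⟩
    have := h2 ((h n).mpr h0)
    lia
  · rintro ⟨h1, h2⟩
    refine ⟨(h _).mpr h1, fun m hm => ?_⟩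
    by_contra! hlt
    exact h2 (pow_eq_zero_of_le (Nat.lt_succ_iff.mp hlt) ((h m).mp hm))

end RadicalPower

/-! ### Representations of the cyclic group of order five -/

section CyclicGroup

open Representation

theorem IsJordanBlock.of_equiv {k : Type*} [Field k] {V W : Type*} [AddCommGroup V] [Module k V]
    [AddCommGroup W] [Module k W] {a : Module.End k V} {b : Module.End k W} {n : ℕ}
    (hb : IsJordanBlock b n) (e : V ≃ₗ[k] W) (he : ∀ v, e (a v) = b (e v)) :
    IsJordanBlock a n := by
  have he' : ∀ i v, e ((a ^ i) v) = (b ^ i) (e v) := by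
    intro i
    induction i with
    | zero => exact fun v => rfl
    | succ i ih => exact fun v => by rw [pow_succ, Module.End.mul_apply, ih, he]; rfl
  obtain ⟨hb0, w, hw, hw'⟩ := hb
  refine ⟨LinearMap.ext fun v => e.injective ?_, e.symm w, fun h => hw ?_, fun v => ?_⟩
  · rw [he', hb0]
    simp
  · have := he' n (e.symm w)
    rwa [h, map_zero, e.apply_symm_apply, eq_comm] at this
  · have h1 : (fun i : Fin (n + 1) => (a ^ (i : ℕ)) (e.symm w)) =
        (e.symm : W →ₗ[k] V) ∘ fun i : Fin (n + 1) => (b ^ (i : ℕ)) w := by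
      funext i
      refine e.injective ?_
      rw [he']
      simp
    rw [h1, Set.range_comp, Submodule.span_image]
    exact ⟨e v, hw' _, e.symm_apply_apply v⟩

variable {k : Type u} [Field k] {Q : Type w} [Group Q] {g : Q} (hg : ∀ h, ∃ i : ℕ, g ^ i = h)
  {V : Type*} [AddCommGroup V] [Module k V] {W : Type*} [AddCommGroup W] [Module k W]
  {ρ : Representation k Q V} {σ : Representation k Q W} {n : ℕ}

include hg in
theorem Representation.commute_of_commute_generator {f : V →ₗ[k] W} (hf : ∀ v, f (ρ g v) = σ g (f v))
    (h : Q) (v : V) : f (ρ h v) = σ h (f v) := by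
  obtain ⟨i, rfl⟩ := hg h
  rw [map_pow, map_pow]
  induction i generalizing v with
  | zero => rfl
  | succ i ih => rw [pow_succ, Module.End.mul_apply, ih, hf]; rfl

include hg in
theorem Representation.nonempty_equiv_of_isJordanBlock (hρ : IsJordanBlock (ρ g - 1) n)
    (hσ : IsJordanBlock (σ g - 1) n) : Nonempty (ρ.Equiv σ) := by
  obtain ⟨e, he⟩ := hρ.exists_equiv hσ
  refine ⟨Representation.Equiv.mk e fun h => LinearMap.ext
    (commute_of_commute_generator (f := (e : V →ₗ[k] W)) hg (fun v => ?_) h)⟩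
  have := he v
  simp only [LinearMap.sub_apply, map_sub, Module.End.one_apply] at this
  exact sub_left_injective this

theorem isIndecomposableRep_of_isJordanBlock (hρ : IsJordanBlock (ρ g - 1) n) :
    IsIndecomposableRep ρ := by
  refine ⟨?_, fun A B hAB => ?_⟩
  · obtain ⟨-, v, hv, -⟩ := hρ
    exact ⟨_, _, hv⟩
  · have hinv : ∀ C : Subrepresentation ρ, ∀ x ∈ C.toSubmodule, (ρ g - 1) x ∈ C.toSubmodule :=
      fun C x hx => C.toSubmodule.sub_mem (C.apply_mem_toSubmodule g hx) hx
    have h := hρ.eq_bot_or_eq_bot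
      (congrArg Subrepresentation.toSubmodule (codisjoint_iff.mp hAB.codisjoint))
      (fun x hA hB => by
        have h0 := congrArg Subrepresentation.toSubmodule (disjoint_iff.mp hAB.disjoint)
        have hx : x ∈ (A ⊓ B).toSubmodule := ⟨hA, hB⟩
        rw [h0] at hx
        exact hx) (hinv A) (hinv B)
    exact h.imp (fun h => Subrepresentation.toSubmodule_injective h)
      (fun h => Subrepresentation.toSubmodule_injective h)

-- A vector of maximal height generates an equivariant direct summand, the image of
-- `Module.End.exists_projection`; indecomposability forces its complement to vanish.
include hg in
theorem IsIndecomposableRep.isJordanBlock (hρ : IsIndecomposableRep ρ)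
    (h0 : (ρ g - 1) ^ (n + 1) = 0) (h1 : (ρ g - 1) ^ n ≠ 0) : IsJordanBlock (ρ g - 1) n := by
  obtain ⟨v, hv⟩ : ∃ v, ((ρ g - 1) ^ n : Module.End k V) v ≠ 0 := by
    by_contra! h
    exact h1 (LinearMap.ext h)
  obtain ⟨e, hae, hev, hspan, -⟩ := Module.End.exists_projection h0 hv
  have hee : ∀ w, e (e w) = e w := fun w => Module.End.eq_self_of_mem_span hae hev (hspan w)
  have heg : ∀ v, e (ρ g v) = ρ g (e v) := by
    intro v
    have := LinearMap.congr_fun hae v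
    simp only [Module.End.mul_apply, LinearMap.sub_apply, map_sub, Module.End.one_apply] at this
    exact (sub_left_injective this).symm
  have hcomm := commute_of_commute_generator hg heg
  let A : Subrepresentation ρ := ⟨LinearMap.range e, by
    rintro h _ ⟨w, rfl⟩
    exact ⟨ρ h w, hcomm h w⟩⟩
  let B : Subrepresentation ρ := ⟨LinearMap.ker e, fun h w hw => by
    rw [LinearMap.mem_ker] at hw ⊢
    rw [hcomm, hw, map_zero]⟩
  have hAB : IsCompl A B := by
    refine ⟨disjoint_iff.mpr (Subrepresentation.toSubmodule_injective ?_),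
      codisjoint_iff.mpr (Subrepresentation.toSubmodule_injective ?_)⟩
    · refine (Submodule.eq_bot_iff _).mpr ?_
      rintro _ ⟨⟨w, rfl⟩, hw⟩
      rw [← hee]
      exact hw
    · refine Submodule.eq_top_iff'.mpr fun w => Submodule.mem_sup.mpr
        ⟨e w, ⟨w, rfl⟩, w - e w, ?_, add_sub_cancel _ _⟩
      exact LinearMap.mem_ker.mpr (by rw [map_sub, hee, sub_self])
  refine ⟨h0, v, hv, fun w => ?_⟩
  rcases hρ.2 A B hAB with h | h
  · have h2 : v ∈ A.toSubmodule := ⟨v, hev⟩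
    rw [h] at h2
    exact absurd (by rw [(Submodule.mem_bot k).mp h2, map_zero]) hv
  · have h2 : w - e w ∈ B.toSubmodule := LinearMap.mem_ker.mpr (by rw [map_sub, hee, sub_self])
    rw [h] at h2
    rw [sub_eq_zero.mp ((Submodule.mem_bot k).mp h2)]
    exact hspan w

variable [CharP k 5]

theorem isJordanBlock_leftRegular (h5 : orderOf g = 5) (hQ : Nat.card Q = 5) :
    IsJordanBlock (leftRegular k Q g - 1) 4 := by
  have h0 : (leftRegular k Q g - 1) ^ 5 = 0 :=
    sub_one_pow_char_of_pow_eq_one (k := k) <| by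
      rw [← map_pow, ← h5, pow_orderOf_eq_one, map_one]
  have h1 : ((leftRegular k Q g - 1) ^ 4 : Module.End k k[Q]) (MonoidAlgebra.single 1 1) ≠ 0 := by
    rw [← sum_pow_eq_sub_one_pow (k := k) (p := 5), LinearMap.sum_apply]
    intro h
    have h2 : ∀ i ∈ Finset.range 5, (leftRegular k Q g ^ i : Module.End k k[Q])
        (MonoidAlgebra.single 1 1) = MonoidAlgebra.single (g ^ i) 1 := by
      intro i _
      rw [← map_pow, leftRegular, ofMulAction_single, smul_eq_mul, mul_one]
    rw [Finset.sum_congr rfl h2] at h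
    have h3 := congrArg (fun z : k[Q] => z.coeff 1) h
    rw [MonoidAlgebra.coeff_sum, Finsupp.finsetSum_apply, Finset.sum_eq_single 0] at h3
    · simp at h3
    · intro i hi hi0
      classical
      rw [MonoidAlgebra.coeff_single, Finsupp.single_apply, if_neg]
      exact pow_ne_one_of_lt_orderOf hi0 (h5 ▸ Finset.mem_range.mp hi)
    · simp
  have : Finite Q := Nat.finite_of_card_ne_zero (by rw [hQ]; norm_num)
  have : Fintype Q := Fintype.ofFinite Q
  have hli := Module.End.linearIndependent_pow_apply h0 h1
  refine ⟨h0, _, h1, fun w => ?_⟩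
  rw [hli.span_eq_top_of_card_eq_finrank]
  · trivial
  · rw [(MonoidAlgebra.coeffLinearEquiv k).finrank_eq, Module.finrank_finsupp_self, Fintype.card_fin,
      ← Nat.card_eq_fintype_card, hQ]

include hg in
theorem isJordanBlock_radicalSub {m : ℕ} {V : Type v} [AddCommGroup V] [Module k V]
    {ρ : Representation k Q V} (h5 : g ^ 5 = 1) (hρ : IsJordanBlock (ρ g - 1) (m + n)) :
    IsJordanBlock ((radicalSub ρ m).toRepresentation g - 1) n := by
  have hpow : ∀ (i : ℕ) (x : (radicalSub ρ m).toSubmodule),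
      ((((radicalSub ρ m).toRepresentation g - 1) ^ i : Module.End k _) x).1 =
        ((ρ g - 1) ^ i : Module.End k V) x.1 := by
    intro i
    induction i with
    | zero => exact fun x => rfl
    | succ i ih =>
      intro x
      rw [pow_succ, Module.End.mul_apply, ih, pow_succ, Module.End.mul_apply]
      rfl
  obtain ⟨h0, v, hv, hv'⟩ := hρ
  let v' : (radicalSub ρ m).toSubmodule :=
    ⟨((ρ g - 1) ^ m : Module.End k V) v, (mem_radicalSub_iff hg h5 ρ m _).mpr ⟨v, rfl⟩⟩
  refine ⟨LinearMap.ext fun x => Subtype.ext ?_, v', fun h => hv ?_, fun x => ?_⟩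
  · obtain ⟨w, hw⟩ := (mem_radicalSub_iff hg h5 ρ m x.1).mp x.2
    rw [hpow, hw, ← Module.End.mul_apply, ← pow_add, add_comm, ← add_assoc, h0]
    rfl
  · have := congrArg Subtype.val h
    rw [hpow, ← Module.End.mul_apply, ← pow_add, add_comm] at this
    exact this
  · obtain ⟨w, hw⟩ := (mem_radicalSub_iff hg h5 ρ m x.1).mp x.2
    suffices h : ∀ y ∈ Submodule.span k
        (Set.range fun i : Fin (m + n + 1) => ((ρ g - 1) ^ (i : ℕ) : Module.End k V) v),
        ((ρ g - 1) ^ m : Module.End k V) y ∈ (Submodule.span k (Set.range fun i : Fin (n + 1) =>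
          (((radicalSub ρ m).toRepresentation g - 1) ^ (i : ℕ) : Module.End k _) v')).map
          (radicalSub ρ m).toSubmodule.subtype by
      obtain ⟨z, hz, hzx⟩ := h w (hv' w)
      rwa [show x = z from Subtype.ext (hw.trans hzx.symm)]
    intro y hy
    induction hy using Submodule.span_induction with
    | zero => rw [map_zero]; exact Submodule.zero_mem _
    | add a b _ _ ha hb => rw [map_add]; exact Submodule.add_mem _ ha hb
    | smul c a _ ha => rw [map_smul]; exact Submodule.smul_mem _ _ ha
    | mem _ hi =>
      obtain ⟨i, rfl⟩ := hi
      simp only [← Module.End.mul_apply, ← pow_add]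
      by_cases hi : (i : ℕ) < n + 1
      · refine ⟨_, Submodule.subset_span ⟨⟨i, hi⟩, rfl⟩, ?_⟩
        rw [Submodule.subtype_apply, hpow, ← Module.End.mul_apply, ← pow_add, add_comm]
      · rw [pow_eq_zero_of_le (by lia) h0]
        exact Submodule.zero_mem _

/-- The regular representation is one block of size 5, and the second radical power drops two steps,
leaving a block of size 3. -/
theorem isJordanBlock_radicalPowerRep (hg : ∀ h, ∃ i : ℕ, g ^ i = h) (h5 : orderOf g = 5)
    (hQ : Nat.card Q = 5) : IsJordanBlock (radicalPowerRep k Q 2 g - 1) 2 :=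
  isJordanBlock_radicalSub (m := 2) hg (h5 ▸ pow_orderOf_eq_one g) (isJordanBlock_leftRegular h5 hQ)

theorem isIndecomposableRep_and_hasLoewyLength_iff (hg : ∀ h, ∃ i : ℕ, g ^ i = h)
    (h5 : orderOf g = 5) (hQ : Nat.card Q = 5) {V : Type v} [AddCommGroup V] [Module k V]
    (ρ : Representation k Q V) :
    (Module.Finite k V ∧ IsIndecomposableRep ρ ∧ HasLoewyLength ρ 3) ↔
      Nonempty (ρ.Equiv (radicalPowerRep k Q 2)) := by
  have hg5 : g ^ 5 = 1 := h5 ▸ pow_orderOf_eq_one g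
  constructor
  · rintro ⟨-, h1, h2⟩
    obtain ⟨h3, h4⟩ := (hasLoewyLength_iff hg hg5 ρ 2).mp h2
    exact nonempty_equiv_of_isJordanBlock hg (h1.isJordanBlock hg h3 h4)
      (isJordanBlock_radicalPowerRep hg h5 hQ)
  · rintro ⟨e⟩
    have h : IsJordanBlock (ρ g - 1) 2 :=
      (isJordanBlock_radicalPowerRep hg h5 hQ).of_equiv e.toLinearEquiv fun v => by
        have := IntertwiningMap.isIntertwining _ _ e.toIntertwiningMap g v
        change e.toIntertwiningMap (ρ g v - v) = _ - _
        rw [map_sub, this]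
        rfl
    refine ⟨h.finite, isIndecomposableRep_of_isJordanBlock h, (hasLoewyLength_iff hg hg5 ρ 2).mpr
      ⟨h.1, fun h0 => ?_⟩⟩
    obtain ⟨-, v, hv, -⟩ := h
    exact hv (by rw [h0]; rfl)

/-- An eight-dimensional representation with two blocks, one of size five, has a direct summand
that is a block of size three. -/
theorem HasTwoBlocks.exists_retract (hg : ∀ h, ∃ i : ℕ, g ^ i = h) [FiniteDimensional k V]
    (hρ : HasTwoBlocks (ρ g)) (hV : Module.finrank k V = 8) (hσ : IsJordanBlock (σ g - 1) 2) :
    ∃ (a : ρ.IntertwiningMap σ) (b : σ.IntertwiningMap ρ),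
      LinearMap.trace k V (b.toLinearMap ∘ₗ a.toLinearMap) = 3 := by
  obtain ⟨v, hv⟩ : ∃ v, ((ρ g - 1) ^ 4 : Module.End k V) v ≠ 0 := by
    by_contra! h
    exact hρ.pow_ne_zero (LinearMap.ext h)
  have h0 : (ρ g - 1) ^ (4 + 1) = 0 := hρ.pow_eq_zero
  obtain ⟨e, hae, hev, hspan, c, hc⟩ := Module.End.exists_projection h0 hv
  have hee : ∀ w, e (e w) = e w := fun w => Module.End.eq_self_of_mem_span hae hev (hspan w)
  have heg : ∀ v, e (ρ g v) = ρ g (e v) := by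
    intro v
    have := LinearMap.congr_fun hae v
    simp only [Module.End.mul_apply, LinearMap.sub_apply, map_sub, Module.End.one_apply] at this
    exact (sub_left_injective this).symm
  have hcomm := commute_of_commute_generator hg heg
  let M : Subrepresentation ρ := ⟨LinearMap.ker e, fun h w hw => by
    rw [LinearMap.mem_ker] at hw ⊢
    rw [hcomm, hw, map_zero]⟩
  let p : ρ.IntertwiningMap M.toRepresentation :=
    ⟨(LinearMap.id - e).codRestrict _ fun w => LinearMap.mem_ker.mpr <| by
      rw [LinearMap.sub_apply, map_sub, LinearMap.id_apply, hee, sub_self], fun h =>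
      LinearMap.ext fun w => Subtype.ext <| by
        change ρ h w - e (ρ h w) = ρ h (w - e w)
        rw [hcomm, map_sub]⟩
  let j : M.toRepresentation.IntertwiningMap ρ := ⟨M.toSubmodule.subtype, fun _ => rfl⟩
  -- The projection onto the block of size 5 has trace a multiple of 5, so the complementary one has
  -- trace 8 = 3.
  have htr : LinearMap.trace k V (j.toLinearMap ∘ₗ p.toLinearMap) = 3 := by
    have : j.toLinearMap ∘ₗ p.toLinearMap = LinearMap.id - e := rfl
    rw [this, map_sub, LinearMap.trace_id, hc, hV]
    have := five_eq_zero (k := k)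
    push_cast
    linear_combination (1 - c) * this
  have hM : IsJordanBlock (M.toRepresentation g - 1) 2 := by
    have hli := Module.End.linearIndependent_pow_apply h0 hv
    have hrange : LinearMap.range e =
        Submodule.span k (Set.range fun i : Fin (4 + 1) => ((ρ g - 1) ^ (i : ℕ) : Module.End k V) v) := by
      ext w
      exact ⟨by rintro ⟨w, rfl⟩; exact hspan w, fun hw =>
        ⟨w, Module.End.eq_self_of_mem_span hae hev hw⟩⟩
    refine IsJordanBlock.of_finrank_ker_le ⟨5, ?_⟩ ?_ ?_
    · have hpow : ∀ (i : ℕ) (x : M.toSubmodule),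
          (((M.toRepresentation g - 1) ^ i : Module.End k _) x).1 =
            ((ρ g - 1) ^ i : Module.End k V) x.1 := by
        intro i
        induction i with
        | zero => exact fun x => rfl
        | succ i ih =>
          intro x
          rw [pow_succ, Module.End.mul_apply, ih, pow_succ, Module.End.mul_apply]
          rfl
      refine LinearMap.ext fun x => Subtype.ext ?_
      rw [hpow, hρ.pow_eq_zero]
      rfl
    · have := LinearMap.finrank_range_add_finrank_ker e
      rw [hrange, finrank_span_eq_card hli, Fintype.card_fin, hV] at this
      change Module.finrank k (LinearMap.ker e) = 3
      lia
    -- The last vector of the long chain is fixed but lies outside the complement. So the fixed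
    -- space of the complement is at most a line, and the complement is a single block.
    · have hlt : (LinearMap.ker (M.toRepresentation g - 1)).map M.toSubmodule.subtype <
          LinearMap.ker (ρ g - 1) := by
        refine lt_of_le_of_ne ?_ fun heq => hv ?_
        · rintro _ ⟨x, hx, rfl⟩
          exact congrArg Subtype.val (LinearMap.mem_ker.mp hx)
        · have h1 : ((ρ g - 1) ^ 4 : Module.End k V) v ∈ LinearMap.ker (ρ g - 1) := by
            rw [LinearMap.mem_ker, ← Module.End.mul_apply, ← pow_succ', h0]
            rfl
          rw [← heq] at h1
          obtain ⟨x, -, hx⟩ := h1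
          have h2 : e (((ρ g - 1) ^ 4 : Module.End k V) v) = ((ρ g - 1) ^ 4 : Module.End k V) v :=
            Module.End.eq_self_of_mem_span hae hev
              (Submodule.subset_span ⟨(4 : Fin (4 + 1)), rfl⟩)
          rw [← h2, ← hx]
          exact LinearMap.mem_ker.mp x.2
      have h1 := Submodule.finrank_lt_finrank_of_lt hlt
      rw [Submodule.finrank_map_subtype_eq] at h1
      have := hρ.finrank_ker_le
      lia
  obtain ⟨f⟩ := nonempty_equiv_of_isJordanBlock hg hM hσ
  refine ⟨f.toIntertwiningMap.comp p, j.comp f.symm.toIntertwiningMap, ?_⟩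
  rw [← htr]
  congr 1
  refine LinearMap.ext fun w => ?_
  change j (f.symm (f (p w))) = j (p w)
  rw [f.symm_apply_apply]

end CyclicGroup

/-! ### Induction and relative projectivity -/

section Induction

open Representation

variable {k : Type u} [Field k] {G : Type*} [Group G] {H : Subgroup G}
  {V : Type*} [AddCommGroup V] [Module k V] {W : Type*} [AddCommGroup W] [Module k W]
  {ρ : Representation k G V} {σ : Representation k H W}

/-- The restriction of a representation to a subgroup. -/
abbrev Representation.restrictSubgroup (ρ : Representation k G V) (H : Subgroup G) :
    Representation k H V :=
  ρ.comp H.subtype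

/-- Induction is realised by coinvariants for left translation by `H`. This is why Frobenius
reciprocity and the transfer below involve inverses of coset representatives. -/
theorem Representation.IndV.mk_mul (h : H) (t : G) (w : W) :
    IndV.mk H.subtype σ (h * t) (σ h w) = IndV.mk H.subtype σ t w := by
  have := Coinvariants.mk_self_apply (Representation.tprod ((leftRegular k G).comp H.subtype) σ) h
    (MonoidAlgebra.single t 1 ⊗ₜ w)
  simpa using this

theorem Representation.IndV.mk_mul_inv (h : H) (t : G) (w : W) :
    IndV.mk H.subtype σ (h * t) w = IndV.mk H.subtype σ t (σ h⁻¹ w) := by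
  rw [← IndV.mk_mul h t, ← Module.End.mul_apply, ← map_mul, mul_inv_cancel, map_one,
    Module.End.one_apply]

/-- The universal property of the space underlying the induced representation. -/
noncomputable def Representation.IndV.desc {X : Type*} [AddCommGroup X] [Module k X]
    (F : G → W →ₗ[k] X) (hF : ∀ (h : H) t w, F (h * t) (σ h w) = F t w) :
    IndV H.subtype σ →ₗ[k] X :=
  Coinvariants.lift _
    (TensorProduct.lift <| (Finsupp.lift _ _ _ F) ∘ₗ
      (MonoidAlgebra.coeffLinearEquiv k).toLinearMap)
    fun h => TensorProduct.ext <| MonoidAlgebra.lhom_ext' fun t => LinearMap.ext_ring <|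
      LinearMap.ext fun w => by simpa [ofMulAction_single] using hF h t w

@[simp] theorem Representation.IndV.desc_mk {X : Type*} [AddCommGroup X] [Module k X]
    (F : G → W →ₗ[k] X) (hF : ∀ (h : H) t w, F (h * t) (σ h w) = F t w) (t : G) (w : W) :
    IndV.desc F hF (IndV.mk H.subtype σ t w) = F t w := by
  simp [IndV.desc]

theorem Representation.IntertwiningMap.apply_mul_inv (b : σ.IntertwiningMap (ρ.restrictSubgroup H))
    (h : H) (t : G) (w : W) :
    (ρ (h * t)⁻¹ ∘ₗ b.toLinearMap) (σ h w) = (ρ t⁻¹ ∘ₗ b.toLinearMap) w := by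
  change ρ (h * t)⁻¹ (b (σ h w)) = ρ t⁻¹ (b w)
  rw [b.isIntertwining]
  change (ρ (h * t)⁻¹ * ρ h) (b w) = _
  rw [← map_mul, mul_inv_rev, inv_mul_cancel_right]

/-- The map from the induced representation given by Frobenius reciprocity. -/
noncomputable def indLift (b : σ.IntertwiningMap (ρ.restrictSubgroup H)) :
    (ind H.subtype σ).IntertwiningMap ρ where
  toLinearMap := IndV.desc (fun t => ρ t⁻¹ ∘ₗ b.toLinearMap) b.apply_mul_inv
  isIntertwining' g := IndV.hom_ext _ _ fun t => LinearMap.ext fun w => by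
    change IndV.desc _ b.apply_mul_inv (ind H.subtype σ g (IndV.mk H.subtype σ t w)) =
      ρ g (IndV.desc _ b.apply_mul_inv (IndV.mk H.subtype σ t w))
    rw [ind_mk, IndV.desc_mk, IndV.desc_mk, mul_inv_rev, inv_inv, map_mul]
    rfl

theorem indLift_mk (b : σ.IntertwiningMap (ρ.restrictSubgroup H)) (t : G) (w : W) :
    indLift b (IndV.mk H.subtype σ t w) = ρ t⁻¹ (b w) :=
  IndV.desc_mk _ b.apply_mul_inv t w

/-- The component of the transfer to the induced representation that belongs to a coset. -/
noncomputable def transferComponent (a : (ρ.restrictSubgroup H).IntertwiningMap σ) :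
    G ⧸ H → V →ₗ[k] IndV H.subtype σ :=
  Quotient.lift (fun t : G => IndV.mk H.subtype σ t⁻¹ ∘ₗ a.toLinearMap ∘ₗ ρ t⁻¹) <| by
    intro s t hst
    obtain ⟨h, hh⟩ : ∃ h : H, t⁻¹ = h * s⁻¹ :=
      ⟨⟨t⁻¹ * s, by
        have := H.inv_mem (QuotientGroup.leftRel_apply.mp hst)
        rwa [mul_inv_rev, inv_inv] at this⟩, by simp⟩
    refine LinearMap.ext fun v => ?_
    change IndV.mk H.subtype σ s⁻¹ (a (ρ s⁻¹ v)) = IndV.mk H.subtype σ t⁻¹ (a (ρ t⁻¹ v))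
    rw [hh, IndV.mk_mul_inv, ← a.isIntertwining]
    change _ = IndV.mk H.subtype σ s⁻¹ (a ((ρ (h : G)⁻¹ * ρ (h * s⁻¹)) v))
    rw [← map_mul, inv_mul_cancel_left]

theorem transferComponent_mk (a : (ρ.restrictSubgroup H).IntertwiningMap σ) (t : G) (v : V) :
    transferComponent a (t : G ⧸ H) v = IndV.mk H.subtype σ t⁻¹ (a (ρ t⁻¹ v)) := rfl

theorem transferComponent_apply (a : (ρ.restrictSubgroup H).IntertwiningMap σ) (g : G) (q : G ⧸ H)
    (v : V) : transferComponent a (g • q) (ρ g v) = ind H.subtype σ g (transferComponent a q v) := by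
  induction q using QuotientGroup.induction_on with
  | H t =>
    rw [MulAction.Quotient.smul_coe, transferComponent_mk, transferComponent_mk, ind_mk,
      ← Module.End.mul_apply, ← map_mul, smul_eq_mul, mul_inv_rev, inv_mul_cancel_right]

/-- The transfer to the induced representation. -/
noncomputable def transferMap [Fintype (G ⧸ H)] (a : (ρ.restrictSubgroup H).IntertwiningMap σ) :
    ρ.IntertwiningMap (ind H.subtype σ) where
  toLinearMap := ∑ q, transferComponent a q
  isIntertwining' g := LinearMap.ext fun v => by
    change (∑ q, transferComponent a q) (ρ g v) = ind H.subtype σ g ((∑ q, transferComponent a q) v)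
    rw [LinearMap.sum_apply, LinearMap.sum_apply, map_sum,
      ← Equiv.sum_comp (MulAction.toPerm g : Equiv.Perm (G ⧸ H))]
    exact Finset.sum_congr rfl fun q _ => transferComponent_apply a g q v

/-- The composite is a sum over cosets of conjugates of `b ∘ a`, all with the same trace. -/
theorem trace_indLift_transferMap [Fintype (G ⧸ H)] (a : (ρ.restrictSubgroup H).IntertwiningMap σ)
    (b : σ.IntertwiningMap (ρ.restrictSubgroup H)) :
    LinearMap.trace k V ((indLift b).toLinearMap ∘ₗ (transferMap a).toLinearMap) =
      Fintype.card (G ⧸ H) * LinearMap.trace k V (b.toLinearMap ∘ₗ a.toLinearMap) := by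
  have h1 : (indLift b).toLinearMap ∘ₗ (transferMap a).toLinearMap =
      ∑ q, (indLift b).toLinearMap ∘ₗ transferComponent a q := LinearMap.ext fun v => by
    change indLift b ((∑ q, transferComponent a q) v) = _
    rw [LinearMap.sum_apply, map_sum, LinearMap.sum_apply]
    rfl
  have h2 : ∀ q, LinearMap.trace k V ((indLift b).toLinearMap ∘ₗ transferComponent a q) =
      LinearMap.trace k V (b.toLinearMap ∘ₗ a.toLinearMap) := by
    intro q
    induction q using QuotientGroup.induction_on with
    | H t =>
      have : (indLift b).toLinearMap ∘ₗ transferComponent a (t : G ⧸ H) =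
          ρ t * ((b.toLinearMap ∘ₗ a.toLinearMap) * ρ t⁻¹) := LinearMap.ext fun v => by
        change indLift b (transferComponent a (t : G ⧸ H) v) = _
        rw [transferComponent_mk, indLift_mk, inv_inv]
        rfl
      rw [this, LinearMap.trace_mul_comm, mul_assoc, ← map_mul, inv_mul_cancel, map_one, mul_one]
  rw [h1, map_sum, Finset.sum_congr rfl fun q _ => h2 q, Finset.sum_const, Finset.card_univ,
    nsmul_eq_mul]

/-- The composite through the induced module is a scalar whose trace is the index times the trace of
`b ∘ a`. If that is nonzero, the scalar can be inverted and the composite splits. -/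
theorem HasScalarEndomorphisms.isDirectSummandOf_ind [Finite (G ⧸ H)]
    (hρ : HasScalarEndomorphisms ρ) (a : (ρ.restrictSubgroup H).IntertwiningMap σ)
    (b : σ.IntertwiningMap (ρ.restrictSubgroup H)) (hH : (H.index : k) ≠ 0)
    (hab : LinearMap.trace k V (b.toLinearMap ∘ₗ a.toLinearMap) ≠ 0) :
    IsDirectSummandOf ρ (ind H.subtype σ) := by
  have := Fintype.ofFinite (G ⧸ H)
  obtain ⟨c, hc⟩ := hρ ((indLift b).comp (transferMap a))
  have h1 := trace_indLift_transferMap a b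
  have h2 : (indLift b).toLinearMap ∘ₗ (transferMap a).toLinearMap = c • LinearMap.id :=
    LinearMap.ext hc
  have h0 : c ≠ 0 := by
    rintro rfl
    rw [h2, zero_smul, map_zero, ← Nat.card_eq_fintype_card] at h1
    exact mul_ne_zero hH hab h1.symm
  refine ⟨transferMap a, c⁻¹ • indLift b, fun v => ?_⟩
  change c⁻¹ • (indLift b).comp (transferMap a) v = v
  rw [hc, smul_smul, inv_mul_cancel₀ h0, one_smul]

/-- The projection onto the component of the identity element is a Higman element: its conjugates
are the projections onto all components. -/
theorem hasHigmanElement_ind_bot [Fintype G] (σ : Representation k (⊥ : Subgroup G) W) :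
    HasHigmanElement (ind (⊥ : Subgroup G).subtype σ) := by
  classical
  let θ : IndV (⊥ : Subgroup G).subtype σ →ₗ[k] IndV (⊥ : Subgroup G).subtype σ :=
    IndV.desc (fun t => if t = 1 then IndV.mk _ σ t else 0) fun h t w => by
      obtain rfl : h = 1 := Subsingleton.elim _ _
      simp
  refine ⟨θ, fun v => ?_⟩
  have : ∑ g, ind (⊥ : Subgroup G).subtype σ g ∘ₗ θ ∘ₗ ind (⊥ : Subgroup G).subtype σ g⁻¹ =
      LinearMap.id := by
    refine IndV.hom_ext _ _ fun t => LinearMap.ext fun w => ?_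
    rw [LinearMap.comp_apply, LinearMap.sum_apply, Finset.sum_eq_single t⁻¹]
    · rw [LinearMap.comp_apply, LinearMap.comp_apply, ind_mk, IndV.desc_mk]
      simp only [inv_inv, mul_inv_cancel, if_true]
      rw [ind_mk, inv_inv, one_mul]
      rfl
    · intro g _ hg
      rw [LinearMap.comp_apply, LinearMap.comp_apply, ind_mk, IndV.desc_mk, inv_inv, if_neg,
        LinearMap.zero_apply, map_zero]
      exact fun h => hg (eq_inv_of_mul_eq_one_right h)
    · simp
  have h := LinearMap.congr_fun this v
  rw [LinearMap.sum_apply] at h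
  exact h

/-- The projection attached to a decomposition is a scalar, and it is the identity on one summand
and zero on the other. -/
theorem HasScalarEndomorphisms.isIndecomposableRep [Nontrivial V]
    (hρ : HasScalarEndomorphisms ρ) : IsIndecomposableRep ρ := by
  refine ⟨inferInstance, fun A B hAB => ?_⟩
  have hs : A.toSubmodule ⊔ B.toSubmodule = ⊤ :=
    congrArg Subrepresentation.toSubmodule (codisjoint_iff.mp hAB.codisjoint)
  have hd : A.toSubmodule ⊓ B.toSubmodule = ⊥ :=
    congrArg Subrepresentation.toSubmodule (disjoint_iff.mp hAB.disjoint)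
  have hc : IsCompl A.toSubmodule B.toSubmodule := ⟨disjoint_iff.mpr hd, codisjoint_iff.mpr hs⟩
  let f := Submodule.projection _ _ hc
  have hfA : ∀ a ∈ A.toSubmodule, f a = a := fun a ha => by
    exact Submodule.projection_apply_left hc ⟨a, ha⟩
  have hfB : ∀ b ∈ B.toSubmodule, f b = 0 := fun b hb => by
    exact Submodule.projection_apply_right hc ⟨b, hb⟩
  let φ : ρ.IntertwiningMap ρ := ⟨f, fun g => LinearMap.ext fun v => by
    obtain ⟨a, ha, b, hb, rfl⟩ := Submodule.mem_sup.mp (hs ▸ Submodule.mem_top :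
      v ∈ A.toSubmodule ⊔ B.toSubmodule)
    change f (ρ g (a + b)) = ρ g (f (a + b))
    rw [map_add, map_add, map_add, hfA a ha, hfB b hb, hfA _ (A.apply_mem_toSubmodule g ha),
      hfB _ (B.apply_mem_toSubmodule g hb), add_zero, add_zero]⟩
  obtain ⟨c, hc⟩ := hρ φ
  by_cases h0 : c = 0
  · left
    refine Subrepresentation.toSubmodule_injective ((Submodule.eq_bot_iff _).mpr fun a ha => ?_)
    rw [← hfA a ha]
    exact (hc a).trans (by rw [h0, zero_smul])
  · right
    refine Subrepresentation.toSubmodule_injective ((Submodule.eq_bot_iff _).mpr fun b hb => ?_)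
    have := (hc b).symm.trans (hfB b hb)
    exact (smul_eq_zero.mp this).resolve_left h0

end Induction

/-! ### The vertex and the source -/

section Vertex

open Representation

variable {k : Type u} [Field k] [CharP k 5] {V : Type v} [AddCommGroup V] [Module k V]
  {ρ : Representation k (Equiv.Perm (Fin 5)) V}

/-- Since 5 divides 120 exactly once, `P` is cyclic of order 5, and an element of order 5 in five
letters is a 5-cycle, conjugate to the standard rotation. -/
theorem exists_generator_sylow_five (P : Sylow 5 (Equiv.Perm (Fin 5))) :
    Nat.card (P : Subgroup (Equiv.Perm (Fin 5))) = 5 ∧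
      ∃ g : (P : Subgroup (Equiv.Perm (Fin 5))), orderOf g = 5 ∧ (∀ h, ∃ i : ℕ, g ^ i = h) ∧
        IsConj (finRotate 5) (g : Equiv.Perm (Fin 5)) := by
  have hG : Nat.card (Equiv.Perm (Fin 5)) = 120 := by
    rw [Nat.card_eq_fintype_card, Fintype.card_perm, Fintype.card_fin]
    rfl
  have hP : Nat.card (P : Subgroup (Equiv.Perm (Fin 5))) = 5 := by
    obtain ⟨n, hn⟩ := IsPGroup.iff_card.mp P.2
    have h1 := Subgroup.card_mul_index (P : Subgroup (Equiv.Perm (Fin 5)))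
    rw [hn, hG] at h1
    match n, hn, h1 with
    | 0, _, h1 => exact absurd ⟨24, by lia⟩ P.not_dvd_index
    | 1, hn, _ => exact hn
    | n + 2, _, h1 =>
      have : 5 ^ 2 ∣ 120 := ⟨5 ^ n * (P : Subgroup (Equiv.Perm (Fin 5))).index, by rw [← h1]; ring⟩
      exact absurd this (by norm_num)
  have : IsCyclic (P : Subgroup (Equiv.Perm (Fin 5))) := isCyclic_of_prime_card hP
  obtain ⟨g, hg⟩ := IsCyclic.exists_generator (α := (P : Subgroup (Equiv.Perm (Fin 5))))
  have h5 : orderOf g = 5 := by rw [orderOf_eq_card_of_forall_mem_zpowers hg, hP]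
  refine ⟨hP, g, h5, fun h => ?_, ?_⟩
  · exact (mem_powers_iff_mem_zpowers.mpr (hg h))
  · have h5' : orderOf (g : Equiv.Perm (Fin 5)) = 5 := by rw [Subgroup.orderOf_coe, h5]
    have hc := Equiv.Perm.isCycle_of_prime_order'' (by simpa using Nat.prime_five)
      (h5'.trans (Fintype.card_fin 5).symm)
    rw [isCycle_finRotate.isConj_iff hc, ← hc.orderOf, h5', support_finRotate]
    simp

variable (k) in
theorem index_sylow_ne_zero (P : Sylow 5 (Equiv.Perm (Fin 5))) :
    ((P : Subgroup (Equiv.Perm (Fin 5))).index : k) ≠ 0 := by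
  rw [Ne, CharP.cast_eq_zero_iff k 5]
  exact P.not_dvd_index

variable (e : ρ.Equiv (totalMap k 2).ker.toRepresentation)
include e

theorem hasScalarEndomorphisms_of_equiv : HasScalarEndomorphisms ρ :=
  hasScalarEndomorphisms_ker_totalMap_two.congr e.symm

/-- Relative projectivity to `P` follows from the trace criterion with identity maps, as the index
and the dimension are invertible. The only proper subgroup of `P` is trivial, and projectivity
relative to it would make the dimension zero in k. -/
theorem isVertex_sylow (P : Sylow 5 (Equiv.Perm (Fin 5))) :
    IsVertex (P : Subgroup (Equiv.Perm (Fin 5))) ρ := by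
  have hfin := finite_of_equiv_ker_totalMap e
  have h3 := finrank_eq_of_equiv_ker_totalMap e
  have hs := hasScalarEndomorphisms_of_equiv e
  have : Nontrivial V := by
    by_contra h
    rw [not_nontrivial_iff_subsingleton] at h
    rw [Module.finrank_zero_of_subsingleton, Nat.cast_zero] at h3
    exact three_ne_zero_of_charP_five h3.symm
  refine ⟨hs.isIndecomposableRep, ?_, fun H hH hHP => ?_⟩
  · refine hs.isDirectSummandOf_ind (IntertwiningMap.id _) (IntertwiningMap.id _)
      (index_sylow_ne_zero k P) ?_
    have : (IntertwiningMap.id (ρ.restrictSubgroup P)).toLinearMap ∘ₗ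
      (IntertwiningMap.id (ρ.restrictSubgroup P)).toLinearMap = LinearMap.id := rfl
    rw [this, LinearMap.trace_id, h3]
    exact three_ne_zero_of_charP_five
  · obtain ⟨hP, -⟩ := exists_generator_sylow_five P
    rcases (Nat.dvd_prime Nat.prime_five).mp (hP ▸ Subgroup.card_dvd_of_le hHP) with h | h
    · obtain rfl := Subgroup.card_eq_one.mp h
      obtain ⟨i, q, hiq⟩ := hH
      have hρ := (hasHigmanElement_ind_bot _).of_retract i q hiq
      have h0 := hρ.finrank_eq_zero card_perm_eq_zero
      rw [h3] at h0
      exact absurd h0 three_ne_zero_of_charP_five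
    · exact (Subgroup.eq_of_le_of_card_ge hHP (by rw [h, hP])).ge

/-- The restriction to `P` splits off a block of size 3 through maps whose composite has trace 3, so
the trace criterion applies to that block. -/
theorem isSource_sylow (P : Sylow 5 (Equiv.Perm (Fin 5))) :
    IsSource (P : Subgroup (Equiv.Perm (Fin 5))) ρ
      (radicalPowerRep k (P : Subgroup (Equiv.Perm (Fin 5))) 2) := by
  have hfin := finite_of_equiv_ker_totalMap e
  obtain ⟨hP, g, h5, hg, hconj⟩ := exists_generator_sylow_five P
  have hblock := isJordanBlock_radicalPowerRep (k := k) hg h5 hP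
  refine ⟨isVertex_sylow e P, hblock.finite, isIndecomposableRep_of_isJordanBlock hblock, ?_⟩
  have htwo := hasTwoBlocks_finRotate e
  have hV := htwo.finrank_eq (finrank_eq_of_equiv_ker_totalMap e)
  obtain ⟨a, b, hab⟩ := HasTwoBlocks.exists_retract (ρ := ρ.restrictSubgroup P) hg
    (htwo.conj hconj) hV hblock
  exact (hasScalarEndomorphisms_of_equiv e).isDirectSummandOf_ind a b (index_sylow_ne_zero k P)
    (by rw [hab]; exact three_ne_zero_of_charP_five)

end Vertex

theorem proposition4p2 (k : Type u) [Field k] [CharP k 5]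
    (U : Type u) [AddCommGroup U] [Module k U]
    (ρ : Representation k (Equiv.Perm (Fin 5)) U)
    (hU : IsHellerTranslateSq (simpleRep k partition2111 5) ρ) :
    (¬ HasSpechtFiltration (ρ.tprod ρ) ∧ ¬ HasDualSpechtFiltration (ρ.tprod ρ)) ∧
    Nonempty (ExtRep ρ ρ.dual 1 ≃ₗ[k] k) ∧
    ¬ LiftsToCharZero.{w} ρ ∧
    ∀ P : Sylow 5 (Equiv.Perm (Fin 5)),
      IsVertex (P : Subgroup (Equiv.Perm (Fin 5))) ρ ∧
      IsSource (P : Subgroup (Equiv.Perm (Fin 5))) ρ (radicalPowerRep k P 2) ∧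
      ∀ (N : Type u) [AddCommGroup N] [Module k N] (τ : Representation k P N),
        (Module.Finite k N ∧ IsIndecomposableRep τ ∧ HasLoewyLength τ 3) ↔
          Nonempty (τ.Equiv (radicalPowerRep k P 2)) := by
  obtain ⟨e⟩ := hU.nonempty_equiv
  have := finite_of_equiv_ker_totalMap e
  refine ⟨⟨not_hasSpechtFiltration_tprod e, not_hasDualSpechtFiltration_tprod e⟩,
    nonempty_extRep_dual_linearEquiv e, not_liftsToCharZero e, fun P =>
      ⟨isVertex_sylow e P, isSource_sylow e P, fun N _ _ τ => ?_⟩⟩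
  obtain ⟨hP, g, h5, hg, -⟩ := exists_generator_sylow_five P
  exact isIndecomposableRep_and_hasLoewyLength_iff hg h5 hP τ
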